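/- Let $d\in\mathbb N$ and let $\mathcal D=\mathcal D(\mathbb R^d)$ be the space of complex-valued compactly supported smooth functions, $\mathcal D'$ its dual, $\mathcal D(K)=\{\phi\in\mathcal D:\operatorname{supp}\phi\subseteq K\}$, and for $L\in\mathbb N=\{0,1,2,\dots\}$ let $\mathcal D_L(K)$ be the set of $\phi\in\mathcal D(K)$ with $\int x^\alpha\phi(x)\,dx=0$ for all $|\alpha|<L$. For $\phi\in\mathcal D$ put $\phi_j=2^{jd}\phi(2^j\,\cdot\,)$, $j\in\mathbb N$. A pair $(\chi^0,\chi^1)\in\mathcal D\times\mathcal D$ has the *moment-wise decomposition factorization property* (MDFP) if there is a compact $K\subset\mathbb R^d$ with non-empty interior such that for every $L\in\mathbb N$ there exist non-trivial pairs $(\varphi^\ell,\psi^\ell)\in\mathcal D(K)\times\mathcal D_L(K)$, $\ell\in\{0,1\}$ (that is, $(\varphi^\ell,\psi^\ell)\neq(0,0)$), with $$2^d\varphi^0(2\,\cdot\,)-\varphi^0=\Delta\psi^0,\qquad \int_{\mathbb R^d}\varphi^0(x)\,dx=1,$$ $$\varphi^0=\chi^0*\varphi^0+\chi^1*\varphi^1,\qquad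 \psi^0=\chi^0*\psi^0+\chi^1*\psi^1 .$$ Let $\omega:\mathbb R^d\to[0,\infty)$ be a continuous function (monotonicity is not required) for which there is $C>0$ with $\omega(x+y)\le C\,\omega(x)$ for all $x\in\mathbb R^d$ and $|y|\le1$. For $p\in[1,\infty]$ define $$\mathcal K^p_\omega=\{f\in C^\infty(\mathbb R^d): f^{(\alpha)}e^{n\omega}\in L^p(\mathbb R^d)\text{ for all }n\in\mathbb N,\ \alpha\in\mathbb N^d\},$$ $$\mathcal O_C'(\mathcal D,\mathcal K^p_\omega)=\{f\in\mathcal D': f*\phi\in\mathcal K^p_\omega\text{ for all }\phi\in\mathcal D\},$$ $$\mathcal O_M(\mathcal K^\infty_\omega,\mathcal K^p_\omega)=\{f\in C^\infty(\mathbb R^d): f\cdot\phi\in\mathcal K^p_\omega\text{ for all }\phi\in\mathcal K^\infty_\omega\}.$$ **Theorem 1.1.** Let $p\in[1,\infty]$, let $\omega$ be as above, and let $(\chi^0,\chi^1)\in\mathcal D\times\mathcal D$ have the MDFP. For every $f\in\mathcal D'$: (i) $f\in\mathcal K^p_\omega$ if and only if there exists $r>0$ such that for all $n\in\mathbb N$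 and $\alpha\in\mathbb N^d$ $$\sup_{j\in\mathbb N,\ \ell\in\{0,1\}}2^{-rj}\,\bigl\|\partial^\alpha[f*\chi^\ell_j]\,e^{n\omega}\bigr\|_{L^p}<\infty .$$ (ii) $f\in\mathcal O_C'(\mathcal D,\mathcal K^p_\omega)$ if and only if for all $n\in\mathbb N$ there exists $r>0$ such that $$\sup_{j\in\mathbb N,\ \ell\in\{0,1\}}2^{-rj}\,\bigl\|[f*\chi^\ell_j]\,e^{n\omega}\bigr\|_{L^p}<\infty .$$ (iii) $f\in\mathcal O_M(\mathcal K^\infty_\omega,\mathcal K^p_\omega)$ if and only if there exists $r>0$ such that for all $\alpha\in\mathbb N^d$ there is $n\in\mathbb N$ with $$\sup_{j\in\mathbb N,\ \ell\in\{0,1\}}2^{-rj}\,\bigl\|\partial^\alpha[f*\chi^\ell_j]\,e^{-n\omega}\bigr\|_{L^p}<\infty .$$ In (i) and (iii), $f\in\mathcal D'$ belongs to a space of functions if it is the distribution $\phi\mapsto\int g\phi$ of some $g$ in that space. -/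

import Mathlib

open MeasureTheory TopologicalSpace
open scoped Distributions ENNReal

noncomputable section

namespace Mollif

/-- The Euclidean space `ℝ^d`. -/
abbrev Eu (d : ℕ) : Type := EuclideanSpace ℝ (Fin d)

/-- The space `𝓓 = 𝓓(ℝ^d)` of complex-valued, compactly supported, smooth functions on `ℝ^d`. -/
abbrev TF (d : ℕ) : Type := 𝓓((⊤ : Opens (Eu d)), ℂ)

/-- The space `𝓓'` of distributions on `ℝ^d`: continuous complex-linear functionals on `𝓓`, where
`𝓓` carries its canonical LF topology. -/
abbrev Distr (d : ℕ) : Type := TF d →L[ℂ] ℂ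

/-- The partial derivative `∂^α g = ∂_1^{α_1} ⋯ ∂_d^{α_d} g` of a function `g` on `ℝ^d`.
(It is only applied to smooth functions, for which the order of differentiation is immaterial.) -/
def pderiv {d : ℕ} (α : Fin d → ℕ) (g : Eu d → ℂ) : Eu d → ℂ :=
  (List.finRange d).foldr
    (fun i h => (fun (u : Eu d → ℂ) (x : Eu d) =>
      fderiv ℝ u x (EuclideanSpace.single i (1 : ℝ)))^[α i] h) g

/-- The test function `y ↦ φ (x - y)`. -/
def reflTranslate {d : ℕ} (φ : TF d) (x : Eu d) : TF d where
  toFun := fun y => φ (x - y)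
  contDiff' := φ.contDiff.comp (contDiff_const.sub contDiff_id)
  hasCompactSupport' := φ.hasCompactSupport.comp_homeomorph (Homeomorph.subLeft x)
  tsupport_subset' := fun _ _ => trivial

/-- The rescaled test function `φ_j = 2^{jd} φ(2^j ·)`. -/
def dilate {d : ℕ} (φ : TF d) (j : ℕ) : TF d where
  toFun := fun y => (2 : ℂ) ^ (j * d) * φ ((2 : ℝ) ^ j • y)
  contDiff' := contDiff_const.mul (φ.contDiff.comp (contDiff_const_smul _))
  hasCompactSupport' :=
    (φ.hasCompactSupport.comp_homeomorph
      (Homeomorph.smulOfNeZero ((2 : ℝ) ^ j) (by positivity))).mul_left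
  tsupport_subset' := fun _ _ => trivial

/-- The convolution `f * φ` of a distribution and a test function, a (smooth) function:
`(f * φ)(x) = ⟨f, φ(x - ·)⟩`. -/
def dconv {d : ℕ} (f : Distr d) (φ : TF d) : Eu d → ℂ := fun x => f (reflTranslate φ x)

/-- The distribution `f` is the one given by the function `g`, i.e. `⟨f, φ⟩ = ∫ g φ`. -/
def Represents {d : ℕ} (g : Eu d → ℂ) (f : Distr d) : Prop :=
  ∀ φ : TF d, f φ = ∫ x, g x * φ x

/-- The space `𝓚^p_ω`: the smooth functions `g` with `∂^α g · e^{n ω} ∈ L^p` for all `n` and all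
multi-indices `α`. -/
def KSpace {d : ℕ} (ω : Eu d → ℝ) (p : ℝ≥0∞) : Set (Eu d → ℂ) :=
  {g | ContDiff ℝ ((⊤ : ℕ∞) : WithTop ℕ∞) g ∧ ∀ (n : ℕ) (α : Fin d → ℕ),
    MemLp (fun x => pderiv α g x * (Real.exp (n * ω x) : ℂ)) p volume}

/-- The convolutor space `𝓞_C'(𝓓, 𝓚^p_ω)`. -/
def ConvolutorSpace {d : ℕ} (ω : Eu d → ℝ) (p : ℝ≥0∞) : Set (Distr d) :=
  {f | ∀ φ : TF d, dconv f φ ∈ KSpace ω p}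

/-- The multiplier space `𝓞_M(𝓚^∞_ω, 𝓚^p_ω)`. -/
def MultiplierSpace {d : ℕ} (ω : Eu d → ℝ) (p : ℝ≥0∞) : Set (Eu d → ℂ) :=
  {g | ContDiff ℝ ((⊤ : ℕ∞) : WithTop ℕ∞) g ∧ ∀ φ ∈ KSpace ω ∞, (fun x => g x * φ x) ∈ KSpace ω p}

/-- `φ ∈ 𝓓(K)`. -/
def SupportedIn {d : ℕ} (K : Set (Eu d)) (φ : TF d) : Prop := tsupport φ ⊆ K

/-- `∫ x^α φ(x) dx = 0` for all multi-indices `α` with `|α| < L`. -/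
def MomentsVanish {d : ℕ} (L : ℕ) (φ : TF d) : Prop :=
  ∀ α : Fin d → ℕ, ∑ i, α i < L → ∫ x : Eu d, ((∏ i, x i ^ α i : ℝ) : ℂ) * φ x = 0

/-- The convolution `φ * ψ` of two test functions, as a function:
`(φ * ψ)(x) = ∫ φ(y) ψ(x - y) dy`. -/
def tconv {d : ℕ} (φ ψ : TF d) : Eu d → ℂ :=
  convolution (φ : Eu d → ℂ) (ψ : Eu d → ℂ) (ContinuousLinearMap.mul ℂ ℂ) volume

/-- The momentwise decomposition factorization property of a pair `(χ^0, χ^1)` of test functions. -/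
def MDFP {d : ℕ} (χ : Fin 2 → TF d) : Prop :=
  ∃ K : Set (Eu d), IsCompact K ∧ (interior K).Nonempty ∧
    ∀ L : ℕ, ∃ φ ψ : Fin 2 → TF d,
      (∀ ℓ, SupportedIn K (φ ℓ) ∧ SupportedIn K (ψ ℓ) ∧ MomentsVanish L (ψ ℓ) ∧
        (φ ℓ, ψ ℓ) ≠ (0, 0)) ∧
      (∀ x, (2 : ℂ) ^ d * φ 0 ((2 : ℝ) • x) - φ 0 x
        = Laplacian.laplacian (ψ 0 : Eu d → ℂ) x) ∧
      ∫ x, φ 0 x = 1 ∧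
      (∀ x, φ 0 x = tconv (χ 0) (φ 0) x + tconv (χ 1) (φ 1) x) ∧
      (∀ x, ψ 0 x = tconv (χ 0) (ψ 0) x + tconv (χ 1) (ψ 1) x)

end Mollif

end

/-!
The growth conditions are necessary and sufficient by the following three arguments.

*Sufficiency.* The functions `φ^0_j` of the MDFP form an approximate identity, whose increments are
`φ^0_{j+1} - φ^0_j = 4^{-j} Δ(ψ^0_j) = 4^{-j} Δ ∑_ℓ χ^ℓ_j * ψ^ℓ_j` (`MDFP.exists_decomposition`).
Hence `f` is the limit of the telescoping series with terms `4^{-j} ∑_ℓ Δ(f * χ^ℓ_j) * ψ^ℓ_j`.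
Convolution with `ψ^ℓ_j`, which has `L` vanishing moments, gains a factor `2^{-jL}` at the expense of
finitely many derivatives (`norm_cv_dilate_le`), and with `L > r` this beats the growth `2^{rj}`. The
local Sobolev inequality `exists_sobolev` bounds these derivatives by local averages, and local
averages are bounded on the weighted `L^p` spaces, up to a change of the weight from `e^{nω}` to
`e^{κnω}` (`wt_average_le`). If all derivatives of the `f * χ^ℓ_j` are controlled with the same `r`,
then the series converges to a smooth function representing `f` (`exists_smooth_representative`). For
convolutors, the derivatives and the vanishing moments are played off against a test function instead
(`mem_ConvolutorSpace_of_wt_le`); here `r` depends on the weight, and it matters that the supports in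
the MDFP do not depend on `L`, since `L` can only be chosen after the weight.

*Necessity for functions.* If `f` is given by a smooth function `g`, then the derivatives of `f * χ_j`
are local averages of those of `g`, uniformly in `j` (`exists_wt_ld_dconv_dilate_le`). For multipliers
this is combined with the description of the multiplier space as the space of all smooth functions
each of whose derivatives is in `L^p` for some weight `e^{-nω}`
(`MultiplierSpace.exists_wt_lt_top`, `mem_MultiplierSpace_of_wt_lt_top`), which is proved by testing
with a function `e^{-N(x) ω(x)}` whose exponent tends to infinity slowly.

*Necessity for convolutors.* This is a uniform boundedness argument. If the weighted norms of
`f * χ_j` grew faster than every `2^{kj}`, then `f` would map a bounded sequence of test functions to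
an unbounded one; but combining the sequence with coefficients in `ℓ^1` gives a lower semicontinuous
seminorm on a barrelled space, which is continuous (`exists_wt_dconv_le`).

Throughout, derivatives are taken along lists of coordinates, `ld l u`, rather than along
multi-indices.
-/

noncomputable section

namespace Mollif

variable {d : ℕ} {ω : Eu d → ℝ} {p : ℝ≥0∞}

/-! ### Iterated partial derivatives -/

/-- Smoothness (`C^∞`) of a function on `ℝ^d`. -/
abbrev Smooth (u : Eu d → ℂ) : Prop := ContDiff ℝ ((⊤ : ℕ∞) : WithTop ℕ∞) u

/-- The directional derivative `∂_v u`. -/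
def dirD (v : Eu d) (u : Eu d → ℂ) : Eu d → ℂ := fun x => fderiv ℝ u x v

/-- The partial derivative `∂_i u`. -/
def pd (i : Fin d) (u : Eu d → ℂ) : Eu d → ℂ := dirD (EuclideanSpace.single i (1 : ℝ)) u

/-- The iterated partial derivative `∂_{i_1} ⋯ ∂_{i_k} u` along a list `[i_1, …, i_k]` of
coordinates. -/
def ld (l : List (Fin d)) (u : Eu d → ℂ) : Eu d → ℂ := l.foldr pd u

@[simp] lemma ld_nil (u : Eu d → ℂ) : ld [] u = u := rfl

lemma ld_cons (i : Fin d) (l : List (Fin d)) (u : Eu d → ℂ) : ld (i :: l) u = pd i (ld l u) := rfl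

lemma ld_append (l l' : List (Fin d)) (u : Eu d → ℂ) : ld (l ++ l') u = ld l (ld l' u) := by
  simp [ld]

lemma Smooth.diff {u : Eu d → ℂ} (hu : Smooth u) : Differentiable ℝ u :=
  hu.differentiable (by simp)

lemma Smooth.dirD {u : Eu d → ℂ} (hu : Smooth u) (v : Eu d) : Smooth (dirD v u) :=
  (hu.fderiv_right (m := ((⊤ : ℕ∞) : WithTop ℕ∞)) (by simp)).clm_apply contDiff_const

lemma Smooth.pd {u : Eu d → ℂ} (hu : Smooth u) (i : Fin d) : Smooth (pd i u) := hu.dirD _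

lemma Smooth.ld {u : Eu d → ℂ} (hu : Smooth u) (l : List (Fin d)) : Smooth (ld l u) := by
  induction l with
  | nil => exact hu
  | cons i l ih => exact ih.pd i

lemma dirD_add {u v : Eu d → ℂ} (hu : Differentiable ℝ u) (hv : Differentiable ℝ v) (w : Eu d) :
    dirD w (fun x => u x + v x) = fun x => dirD w u x + dirD w v x := by
  funext x; simp only [dirD]; rw [fderiv_fun_add (hu x) (hv x)]; rfl

lemma pd_add {u v : Eu d → ℂ} (hu : Differentiable ℝ u) (hv : Differentiable ℝ v) (i : Fin d) :
    pd i (fun x => u x + v x) = fun x => pd i u x + pd i v x := dirD_add hu hv _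

lemma pd_sub {u v : Eu d → ℂ} (hu : Differentiable ℝ u) (hv : Differentiable ℝ v) (i : Fin d) :
    pd i (fun x => u x - v x) = fun x => pd i u x - pd i v x := by
  funext x; simp only [pd, dirD]; rw [fderiv_fun_sub (hu x) (hv x)]; rfl

lemma dirD_const_mul {u : Eu d → ℂ} (hu : Differentiable ℝ u) (c : ℂ) (w : Eu d) :
    dirD w (fun x => c * u x) = fun x => c * dirD w u x := by
  funext x; simp only [dirD]; rw [fderiv_const_mul (hu x)]; simp

lemma pd_const_mul {u : Eu d → ℂ} (hu : Differentiable ℝ u) (c : ℂ) (i : Fin d) :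
    pd i (fun x => c * u x) = fun x => c * pd i u x := dirD_const_mul hu c _

lemma dirD_sum {ι : Type*} (s : Finset ι) {u : ι → Eu d → ℂ} (hu : ∀ k, Differentiable ℝ (u k))
    (w : Eu d) : dirD w (fun x => ∑ k ∈ s, u k x) = fun x => ∑ k ∈ s, dirD w (u k) x := by
  funext x; simp only [dirD]
  rw [fderiv_fun_sum (fun k _ => hu k x)]; simp

lemma pd_sum {ι : Type*} (s : Finset ι) {u : ι → Eu d → ℂ} (hu : ∀ k, Differentiable ℝ (u k))
    (i : Fin d) : pd i (fun x => ∑ k ∈ s, u k x) = fun x => ∑ k ∈ s, pd i (u k) x :=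
  dirD_sum s hu _

lemma pd_mul {u v : Eu d → ℂ} (hu : Differentiable ℝ u) (hv : Differentiable ℝ v) (i : Fin d) :
    pd i (fun x => u x * v x) = fun x => pd i u x * v x + u x * pd i v x := by
  funext x; simp only [pd, dirD]; rw [fderiv_fun_mul (hu x) (hv x)]; simp; ring

lemma ld_sub {u v : Eu d → ℂ} (hu : Smooth u) (hv : Smooth v) (l : List (Fin d)) :
    ld l (fun x => u x - v x) = fun x => ld l u x - ld l v x := by
  induction l with
  | nil => rfl
  | cons i l ih => rw [ld_cons, ih, pd_sub (hu.ld l).diff (hv.ld l).diff]; rfl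

lemma ld_add {u v : Eu d → ℂ} (hu : Smooth u) (hv : Smooth v) (l : List (Fin d)) :
    ld l (fun x => u x + v x) = fun x => ld l u x + ld l v x := by
  induction l with
  | nil => rfl
  | cons i l ih => rw [ld_cons, ih, pd_add (hu.ld l).diff (hv.ld l).diff]; rfl

lemma ld_const_mul {u : Eu d → ℂ} (hu : Smooth u) (c : ℂ) (l : List (Fin d)) :
    ld l (fun x => c * u x) = fun x => c * ld l u x := by
  induction l with
  | nil => rfl
  | cons i l ih => rw [ld_cons, ih, pd_const_mul (hu.ld l).diff]; rfl

lemma ld_sum {ι : Type*} (s : Finset ι) {u : ι → Eu d → ℂ} (hu : ∀ k, Smooth (u k))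
    (l : List (Fin d)) : ld l (fun x => ∑ k ∈ s, u k x) = fun x => ∑ k ∈ s, ld l (u k) x := by
  induction l with
  | nil => rfl
  | cons i l ih => rw [ld_cons, ih, pd_sum s (fun k => ((hu k).ld l).diff)]; rfl

lemma dirD_dirD {u : Eu d → ℂ} (hu : Smooth u) (v w x : Eu d) :
    dirD v (dirD w u) x = fderiv ℝ (fderiv ℝ u) x v w := by
  have hd : Differentiable ℝ (fderiv ℝ u) :=
    (hu.fderiv_right (m := ((⊤ : ℕ∞) : WithTop ℕ∞)) (by simp)).differentiable (by simp)
  change fderiv ℝ (fun y => fderiv ℝ u y w) x v = _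
  rw [fderiv_clm_apply (hd x) (differentiableAt_const w)]
  simp

lemma dirD_comm {u : Eu d → ℂ} (hu : Smooth u) (v w : Eu d) :
    dirD v (dirD w u) = dirD w (dirD v u) := by
  funext x
  rw [dirD_dirD hu, dirD_dirD hu]
  have := (hu.contDiffAt (x := x)).isSymmSndFDerivAt
    (by simp only [minSmoothness_of_isRCLikeNormedField]; exact WithTop.coe_le_coe.mpr le_top)
  exact this v w

lemma pd_comm {u : Eu d → ℂ} (hu : Smooth u) (i j : Fin d) : pd i (pd j u) = pd j (pd i u) :=
  dirD_comm hu _ _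

lemma ld_perm {u : Eu d → ℂ} (hu : Smooth u) {l l' : List (Fin d)} (h : l.Perm l') :
    ld l u = ld l' u := by
  induction h with
  | nil => rfl
  | cons i _ ih => rw [ld_cons, ld_cons, ih]
  | swap i j l => exact pd_comm (hu.ld l) _ _
  | trans _ _ h1 h2 => exact h1.trans h2

lemma ld_pd {u : Eu d → ℂ} (hu : Smooth u) (l : List (Fin d)) (i : Fin d) :
    ld l (pd i u) = pd i (ld l u) := by
  have := ld_perm hu (l := l ++ [i]) (l' := i :: l) (List.perm_append_singleton i l)
  rwa [ld_append] at this

lemma pderiv_eq_ld (α : Fin d → ℕ) (u : Eu d → ℂ) :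
    pderiv α u = ld ((List.finRange d).flatMap fun i => List.replicate (α i) i) u := by
  unfold pderiv
  induction List.finRange d with
  | nil => rfl
  | cons i L ih =>
    rw [List.flatMap_cons, ld_append, ← ih, List.foldr_cons]
    generalize List.foldr _ u L = w
    induction α i with
    | zero => rfl
    | succ n ihn =>
      rw [Function.iterate_succ_apply', ihn, List.replicate_succ, ld_cons]
      rfl

/-- For smooth functions, derivatives along lists of coordinates and derivatives along
multi-indices are the same operators. -/
lemma ld_eq_pderiv {u : Eu d → ℂ} (hu : Smooth u) (l : List (Fin d)) :
    ld l u = pderiv (fun i => l.count i) u := by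
  rw [pderiv_eq_ld]
  refine ld_perm hu ?_
  rw [List.perm_iff_count]
  intro a
  rw [List.count_flatMap]
  have : ∀ L : List (Fin d), L.Nodup →
      (L.map (List.count a ∘ fun i => List.replicate (l.count i) i)).sum
        = if a ∈ L then l.count a else 0 := by
    intro L hL
    induction L with
    | nil => simp
    | cons b L ih =>
      have hb := List.nodup_cons.mp hL
      rw [List.map_cons, List.sum_cons, ih hb.2]
      by_cases hab : a = b
      · subst hab; simp [hb.1]
      · simp [List.count_replicate, hab, Ne.symm hab]
  rw [this _ (List.nodup_finRange d)]
  simp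

lemma forall_pderiv_iff {P : (Eu d → ℂ) → Prop} {u : Eu d → ℂ} (hu : Smooth u) :
    (∀ α, P (pderiv α u)) ↔ ∀ l, P (ld l u) := by
  constructor
  · intro h l; rw [ld_eq_pderiv hu]; exact h _
  · intro h α; rw [pderiv_eq_ld]; exact h _

lemma eu_eq_sum (v : Eu d) : v = ∑ i, v i • EuclideanSpace.single i (1 : ℝ) := by
  ext j
  simp [Pi.single_apply]

lemma fderiv_apply_eq_sum (u : Eu d → ℂ) (x v : Eu d) :
    fderiv ℝ u x v = ∑ i, (v i : ℂ) * pd i u x := by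
  conv_lhs => rw [eu_eq_sum v]
  rw [map_sum]
  refine Finset.sum_congr rfl fun i _ => ?_
  rw [map_smul]; simp [pd, dirD]

lemma dirD_eq_sum (u : Eu d → ℂ) (v : Eu d) :
    dirD v u = fun x => ∑ i, (v i : ℂ) * pd i u x := by
  funext x; exact fderiv_apply_eq_sum u x v

lemma abs_coord_le (v : Eu d) (i : Fin d) : |v i| ≤ ‖v‖ := by
  simpa using PiLp.norm_apply_le v i

lemma norm_fderiv_le_sum (u : Eu d → ℂ) (x : Eu d) :
    ‖fderiv ℝ u x‖ ≤ ∑ i, ‖pd i u x‖ := by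
  refine ContinuousLinearMap.opNorm_le_bound _ (Finset.sum_nonneg fun _ _ => norm_nonneg _) ?_
  intro v
  rw [fderiv_apply_eq_sum, Finset.sum_mul]
  refine (norm_sum_le _ _).trans (Finset.sum_le_sum fun i _ => ?_)
  rw [norm_mul, mul_comm]
  refine mul_le_mul_of_nonneg_left ?_ (norm_nonneg _)
  simpa using abs_coord_le v i

lemma fderiv_eq_sum (u : Eu d → ℂ) (x : Eu d) :
    fderiv ℝ u x = ∑ i, (EuclideanSpace.proj i : Eu d →L[ℝ] ℝ).smulRight (pd i u x) := by
  ext v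
  rw [fderiv_apply_eq_sum]
  simp

/-- A class of differentiable functions that is stable under partial derivatives consists of
smooth functions. -/
lemma smooth_of_closed (P : (Eu d → ℂ) → Prop) (h1 : ∀ u, P u → Differentiable ℝ u)
    (h2 : ∀ u, P u → ∀ i, P (pd i u)) {u : Eu d → ℂ} (hu : P u) : Smooth u := by
  refine contDiff_infty.mpr ?_
  intro n
  induction n generalizing u with
  | zero => exact contDiff_zero.mpr (h1 u hu).continuous
  | succ n ih =>
    have : ((n + 1 : ℕ) : WithTop ℕ∞) = (n : WithTop ℕ∞) + 1 := by push_cast; rfl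
    rw [this, contDiff_succ_iff_fderiv]
    refine ⟨h1 u hu, by simp, ?_⟩
    have : fderiv ℝ u = fun x =>
        ∑ i, (EuclideanSpace.proj i : Eu d →L[ℝ] ℝ).smulRight (pd i u x) :=
      funext (fderiv_eq_sum u)
    rw [this]
    refine ContDiff.sum fun i _ => ?_
    exact contDiff_const.smulRight (ih (h2 u hu i))

lemma laplacian_eq_sum {u : Eu d → ℂ} (hu : Smooth u) :
    Laplacian.laplacian u = fun x => ∑ i, pd i (pd i u) x := by
  rw [InnerProductSpace.laplacian_eq_iteratedFDeriv_orthonormalBasis u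
    (EuclideanSpace.basisFun (Fin d) ℝ)]
  funext x
  refine Finset.sum_congr rfl fun i _ => ?_
  rw [iteratedFDeriv_two_apply, pd, pd, dirD_dirD hu]
  simp

lemma pd_comp_smul {u : Eu d → ℂ} (hu : Differentiable ℝ u) (c : ℝ) (i : Fin d) :
    pd i (fun x => u (c • x)) = fun x => (c : ℂ) * pd i u (c • x) := by
  funext x
  simp only [pd, dirD]
  have : HasFDerivAt (fun x => u (c • x))
      ((fderiv ℝ u (c • x)).comp (c • ContinuousLinearMap.id ℝ (Eu d))) x :=
    (hu (c • x)).hasFDerivAt.comp x ((hasFDerivAt_id x).const_smul c)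
  rw [this.fderiv]
  simp

lemma pd_comp_sub_left {u : Eu d → ℂ} (hu : Differentiable ℝ u) (a : Eu d) (i : Fin d) :
    pd i (fun x => u (a - x)) = fun x => -pd i u (a - x) := by
  funext x
  simp only [pd, dirD]
  have : HasFDerivAt (fun x => u (a - x))
      ((fderiv ℝ u (a - x)).comp (-ContinuousLinearMap.id ℝ (Eu d))) x :=
    (hu (a - x)).hasFDerivAt.comp x ((hasFDerivAt_id x).const_sub a)
  rw [this.fderiv]
  simp

lemma ld_comp_sub_left {u : Eu d → ℂ} (hu : Smooth u) (a : Eu d) (l : List (Fin d)) :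
    ld l (fun x => u (a - x)) = fun x => (-1 : ℂ) ^ l.length * ld l u (a - x) := by
  induction l with
  | nil => simp
  | cons i l ih =>
    rw [ld_cons, ih, pd_const_mul, pd_comp_sub_left (hu.ld l).diff]
    · funext x; rw [ld_cons, List.length_cons, pow_succ]; ring
    · exact (hu.ld l).diff.comp (differentiable_const a |>.sub differentiable_id)

lemma ld_comp_smul {u : Eu d → ℂ} (hu : Smooth u) (c : ℝ) (l : List (Fin d)) :
    ld l (fun x => u (c • x)) = fun x => (c : ℂ) ^ l.length * ld l u (c • x) := by
  induction l with
  | nil => simp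
  | cons i l ih =>
    rw [ld_cons, ih, pd_const_mul, pd_comp_smul (hu.ld l).diff]
    · funext x; rw [ld_cons, List.length_cons, pow_succ]; ring
    · exact (hu.ld l).diff.comp (differentiable_id.const_smul c)

/-! ### Sums of the derivatives up to a given order -/

/-- `Sg m u x` is the sum of the absolute values at `x` of all iterated partial derivatives of `u`
along lists of at most `m` coordinates. -/
def Sg : ℕ → (Eu d → ℂ) → Eu d → ℝ
  | 0, u, x => ‖u x‖
  | m + 1, u, x => ‖u x‖ + ∑ i, Sg m (pd i u) x

lemma Sg_nonneg (m : ℕ) (u : Eu d → ℂ) (x : Eu d) : 0 ≤ Sg m u x := by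
  induction m generalizing u with
  | zero => exact norm_nonneg _
  | succ m ih => exact add_nonneg (norm_nonneg _) (Finset.sum_nonneg fun i _ => ih _)

lemma norm_le_Sg (m : ℕ) (u : Eu d → ℂ) (x : Eu d) : ‖u x‖ ≤ Sg m u x := by
  cases m with
  | zero => exact le_rfl
  | succ m => exact le_add_of_nonneg_right (Finset.sum_nonneg fun i _ => Sg_nonneg _ _ _)

lemma Sg_le_succ (m : ℕ) (u : Eu d → ℂ) (x : Eu d) : Sg m u x ≤ Sg (m + 1) u x := by
  induction m generalizing u with
  | zero => exact norm_le_Sg 1 u x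
  | succ m ih => exact add_le_add le_rfl (Finset.sum_le_sum fun i _ => ih _)

lemma Sg_mono {m m' : ℕ} (h : m ≤ m') (u : Eu d → ℂ) (x : Eu d) : Sg m u x ≤ Sg m' u x :=
  monotone_nat_of_le_succ (f := fun m => Sg m u x) (fun m => Sg_le_succ m u x) h

lemma sum_Sg_pd_le (m : ℕ) (u : Eu d → ℂ) (x : Eu d) : ∑ i, Sg m (pd i u) x ≤ Sg (m + 1) u x :=
  le_add_of_nonneg_left (norm_nonneg _)

lemma Smooth.continuous_Sg {u : Eu d → ℂ} (hu : Smooth u) (m : ℕ) : Continuous (Sg m u) := by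
  induction m generalizing u with
  | zero => exact hu.continuous.norm
  | succ m ih => exact hu.continuous.norm.add (continuous_finsetSum _ fun i _ => ih (hu.pd i))

lemma Smooth.dirD_iter {u : Eu d → ℂ} (hu : Smooth u) (y : Eu d) (k : ℕ) :
    Smooth ((Mollif.dirD y)^[k] u) := by
  induction k with
  | zero => exact hu
  | succ k ih => rw [Function.iterate_succ_apply']; exact ih.dirD y

lemma dirD_iter_pd {u : Eu d → ℂ} (hu : Smooth u) (y : Eu d) (k : ℕ) (i : Fin d) :
    (dirD y)^[k] (pd i u) = pd i ((dirD y)^[k] u) := by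
  induction k with
  | zero => rfl
  | succ k ih =>
    rw [Function.iterate_succ_apply', ih, Function.iterate_succ_apply']
    exact dirD_comm (hu.dirD_iter y k) _ _

lemma dirD_iter_succ {u : Eu d → ℂ} (hu : Smooth u) (y : Eu d) (k : ℕ) (x : Eu d) :
    (dirD y)^[k + 1] u x = ∑ i, (y i : ℂ) * (dirD y)^[k] (pd i u) x := by
  rw [Function.iterate_succ_apply', dirD_eq_sum]
  simp only [dirD_iter_pd hu]

lemma norm_dirD_iter_le {u : Eu d → ℂ} (hu : Smooth u) (y : Eu d) (k : ℕ) (x : Eu d) :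
    ‖(dirD y)^[k] u x‖ ≤ ‖y‖ ^ k * Sg k u x := by
  induction k generalizing u with
  | zero => simp [Sg]
  | succ k ih =>
    rw [dirD_iter_succ hu]
    calc ‖∑ i, (y i : ℂ) * (dirD y)^[k] (pd i u) x‖
        ≤ ∑ i, ‖y‖ ^ (k + 1) * Sg k (pd i u) x := by
          refine (norm_sum_le _ _).trans (Finset.sum_le_sum fun i _ => ?_)
          rw [norm_mul, pow_succ', mul_assoc]
          refine mul_le_mul ?_ (ih (hu.pd i)) (norm_nonneg _) (norm_nonneg _)
          simpa using abs_coord_le y i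
      _ ≤ ‖y‖ ^ (k + 1) * Sg (k + 1) u x := by
          rw [← Finset.mul_sum]
          exact mul_le_mul_of_nonneg_left (sum_Sg_pd_le _ _ _) (by positivity)

lemma continuous_dirD_iter_left {u : Eu d → ℂ} (hu : Smooth u) (k : ℕ) (x : Eu d) :
    Continuous fun y : Eu d => (dirD y)^[k] u x := by
  induction k generalizing u with
  | zero => exact continuous_const
  | succ k ih =>
    simp only [dirD_iter_succ hu]
    refine continuous_finsetSum _ fun i _ => ?_
    exact (Complex.continuous_ofReal.comp (by fun_prop)).mul (ih (hu.pd i))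

lemma hasDerivAt_dirD_iter {u : Eu d → ℂ} (hu : Smooth u) (x y : Eu d) (k : ℕ) (t : ℝ) :
    HasDerivAt (fun t : ℝ => (dirD y)^[k] u (x + t • y)) ((dirD y)^[k + 1] u (x + t • y)) t := by
  have h1 : HasDerivAt (fun t : ℝ => x + t • y) y t := by
    simpa using ((hasDerivAt_id t).smul_const y).const_add x
  have h2 := ((hu.dirD_iter y k).diff (x + t • y)).hasFDerivAt.comp_hasDerivAt t h1
  rw [Function.iterate_succ_apply']
  exact h2

/-! ### Taylor expansions along segments -/

/-- Taylor's formula of order `L` for a function with successive derivatives `g 0, g 1, …`. The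
factor `1 / L!` in the remainder is dropped. -/
lemma norm_taylor_sub_le {g : ℕ → ℝ → ℂ} (hg : ∀ k t, HasDerivAt (g k) (g (k + 1) t) t) (L : ℕ)
    {M : ℝ} (hM : ∀ t ∈ Set.Icc (0 : ℝ) 1, ‖g L t‖ ≤ M) {t : ℝ} (ht : t ∈ Set.Icc (0 : ℝ) 1) :
    ‖g 0 t - ∑ k ∈ Finset.range L, ((t : ℂ) ^ k / (k.factorial : ℂ)) * g k 0‖ ≤ M := by
  induction L generalizing g t with
  | zero => simpa using hM t ht
  | succ L ih =>
    have hM0 : 0 ≤ M := (norm_nonneg _).trans (hM 0 (by simp))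
    set F : ℝ → ℂ := fun t => g 0 t -
      ∑ k ∈ Finset.range (L + 1), ((t : ℂ) ^ k / (k.factorial : ℂ)) * g k 0 with hF
    have hderiv : ∀ s, HasDerivAt F (g 1 s -
        ∑ k ∈ Finset.range L, ((s : ℂ) ^ k / (k.factorial : ℂ)) * g (k + 1) 0) s := by
      intro s
      refine (hg 0 s).sub ?_
      have : ∀ s : ℝ, ∑ k ∈ Finset.range (L + 1), ((s : ℂ) ^ k / (k.factorial : ℂ)) * g k 0
          = ∑ k ∈ Finset.range L, ((s : ℂ) ^ (k + 1) / ((k + 1).factorial : ℂ)) * g (k + 1) 0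
            + g 0 0 := by
        intro s; rw [Finset.sum_range_succ']; simp
      simp only [this]
      refine HasDerivAt.add_const _ (HasDerivAt.fun_sum fun k _ => ?_)
      refine HasDerivAt.mul_const ?_ _
      have h0 : HasDerivAt (fun s : ℝ => (s : ℂ)) 1 s := (hasDerivAt_id s).ofReal_comp
      have h1 := (h0.pow (k + 1)).div_const ((k + 1).factorial : ℂ)
      refine HasDerivAt.congr_deriv (f' := _) h1 ?_
      rw [Nat.factorial_succ]
      have : (k.factorial : ℂ) ≠ 0 := by exact_mod_cast k.factorial_ne_zero
      have h' : ((k : ℂ) + 1) ≠ 0 := by exact_mod_cast k.succ_ne_zero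
      rw [Nat.add_sub_cancel]
      push_cast
      field_simp
    have hF0 : F 0 = 0 := by
      simp only [hF]; rw [Finset.sum_range_succ']; simp
    have hb : ∀ s ∈ Set.Ico (0 : ℝ) 1, ‖g 1 s -
        ∑ k ∈ Finset.range L, ((s : ℂ) ^ k / (k.factorial : ℂ)) * g (k + 1) 0‖ ≤ M := by
      intro s hs
      exact ih (g := fun k => g (k + 1)) (fun k t => hg (k + 1) t) hM ⟨hs.1, hs.2.le⟩
    have key := norm_image_sub_le_of_norm_deriv_le_segment' (f := F) (a := 0) (b := 1) (C := M)
      (fun s _ => (hderiv s).hasDerivWithinAt) hb t ht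
    rw [hF0, sub_zero, sub_zero] at key
    exact key.trans (mul_le_of_le_one_right hM0 ht.2)

/-- Taylor's formula at `1`, evaluated at `0`, with the remainder in integral form. -/
lemma norm_zero_le_of_chain {g : ℕ → ℝ → ℂ} (hg : ∀ k t, HasDerivAt (g k) (g (k + 1) t) t)
    (m : ℕ) :
    ‖g 0 0‖ ≤ ∑ k ∈ Finset.range (m + 1), ‖g k 1‖ + ∫ t in (0 : ℝ)..1, t ^ m * ‖g (m + 1) t‖ := by
  set F : ℕ → ℝ → ℂ := fun m t =>
    ∑ k ∈ Finset.range (m + 1), ((-(t : ℂ)) ^ k / (k.factorial : ℂ)) * g k t with hF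
  have hderiv : ∀ (m : ℕ) (s : ℝ), HasDerivAt (F m) ((-(s : ℂ)) ^ m / (m.factorial : ℂ) * g (m + 1) s) s := by
    intro m s
    induction m with
    | zero => simpa [hF] using hg 0 s
    | succ m ih =>
      have h0 : HasDerivAt (fun s : ℝ => (-(s : ℂ))) (-1) s := (hasDerivAt_id s).ofReal_comp.neg
      have h1 := ((h0.pow (m + 1)).div_const ((m + 1).factorial : ℂ)).mul (hg (m + 1) s)
      have h2 := ih.add h1
      have : F (m + 1) = fun t => F m t +
          ((-(t : ℂ)) ^ (m + 1) / ((m + 1).factorial : ℂ)) * g (m + 1) t := by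
        funext t; simp only [hF]; rw [Finset.sum_range_succ _ (m + 1)]
      rw [this]
      refine HasDerivAt.congr_deriv h2 ?_
      simp only [Pi.pow_apply, Nat.add_sub_cancel]
      rw [Nat.factorial_succ]
      have : (m.factorial : ℂ) ≠ 0 := by exact_mod_cast m.factorial_ne_zero
      have h' : ((m : ℂ) + 1) ≠ 0 := by exact_mod_cast m.succ_ne_zero
      push_cast
      field_simp
      ring
  have hcont : ∀ k, Continuous (g k) := fun k =>
    continuous_iff_continuousAt.mpr fun t => (hg k t).continuousAt
  have hint := intervalIntegral.integral_eq_sub_of_hasDerivAt (a := 0) (b := 1)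
    (fun t _ => hderiv m t) (Continuous.intervalIntegrable
      (by have := hcont (m + 1); fun_prop) _ _)
  have hF0 : F m 0 = g 0 0 := by
    simp only [hF]; rw [Finset.sum_range_succ']; simp
  rw [hF0] at hint
  have hfac : ∀ k : ℕ, ‖((k.factorial : ℂ))‖⁻¹ ≤ 1 := by
    intro k
    rw [Complex.norm_natCast]
    exact inv_le_one_of_one_le₀ (by exact_mod_cast k.factorial_pos)
  have hF1 : ‖F m 1‖ ≤ ∑ k ∈ Finset.range (m + 1), ‖g k 1‖ := by
    refine (norm_sum_le _ _).trans (Finset.sum_le_sum fun k _ => ?_)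
    rw [norm_mul]
    refine mul_le_of_le_one_left (norm_nonneg _) ?_
    simpa [div_eq_mul_inv] using hfac k
  have hI : ‖∫ t in (0 : ℝ)..1, ((-(t : ℂ)) ^ m / (m.factorial : ℂ)) * g (m + 1) t‖
      ≤ ∫ t in (0 : ℝ)..1, t ^ m * ‖g (m + 1) t‖ := by
    refine intervalIntegral.norm_integral_le_of_norm_le zero_le_one ?_ ?_
    · refine Filter.Eventually.of_forall fun t ht => ?_
      rw [norm_mul]
      refine mul_le_mul_of_nonneg_right ?_ (norm_nonneg _)
      rw [norm_div, norm_pow, norm_neg, Complex.norm_real, Real.norm_of_nonneg ht.1.le,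
        div_eq_mul_inv]
      exact mul_le_of_le_one_right (pow_nonneg ht.1.le _) (hfac m)
    · exact Continuous.intervalIntegrable (by have := hcont (m + 1); fun_prop) _ _
  have : g 0 0 = F m 1 - ∫ t in (0 : ℝ)..1, ((-(t : ℂ)) ^ m / (m.factorial : ℂ)) * g (m + 1) t := by
    rw [hint]; ring
  rw [this]
  exact (norm_sub_le _ _).trans (add_le_add hF1 hI)

/-! ### A local Sobolev inequality -/

lemma integrableOn_ball_shift {S : Eu d → ℝ} (hS : Continuous S) (x : Eu d) (R : ℝ) :
    IntegrableOn (fun y => S (x + y)) (Metric.ball 0 R) := by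
  have : Continuous fun y => S (x + y) := by fun_prop
  exact (this.continuousOn.integrableOn_compact (isCompact_closedBall (0 : Eu d) R)).mono_set
    Metric.ball_subset_closedBall

lemma setIntegral_ball_smul_le {S : Eu d → ℝ} (hS : Continuous S) (h0 : ∀ x, 0 ≤ S x) (x : Eu d)
    {t : ℝ} (ht : 0 < t) (ht1 : t ≤ 1) :
    t ^ d * ∫ y in Metric.ball (0 : Eu d) 1, S (x + t • y)
      ≤ ∫ y in Metric.ball (0 : Eu d) 1, S (x + y) := by
  have h1 := Measure.setIntegral_comp_smul_of_pos (μ := (volume : Measure (Eu d)))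
    (fun y => S (x + y)) (Metric.ball (0 : Eu d) 1) ht
  rw [h1, finrank_euclideanSpace_fin, smul_eq_mul, ← mul_assoc, mul_inv_cancel₀ (by positivity),
    one_mul, smul_ball ht.ne']
  refine setIntegral_mono_set (integrableOn_ball_shift hS x 1)
    (Filter.Eventually.of_forall fun _ => h0 _) ?_
  refine Filter.Eventually.of_forall (Metric.ball_subset_ball' ?_)
  simp [abs_of_pos ht, ht1]

/-- A local Sobolev inequality with values in `L^1`: it follows from averaging over the unit ball
the Taylor expansions of order `d + 1` at the points `x + y`. The factor `t ^ d` in the remainder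
compensates the Jacobian of `y ↦ t • y`. -/
lemma exists_sobolev (d : ℕ) : ∃ C : ℝ, 0 ≤ C ∧ ∀ (u : Eu d → ℂ), Smooth u → ∀ x : Eu d,
    ‖u x‖ ≤ C * ∫ y in Metric.ball (0 : Eu d) 1, Sg (d + 1) u (x + y) := by
  set B : Set (Eu d) := Metric.ball 0 1 with hB
  set V : ℝ := (volume B).toReal with hV
  have hVpos : 0 < V := ENNReal.toReal_pos (Metric.measure_ball_pos _ _ one_pos).ne'
    measure_ball_lt_top.ne
  refine ⟨V⁻¹ * (d + 2), by positivity, fun u hu x => ?_⟩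
  set S := Sg (d + 1) u with hSdef
  have hS : Continuous S := hu.continuous_Sg _
  have hS0 : ∀ z, 0 ≤ S z := fun z => Sg_nonneg _ _ _
  have hpt : ∀ y ∈ B, ‖u x‖ ≤ (d + 1) * S (x + y)
      + ∫ t in Set.Ioc (0 : ℝ) 1, t ^ d * S (x + t • y) := by
    intro y hy
    have hy1 : ‖y‖ ≤ 1 := by simpa [hB] using (Metric.mem_ball.mp hy).le
    have hle : ∀ k ≤ d + 1, ∀ z, ‖(dirD y)^[k] u z‖ ≤ S z := by
      intro k hk z
      refine (norm_dirD_iter_le hu y k z).trans ?_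
      refine (mul_le_of_le_one_left (Sg_nonneg _ _ _) (pow_le_one₀ (norm_nonneg _) hy1)).trans ?_
      exact Sg_mono hk u z
    have h := norm_zero_le_of_chain (g := fun k t => (dirD y)^[k] u (x + t • y))
      (fun k t => hasDerivAt_dirD_iter hu x y k t) d
    simp only [Function.iterate_zero, id, zero_smul, add_zero, one_smul] at h
    refine h.trans (add_le_add ?_ ?_)
    · calc _ ≤ ∑ k ∈ Finset.range (d + 1), S (x + y) :=
            Finset.sum_le_sum fun k hk => hle k (Finset.mem_range.mp hk).le _
        _ = _ := by simp
    · rw [intervalIntegral.integral_of_le zero_le_one]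
      refine setIntegral_mono_on ?_ ?_ measurableSet_Ioc fun t ht => ?_
      · have := ((hu.dirD_iter y (d + 1)).continuous)
        refine (Continuous.integrableOn_Icc ?_).mono_set Set.Ioc_subset_Icc_self
        fun_prop
      · refine (Continuous.integrableOn_Icc ?_).mono_set Set.Ioc_subset_Icc_self
        fun_prop
      · exact mul_le_mul_of_nonneg_left (hle _ le_rfl _) (pow_nonneg ht.1.le _)
  have hint1 : IntegrableOn (fun y => S (x + y)) B := integrableOn_ball_shift hS x 1
  have hprod : Integrable (Function.uncurry fun (y : Eu d) (t : ℝ) => t ^ d * S (x + t • y))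
      ((volume.restrict B).prod (volume.restrict (Set.Ioc (0 : ℝ) 1))) := by
    rw [Measure.prod_restrict]
    have hc : Continuous (Function.uncurry fun (y : Eu d) (t : ℝ) => t ^ d * S (x + t • y)) := by
      simp only [Function.uncurry_def]; fun_prop
    refine (hc.continuousOn.integrableOn_compact
      ((isCompact_closedBall (0 : Eu d) 1).prod (isCompact_Icc (a := (0 : ℝ)) (b := 1)))).mono_set ?_
    exact Set.prod_mono Metric.ball_subset_closedBall Set.Ioc_subset_Icc_self
  have hint2 : IntegrableOn (fun y => ∫ t in Set.Ioc (0 : ℝ) 1, t ^ d * S (x + t • y)) B :=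
    hprod.integral_prod_left
  have hswap : ∫ y in B, ∫ t in Set.Ioc (0 : ℝ) 1, t ^ d * S (x + t • y)
      ≤ ∫ y in B, S (x + y) := by
    rw [integral_integral_swap hprod]
    calc ∫ t in Set.Ioc (0 : ℝ) 1, ∫ y in B, t ^ d * S (x + t • y)
        ≤ ∫ t in Set.Ioc (0 : ℝ) 1, ∫ y in B, S (x + y) := by
          refine setIntegral_mono_on hprod.integral_prod_right (integrableOn_const (by simp))
            measurableSet_Ioc fun t ht => ?_
          rw [integral_const_mul]
          exact setIntegral_ball_smul_le hS hS0 x ht.1 ht.2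
      _ = ∫ y in B, S (x + y) := by simp
  have hfin : V * ‖u x‖ ≤ (d + 2) * ∫ y in B, S (x + y) := by
    calc V * ‖u x‖ = ∫ y in B, ‖u x‖ := by simp [hV, Measure.real]
      _ ≤ ∫ y in B, ((d + 1) * S (x + y)
          + ∫ t in Set.Ioc (0 : ℝ) 1, t ^ d * S (x + t • y)) := by
          refine setIntegral_mono_on (integrableOn_const measure_ball_lt_top.ne)
            ((hint1.const_mul _).add hint2) measurableSet_ball hpt
      _ = (d + 1) * (∫ y in B, S (x + y))
          + ∫ y in B, ∫ t in Set.Ioc (0 : ℝ) 1, t ^ d * S (x + t • y) := by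
          rw [integral_add (hint1.const_mul _) hint2, integral_const_mul]
      _ ≤ (d + 1) * (∫ y in B, S (x + y)) + ∫ y in B, S (x + y) := by gcongr
      _ = _ := by ring
  rw [mul_assoc, ← div_eq_inv_mul, le_div_iff₀ hVpos, mul_comm]
  exact hfin

lemma setIntegral_ball_shift_le {S : Eu d → ℝ} (hS : Continuous S) (h0 : ∀ x, 0 ≤ S x) (x : Eu d)
    {y : Eu d} {r R : ℝ} (hy : ‖y‖ ≤ R) :
    ∫ z in Metric.ball (0 : Eu d) r, S (x + y + z)
      ≤ ∫ z in Metric.ball (0 : Eu d) (R + r), S (x + z) := by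
  have h1 := (measurePreserving_add_left (volume : Measure (Eu d)) y).setIntegral_preimage_emb
    (MeasurableEquiv.addLeft y).measurableEmbedding (fun z => S (x + z)) (Metric.ball y r)
  have h2 : (fun z => y + z) ⁻¹' (Metric.ball y r) = Metric.ball (0 : Eu d) r := by
    ext z; simp [dist_eq_norm]
  rw [h2] at h1
  simp only [← add_assoc] at h1
  rw [h1]
  refine setIntegral_mono_set (integrableOn_ball_shift hS x _)
    (Filter.Eventually.of_forall fun _ => h0 _) ?_
  refine Filter.Eventually.of_forall (Metric.ball_subset_ball' ?_)
  simp only [dist_zero_right]; linarith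

lemma exists_sobolev_shift (d : ℕ) (L : ℕ) : ∃ C : ℝ, 0 ≤ C ∧
    ∀ (u : Eu d → ℂ), Smooth u → ∀ (R : ℝ) (x y : Eu d), ‖y‖ ≤ R →
    Sg L u (x + y) ≤ C * ∫ z in Metric.ball (0 : Eu d) (R + 1), Sg (L + d + 1) u (x + z) := by
  obtain ⟨C, hC, h⟩ := exists_sobolev d
  have base : ∀ (u : Eu d → ℂ), Smooth u → ∀ (R : ℝ) (x y : Eu d), ‖y‖ ≤ R → ∀ L,
      ‖u (x + y)‖ ≤ C * ∫ z in Metric.ball (0 : Eu d) (R + 1), Sg (L + d + 1) u (x + z) := by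
    intro u hu R x y hy L
    refine (h u hu (x + y)).trans (mul_le_mul_of_nonneg_left ?_ hC)
    refine (setIntegral_ball_shift_le (hu.continuous_Sg _) (Sg_nonneg _ _) x hy).trans ?_
    refine setIntegral_mono (integrableOn_ball_shift (hu.continuous_Sg _) x _)
      (integrableOn_ball_shift (hu.continuous_Sg _) x _) fun z => Sg_mono (by omega) u _
  induction L with
  | zero => exact ⟨C, hC, fun u hu R x y hy => by simpa [Sg] using base u hu R x y hy 0⟩
  | succ L ih =>
    obtain ⟨C', hC', h'⟩ := ih
    refine ⟨C + C', by positivity, fun u hu R x y hy => ?_⟩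
    rw [add_mul]
    refine add_le_add (base u hu R x y hy _) ?_
    calc ∑ i, Sg L (pd i u) (x + y)
        ≤ ∑ i, C' * ∫ z in Metric.ball (0 : Eu d) (R + 1), Sg (L + d + 1) (pd i u) (x + z) :=
          Finset.sum_le_sum fun i _ => h' _ (hu.pd i) R x y hy
      _ = C' * ∫ z in Metric.ball (0 : Eu d) (R + 1), ∑ i, Sg (L + d + 1) (pd i u) (x + z) := by
          rw [← Finset.mul_sum, integral_finsetSum]
          exact fun i _ => integrableOn_ball_shift ((hu.pd i).continuous_Sg _) x _
      _ ≤ _ := by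
          refine mul_le_mul_of_nonneg_left ?_ hC'
          refine setIntegral_mono (integrable_finsetSum _ fun i _ =>
            integrableOn_ball_shift ((hu.pd i).continuous_Sg _) x _)
            (integrableOn_ball_shift (hu.continuous_Sg _) x _) fun z => ?_
          have := sum_Sg_pd_le (L + d + 1) u (x + z)
          rwa [show L + 1 + d + 1 = L + d + 1 + 1 by omega]

/-! ### Convolutions with test functions and vanishing moments -/

/-- The convolution `h * ψ` of a function `h` on `ℝ^d` with `ψ`. -/
def cv (h ψ : Eu d → ℂ) : Eu d → ℂ := fun x => ∫ y, h (x - y) * ψ y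

lemma cv_dilate (h : Eu d → ℂ) (ψ : TF d) (j : ℕ) (x : Eu d) :
    cv h (dilate ψ j) x = ∫ y, h (x + (2⁻¹ : ℝ) ^ j • (-y)) * ψ y := by
  have h1 := Measure.integral_comp_smul (volume : Measure (Eu d))
    (fun y => h (x + (2⁻¹ : ℝ) ^ j • (-y)) * ψ y) ((2 : ℝ) ^ j)
  have hpos : (0 : ℝ) < ((2 : ℝ) ^ j) ^ d := by positivity
  rw [finrank_euclideanSpace_fin, abs_of_pos (inv_pos.mpr hpos)] at h1
  have h2 : ∀ y : Eu d, h (x - y) * dilate ψ j y = ((((2 : ℝ) ^ j) ^ d : ℝ) : ℂ) *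
      (h (x + (2⁻¹ : ℝ) ^ j • (-((2 : ℝ) ^ j • y))) * ψ ((2 : ℝ) ^ j • y)) := by
    intro y
    have : (2⁻¹ : ℝ) ^ j • (-((2 : ℝ) ^ j • y)) = -y := by
      rw [smul_neg, smul_smul, ← mul_pow]; simp
    rw [this]
    have h3 : dilate ψ j y = (2 : ℂ) ^ (j * d) * ψ ((2 : ℝ) ^ j • y) := rfl
    rw [h3, ← sub_eq_add_neg, pow_mul]; push_cast; ring
  unfold cv
  simp only [h2]
  rw [integral_const_mul, h1, Complex.real_smul, ← mul_assoc, ← Complex.ofReal_mul,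
    mul_inv_cancel₀ hpos.ne']
  simp

lemma integrable_cont_mul_tf {h : Eu d → ℂ} (hh : Continuous h) (ψ : TF d) :
    Integrable fun y => h y * ψ y :=
  (hh.mul ψ.continuous).integrable_of_hasCompactSupport ψ.hasCompactSupport.mul_left

/-- The Taylor polynomials of order `< L` of a smooth function integrate to zero against a test
function whose moments of order `< L` vanish. The monomial is carried along for the induction on the
order `k` of the derivative, each step of which produces one more coordinate of `y`. -/
lemma integral_monomial_dirD_eq_zero {L : ℕ} {ψ : TF d} (hψ : MomentsVanish L ψ) (k : ℕ)
    {h : Eu d → ℂ} (hh : Smooth h) (x : Eu d) (α : Fin d → ℕ) (hk : ∑ i, α i + k < L) :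
    ∫ y : Eu d, (((∏ i, y i ^ α i : ℝ) : ℂ) * (dirD y)^[k] h x) * ψ y = 0 := by
  induction k generalizing h α with
  | zero =>
    have : ∀ y : Eu d, (((∏ i, y i ^ α i : ℝ) : ℂ) * (dirD y)^[0] h x) * ψ y
        = h x * (((∏ i, y i ^ α i : ℝ) : ℂ) * ψ y) := by
      intro y; simp only [Function.iterate_zero, id]; ring
    simp only [this]
    rw [integral_const_mul, hψ α (by simpa using hk), mul_zero]
  | succ k ih =>
    have h1 : ∀ y : Eu d, (((∏ i, y i ^ α i : ℝ) : ℂ) * (dirD y)^[k + 1] h x) * ψ y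
        = ∑ j, (((∏ i, y i ^ ((α + Pi.single j 1 : Fin d → ℕ) i) : ℝ) : ℂ) * (dirD y)^[k] (pd j h) x) * ψ y := by
      intro y
      rw [dirD_iter_succ hh, Finset.mul_sum, Finset.sum_mul]
      refine Finset.sum_congr rfl fun j _ => ?_
      have : (∏ i, y i ^ ((α + Pi.single j 1 : Fin d → ℕ) i) : ℝ) = (∏ i, y i ^ α i) * y j := by
        simp only [Pi.add_apply, pow_add, Finset.prod_mul_distrib]
        congr 1
        rw [Finset.prod_eq_single j]
        · simp
        · intro b _ hb; simp [hb]
        · simp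
      rw [this]; push_cast; ring
    simp only [h1]
    rw [integral_finsetSum]
    · refine Finset.sum_eq_zero fun j _ => ih (hh.pd j) _ ?_
      simp only [Pi.add_apply, Finset.sum_add_distrib]
      simp
      omega
    · intro j _
      refine integrable_cont_mul_tf ?_ ψ
      refine (Complex.continuous_ofReal.comp ?_).mul (continuous_dirD_iter_left (hh.pd j) k x)
      fun_prop

lemma momentsVanish_zero (ψ : TF d) : MomentsVanish 0 ψ := fun _ h => absurd h (by omega)

/-- Vanishing moments of order `< L` of `ψ` gain the factor `2^{-jL}` in the convolution with
`ψ_j`. -/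
lemma norm_cv_dilate_le {L : ℕ} {ψ : TF d} (hψ : MomentsVanish L ψ) {R : ℝ}
    (hR : tsupport ψ ⊆ Metric.closedBall 0 R) {h : Eu d → ℂ} (hh : Smooth h) (j : ℕ) (x : Eu d)
    {M : ℝ} (hM : ∀ y, ‖y‖ ≤ R → Sg L h (x + y) ≤ M) :
    ‖cv h (dilate ψ j) x‖ ≤ (∫ y, ‖y‖ ^ L * ‖ψ y‖) * ((2⁻¹ : ℝ) ^ (L * j) * M) := by
  set c : ℝ := (2⁻¹ : ℝ) ^ j with hc
  have hc0 : 0 ≤ c := by positivity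
  have hc1 : c ≤ 1 := pow_le_one₀ (by norm_num) (by norm_num)
  have hz : ∀ k < L, ∫ y : Eu d, ((dirD y)^[k] h x) * ψ y = 0 := by
    intro k hk
    have := integral_monomial_dirD_eq_zero hψ k hh x 0 (by simpa using hk)
    simpa using this
  -- The derivative along `-c y` is `(-c)^k` times the one along `y`.
  have hscale : ∀ k (u : Eu d → ℂ), Smooth u → ∀ y : Eu d,
      (dirD (c • (-y)))^[k] u x = ((-c : ℝ) : ℂ) ^ k * (dirD y)^[k] u x := by
    intro k
    induction k with
    | zero => intro u _ y; simp
    | succ k ih =>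
      intro u hu y
      rw [dirD_iter_succ hu, dirD_iter_succ hu, Finset.mul_sum]
      refine Finset.sum_congr rfl fun i _ => ?_
      rw [ih _ (hu.pd i)]
      simp; ring
  have hcont : ∀ k, Continuous fun y : Eu d => (dirD y)^[k] h x :=
    fun k => continuous_dirD_iter_left hh k x
  have hsum0 : ∫ y : Eu d, (∑ k ∈ Finset.range L, (1 / (k.factorial : ℂ)) *
      ((dirD (c • (-y)))^[k] h x)) * ψ y = 0 := by
    simp only [hscale _ h hh, Finset.sum_mul]
    rw [integral_finsetSum]
    · refine Finset.sum_eq_zero fun k hk => ?_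
      have : ∀ y : Eu d, 1 / (k.factorial : ℂ) * (((-c : ℝ) : ℂ) ^ k * (dirD y)^[k] h x) * ψ y
          = (1 / (k.factorial : ℂ) * ((-c : ℝ) : ℂ) ^ k) * ((dirD y)^[k] h x * ψ y) := by
        intro y; ring
      simp only [this]
      rw [integral_const_mul, hz k (Finset.mem_range.mp hk), mul_zero]
    · intro k _
      refine integrable_cont_mul_tf ?_ ψ
      exact continuous_const.mul (continuous_const.mul (hcont k))
  have hA : Integrable fun y : Eu d => h (x + c • (-y)) * ψ y :=
    integrable_cont_mul_tf (by have := hh.continuous; fun_prop) ψ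
  have hB : Integrable fun y : Eu d => (∑ k ∈ Finset.range L, (1 / (k.factorial : ℂ)) *
      ((dirD (c • (-y)))^[k] h x)) * ψ y := by
    refine integrable_cont_mul_tf (continuous_finsetSum _ fun k _ => ?_) ψ
    simp only [hscale _ h hh]
    exact continuous_const.mul (continuous_const.mul (hcont k))
  have hrew : cv h (dilate ψ j) x = ∫ y : Eu d, (h (x + c • (-y)) -
      ∑ k ∈ Finset.range L, (1 / (k.factorial : ℂ)) * ((dirD (c • (-y)))^[k] h x)) * ψ y := by
    rw [cv_dilate]
    simp only [sub_mul]
    rw [integral_sub hA hB, hsum0, sub_zero]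
  rw [hrew]
  have hbound : ∀ y : Eu d, ‖(h (x + c • (-y)) - ∑ k ∈ Finset.range L, (1 / (k.factorial : ℂ)) *
      ((dirD (c • (-y)))^[k] h x)) * ψ y‖ ≤ (‖y‖ ^ L * ‖ψ y‖) * ((2⁻¹ : ℝ) ^ (L * j) * M) := by
    intro y
    by_cases hy : ψ y = 0
    · simp [hy]
    have hyR : ‖y‖ ≤ R := by simpa using hR (subset_tsupport _ hy)
    have ht := norm_taylor_sub_le (g := fun k t => (dirD (c • (-y)))^[k] h (x + t • (c • (-y))))
      (fun k t => hasDerivAt_dirD_iter hh x _ k t) L (M := ‖c • (-y)‖ ^ L * M) ?_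
      (t := 1) (by simp)
    · rw [norm_mul]
      simp only [one_smul, zero_smul, add_zero, Complex.ofReal_one, one_pow, Function.iterate_zero,
        id] at ht
      refine (mul_le_mul_of_nonneg_right ht (norm_nonneg _)).trans (le_of_eq ?_)
      rw [norm_smul, norm_neg, Real.norm_of_nonneg hc0, mul_pow, hc, ← pow_mul, mul_comm j L]
      ring
    · intro t htI
      refine (norm_dirD_iter_le hh _ L _).trans ?_
      refine mul_le_mul_of_nonneg_left (hM _ ?_) (by positivity)
      rw [norm_smul, norm_smul, norm_neg, Real.norm_of_nonneg hc0, Real.norm_of_nonneg htI.1]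
      calc t * (c * ‖y‖) ≤ 1 * (1 * ‖y‖) := by
            gcongr
            exact htI.2
        _ ≤ R := by simpa using hyR
  calc _ ≤ ∫ y, (‖y‖ ^ L * ‖ψ y‖) * ((2⁻¹ : ℝ) ^ (L * j) * M) := by
        refine norm_integral_le_of_norm_le ?_ (Filter.Eventually.of_forall hbound)
        refine Integrable.mul_const ?_ _
        have h1 := (integrable_cont_mul_tf (h := fun y : Eu d => ((‖y‖ ^ L : ℝ) : ℂ))
          (by fun_prop) ψ).norm
        simpa using h1
    _ = _ := integral_mul_const _ _

/-- The pointwise estimate that carries all weighted norm inequalities: `h * ψ_j` is dominated by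
local averages of the derivatives of `h`, with a gain `2^{-jL}` if the moments of `ψ` of order
`< L` vanish. -/
lemma exists_norm_cv_dilate_le {L : ℕ} {ψ : TF d} (hψ : MomentsVanish L ψ) {R : ℝ}
    (hR : tsupport ψ ⊆ Metric.closedBall 0 R) :
    ∃ C : ℝ, 0 ≤ C ∧ ∀ (h : Eu d → ℂ), Smooth h → ∀ (j : ℕ) (x : Eu d),
      ‖cv h (dilate ψ j) x‖ ≤ C * (2⁻¹ : ℝ) ^ (L * j) *
        ∫ z in Metric.ball (0 : Eu d) (R + 1), Sg (L + d + 1) h (x + z) := by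
  obtain ⟨C, hC, hS⟩ := exists_sobolev_shift d L
  refine ⟨(∫ y, ‖y‖ ^ L * ‖ψ y‖) * C, mul_nonneg (integral_nonneg fun y => by positivity) hC,
    fun h hh j x => ?_⟩
  refine (norm_cv_dilate_le hψ hR hh j x (fun y hy => hS h hh R x y hy)).trans (le_of_eq ?_)
  ring

/-! ### Bounds for test functions and the order of a distribution -/

lemma TF.smooth (φ : TF d) : Smooth φ := φ.contDiff

lemma norm_iteratedFDeriv_le_Sg {u : Eu d → ℂ} (hu : Smooth u) (n : ℕ) (x : Eu d) :
    ‖iteratedFDeriv ℝ n u x‖ ≤ Sg n u x := by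
  induction n generalizing u with
  | zero => simp [Sg]
  | succ n ih =>
    rw [← norm_iteratedFDeriv_fderiv]
    have hf : fderiv ℝ u = fun x => ∑ i,
        (ContinuousLinearMap.smulRightL ℝ (Eu d) ℂ (EuclideanSpace.proj i : Eu d →L[ℝ] ℝ))
          (pd i u x) := by
      funext x; rw [fderiv_eq_sum]; rfl
    have hs : ∀ i : Fin d, ContDiff ℝ n fun x =>
        (ContinuousLinearMap.smulRightL ℝ (Eu d) ℂ (EuclideanSpace.proj i : Eu d →L[ℝ] ℝ))
          (pd i u x) := fun i =>
      (ContinuousLinearMap.contDiff _).comp ((hu.pd i).of_le (by exact_mod_cast le_top))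
    rw [hf, iteratedFDeriv_fun_sum_apply (fun i _ => (hs i).contDiffAt)]
    refine (norm_sum_le _ _).trans ((Finset.sum_le_sum fun i _ => ?_).trans (sum_Sg_pd_le n u x))
    refine (ContinuousLinearMap.norm_iteratedFDeriv_comp_left (𝕜 := ℝ)
      (ContinuousLinearMap.smulRightL ℝ (Eu d) ℂ (EuclideanSpace.proj i : Eu d →L[ℝ] ℝ))
      ((hu.pd i).contDiffAt (x := x)) (n := n) (by exact_mod_cast le_top)).trans ?_
    refine (mul_le_of_le_one_left (norm_nonneg _) ?_).trans (ih (hu.pd i))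
    refine ContinuousLinearMap.opNorm_le_bound _ zero_le_one fun c => ?_
    rw [one_mul]
    refine ContinuousLinearMap.opNorm_le_bound _ (norm_nonneg _) fun v => ?_
    simp only [ContinuousLinearMap.smulRightL_apply_apply, ContinuousLinearMap.smulRight_apply,
      norm_smul]
    rw [mul_comm]
    exact mul_le_mul_of_nonneg_left (abs_coord_le v i) (norm_nonneg _)

lemma Sg_le_of_ld_le {u : Eu d → ℂ} {m : ℕ} {x : Eu d} {A : ℝ}
    (h : ∀ l : List (Fin d), l.length ≤ m → ‖ld l u x‖ ≤ A) :
    Sg m u x ≤ (1 + d : ℝ) ^ m * A := by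
  induction m generalizing u with
  | zero => simpa [Sg] using h [] (by simp)
  | succ m ih =>
    have hA : 0 ≤ A := (norm_nonneg _).trans (h [] (by simp))
    have h1 : ∀ i, Sg m (pd i u) x ≤ (1 + d : ℝ) ^ m * A := by
      intro i
      refine ih fun l hl => ?_
      have := h (l ++ [i]) (by simpa using hl)
      rwa [ld_append] at this
    calc Sg (m + 1) u x ≤ A + ∑ _i : Fin d, (1 + d : ℝ) ^ m * A :=
          add_le_add (h [] (by simp)) (Finset.sum_le_sum fun i _ => h1 i)
      _ = A + d * ((1 + d : ℝ) ^ m * A) := by simp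
      _ ≤ (1 + d : ℝ) ^ m * A + d * ((1 + d : ℝ) ^ m * A) := by
          gcongr
          exact le_mul_of_one_le_left hA (one_le_pow₀ (by simp))
      _ = _ := by ring

lemma Sg_ld_le (m : ℕ) (l : List (Fin d)) (u : Eu d → ℂ) (x : Eu d) :
    Sg m (ld l u) x ≤ Sg (m + l.length) u x := by
  induction l generalizing m with
  | nil => exact le_rfl
  | cons i l ih =>
    rw [ld_cons]
    have h1 : Sg m (pd i (ld l u)) x ≤ Sg (m + 1) (ld l u) x :=
      (Finset.single_le_sum (f := fun i => Sg m (pd i (ld l u)) x)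
        (fun i _ => Sg_nonneg _ _ _) (Finset.mem_univ i)).trans (sum_Sg_pd_le _ _ _)
    refine h1.trans ((ih (m + 1)).trans (le_of_eq ?_))
    rw [List.length_cons]; congr 1; omega

lemma tsupport_pd_subset (u : Eu d → ℂ) (i : Fin d) : tsupport (pd i u) ⊆ tsupport u :=
  tsupport_fderiv_apply_subset ℝ _

lemma Sg_eq_zero {u : Eu d → ℂ} {x : Eu d} (hx : x ∉ tsupport u) (m : ℕ) : Sg m u x = 0 := by
  induction m generalizing u with
  | zero => simpa [Sg] using image_eq_zero_of_notMem_tsupport hx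
  | succ m ih =>
    simp only [Sg]
    rw [image_eq_zero_of_notMem_tsupport hx, Finset.sum_eq_zero]
    · simp
    · intro i _; exact ih fun h => hx (tsupport_pd_subset u i h)

lemma exists_Sg_le (φ : TF d) (m : ℕ) : ∃ M : ℝ, 0 ≤ M ∧ ∀ x, Sg m φ x ≤ M := by
  obtain ⟨M, hM⟩ := φ.hasCompactSupport.exists_bound_of_continuousOn
    (φ.smooth.continuous_Sg m).continuousOn
  refine ⟨max M 0, le_max_right _ _, fun x => ?_⟩
  by_cases hx : x ∈ tsupport φ
  · exact (le_abs_self _).trans ((hM x hx).trans (le_max_left _ _))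
  · rw [Sg_eq_zero hx]; exact le_max_right _ _

/-- A distribution has finite order on every compact set. -/
lemma exists_order (f : Distr d) {K : Set (Eu d)} (hK : IsCompact K) :
    ∃ (N : ℕ) (C : ℝ), 0 ≤ C ∧ ∀ φ : TF d, tsupport φ ⊆ K → ∀ A : ℝ, 0 ≤ A →
      (∀ x, Sg N φ x ≤ A) → ‖f φ‖ ≤ C * A := by
  let Kc : Compacts (Eu d) := ⟨K, hK⟩
  have hsub : (Kc : Set (Eu d)) ⊆ ((⊤ : Opens (Eu d)) : Set (Eu d)) := fun _ _ => trivial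
  let g := f.comp (TestFunction.ofSupportedInCLM ℂ (n := ⊤) (F := ℂ) hsub)
  let q : Seminorm ℂ (ContDiffMapSupportedIn (Eu d) ℂ ⊤ Kc) :=
    (normSeminorm ℂ ℂ).comp g.toLinearMap
  have hq : Continuous q := g.continuous.norm
  obtain ⟨s, C, -, hs⟩ := Seminorm.bound_of_continuous
    (ContDiffMapSupportedIn.withSeminorms ℂ (Eu d) ℂ ⊤ Kc) q hq
  refine ⟨s.sup id, C, C.2, fun φ hφ A hA h => ?_⟩
  let φK : ContDiffMapSupportedIn (Eu d) ℂ ⊤ Kc :=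
    .of_support_subset φ.contDiff ((subset_tsupport _).trans hφ)
  have h1 : ‖f φ‖ = q φK := rfl
  rw [h1]
  refine (hs φK).trans ?_
  rw [smul_apply, NNReal.smul_def, smul_eq_mul]
  refine mul_le_mul_of_nonneg_left ?_ C.2
  refine Seminorm.finset_sup_apply_le hA fun i hi => ?_
  rw [ContDiffMapSupportedIn.seminorm_top_le_iff ℂ hA]
  intro x _
  refine (norm_iteratedFDeriv_le_Sg φ.smooth i x).trans ((Sg_mono ?_ _ _).trans (h x))
  exact Finset.le_sup (f := id) hi

/-! ### Operations on test functions -/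

/-- The partial derivative of a test function, as a test function. -/
def tpd (i : Fin d) (φ : TF d) : TF d where
  toFun := pd i φ
  contDiff' := φ.smooth.pd i
  hasCompactSupport' := φ.hasCompactSupport.mono' <|
    (subset_tsupport _).trans (tsupport_pd_subset _ i)
  tsupport_subset' := fun _ _ => trivial

@[simp] lemma coe_tpd (i : Fin d) (φ : TF d) : (tpd i φ : Eu d → ℂ) = pd i φ := rfl

/-- The iterated derivative of a test function along a list of coordinates. -/
def tld (l : List (Fin d)) (φ : TF d) : TF d := l.foldr tpd φ

@[simp] lemma coe_tld (l : List (Fin d)) (φ : TF d) : (tld l φ : Eu d → ℂ) = ld l φ := by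
  induction l with
  | nil => rfl
  | cons i l ih => change pd i (tld l φ) = _; rw [ih]; rfl

lemma reflTranslate_apply (φ : TF d) (x y : Eu d) : reflTranslate φ x y = φ (x - y) := rfl

lemma dilate_apply (φ : TF d) (j : ℕ) (y : Eu d) :
    dilate φ j y = (2 : ℂ) ^ (j * d) * φ ((2 : ℝ) ^ j • y) := rfl

lemma exists_tsupport_subset (φ : TF d) : ∃ R : ℝ, 0 ≤ R ∧ tsupport φ ⊆ Metric.closedBall 0 R := by
  obtain ⟨R, hR⟩ := φ.hasCompactSupport.isBounded.subset_closedBall 0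
  exact ⟨max R 0, le_max_right _ _, hR.trans (Metric.closedBall_subset_closedBall (le_max_left _ _))⟩

lemma tsupport_subset_closedBall {u : Eu d → ℂ} {R : ℝ} (h : ∀ x, u x ≠ 0 → ‖x‖ ≤ R) :
    tsupport u ⊆ Metric.closedBall 0 R :=
  closure_minimal (fun x hx => by simpa using h x hx) Metric.isClosed_closedBall

lemma norm_le_of_ne_zero {u : Eu d → ℂ} {R : ℝ} (h : tsupport u ⊆ Metric.closedBall 0 R) {x : Eu d}
    (hx : u x ≠ 0) : ‖x‖ ≤ R := by
  simpa using h (subset_tsupport _ hx)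

lemma tsupport_reflTranslate {φ : TF d} {R : ℝ} (hR : tsupport φ ⊆ Metric.closedBall 0 R)
    {x : Eu d} {r : ℝ} (hx : ‖x‖ ≤ r) :
    tsupport (reflTranslate φ x) ⊆ Metric.closedBall 0 (r + R) := by
  refine tsupport_subset_closedBall fun y hy => ?_
  have h1 : ‖x - y‖ ≤ R := norm_le_of_ne_zero hR hy
  calc ‖y‖ = ‖x - (x - y)‖ := by simp
    _ ≤ ‖x‖ + ‖x - y‖ := norm_sub_le _ _
    _ ≤ r + R := add_le_add hx h1

lemma ld_reflTranslate (φ : TF d) (x : Eu d) (l : List (Fin d)) (y : Eu d) :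
    ld l (reflTranslate φ x) y = (-1 : ℂ) ^ l.length * ld l φ (x - y) := by
  have := ld_comp_sub_left φ.smooth x l
  exact congrFun this y

lemma dconv_add (f : Distr d) (φ ψ : TF d) (x : Eu d) :
    dconv f (φ + ψ) x = dconv f φ x + dconv f ψ x := by
  have : reflTranslate (φ + ψ) x = reflTranslate φ x + reflTranslate ψ x := by ext y; rfl
  simp only [dconv, this, map_add]

lemma dconv_sub (f : Distr d) (φ ψ : TF d) (x : Eu d) :
    dconv f (φ - ψ) x = dconv f φ x - dconv f ψ x := by
  have : reflTranslate (φ - ψ) x = reflTranslate φ x - reflTranslate ψ x := by ext y; rfl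
  simp only [dconv, this, map_sub]

lemma dconv_smul (f : Distr d) (c : ℂ) (φ : TF d) (x : Eu d) :
    dconv f (c • φ) x = c * dconv f φ x := by
  have : reflTranslate (c • φ) x = c • reflTranslate φ x := by ext y; rfl
  simp only [dconv, this, map_smul, smul_eq_mul]

lemma tf_sum_apply {ι : Type*} (s : Finset ι) (φ : ι → TF d) (x : Eu d) :
    (∑ k ∈ s, φ k) x = ∑ k ∈ s, φ k x := by
  classical
  induction s using Finset.induction_on with
  | empty => rfl
  | insert a s ha ih => rw [Finset.sum_insert ha, Finset.sum_insert ha, ← ih]; rfl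

lemma dconv_sum {ι : Type*} (f : Distr d) (s : Finset ι) (φ : ι → TF d) (x : Eu d) :
    dconv f (∑ k ∈ s, φ k) x = ∑ k ∈ s, dconv f (φ k) x := by
  have : reflTranslate (∑ k ∈ s, φ k) x = ∑ k ∈ s, reflTranslate (φ k) x := by
    ext y; rw [tf_sum_apply, reflTranslate_apply, tf_sum_apply]; rfl
  simp only [dconv, this, map_sum]

/-! ### Smoothness of the convolution with a test function -/

lemma norm_add_sub_taylor_one_le {u : Eu d → ℂ} (hu : Smooth u) {M : ℝ} (hM : ∀ x, Sg 1 u x ≤ M)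
    (z v : Eu d) : ‖u (z + v) - u z‖ ≤ M * ‖v‖ := by
  have h := norm_taylor_sub_le (g := fun k t => (dirD v)^[k] u (z + t • v))
    (fun k t => hasDerivAt_dirD_iter hu z v k t) 1 (M := M * ‖v‖) (fun t _ => by
      refine (norm_dirD_iter_le hu v 1 _).trans ?_
      rw [pow_one, mul_comm]
      exact mul_le_mul_of_nonneg_right (hM _) (norm_nonneg _)) (t := 1) (by simp)
  simpa using h

lemma norm_add_sub_taylor_two_le {u : Eu d → ℂ} (hu : Smooth u) {M : ℝ} (hM : ∀ x, Sg 2 u x ≤ M)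
    (z v : Eu d) : ‖u (z + v) - u z - ∑ i, (v i : ℂ) * pd i u z‖ ≤ M * ‖v‖ ^ 2 := by
  have h := norm_taylor_sub_le (g := fun k t => (dirD v)^[k] u (z + t • v))
    (fun k t => hasDerivAt_dirD_iter hu z v k t) 2 (M := M * ‖v‖ ^ 2) (fun t _ => by
      refine (norm_dirD_iter_le hu v 2 _).trans ?_
      rw [mul_comm]
      exact mul_le_mul_of_nonneg_right (hM _) (by positivity)) (t := 1) (by simp)
  simp only [Finset.sum_range_succ, Finset.sum_range_zero, Function.iterate_zero, id, one_smul,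
    zero_smul, add_zero, Complex.ofReal_one, one_pow, Nat.factorial, Function.iterate_one,
    dirD_eq_sum] at h
  simpa [sub_sub] using h

/-- The difference quotients of `φ` converge in `𝓓`: their second-order Taylor remainders, with all
derivatives up to the order of `f`, are `O(‖v‖^2)`. -/
lemma hasFDerivAt_dconv (f : Distr d) (φ : TF d) (x : Eu d) :
    HasFDerivAt (dconv f φ) (∑ i, (EuclideanSpace.proj i : Eu d →L[ℝ] ℝ).smulRight
      (dconv f (tpd i φ) x)) x := by
  obtain ⟨R, hR0, hR⟩ := exists_tsupport_subset φ
  obtain ⟨N, C, hC, hN⟩ := exists_order f (isCompact_closedBall (0 : Eu d) (‖x‖ + 1 + R))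
  obtain ⟨M, hM0, hM⟩ := exists_Sg_le φ (N + 2)
  rw [hasFDerivAt_iff_isLittleO_nhds_zero]
  refine Asymptotics.IsBigO.trans_isLittleO (g := fun v : Eu d => ‖v‖ ^ 2) ?_ ?_
  · refine Asymptotics.IsBigO.of_bound (C * ((1 + d : ℝ) ^ N * M)) ?_
    filter_upwards [Metric.closedBall_mem_nhds (0 : Eu d) one_pos] with v hv
    have hv1 : ‖v‖ ≤ 1 := by simpa using hv
    set Φ : TF d := reflTranslate φ (x + v) - reflTranslate φ x
      - ∑ i, (v i : ℂ) • reflTranslate (tpd i φ) x with hΦ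
    have hval : f Φ = dconv f φ (x + v) - dconv f φ x
        - (∑ i, (EuclideanSpace.proj i : Eu d →L[ℝ] ℝ).smulRight (dconv f (tpd i φ) x)) v := by
      simp [hΦ, dconv]
    rw [← hval]
    have hΦy : (Φ : Eu d → ℂ) = fun y => (φ (x + v - y) - φ (x - y))
        - ∑ i, (v i : ℂ) * pd i φ (x - y) := by
      funext y
      change (reflTranslate φ (x + v) y - reflTranslate φ x y)
        - (∑ i, (v i : ℂ) • reflTranslate (tpd i φ) x) y = _
      rw [tf_sum_apply]; rfl
    have hsm : ∀ a : Eu d, Smooth fun y => φ (a - y) := fun a => (reflTranslate φ a).smooth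
    have hsm' : ∀ i, Smooth fun y => (v i : ℂ) * pd i φ (x - y) := fun i =>
      contDiff_const.mul (reflTranslate (tpd i φ) x).smooth
    have hsupp : tsupport Φ ⊆ Metric.closedBall 0 (‖x‖ + 1 + R) := by
      refine tsupport_subset_closedBall fun y hy => ?_
      by_contra hcon
      push Not at hcon
      refine hy ?_
      have hz : ∀ a : Eu d, ‖a‖ ≤ ‖x‖ + 1 → a - y ∉ tsupport φ := by
        intro a ha hmem
        have h1 : ‖a - y‖ ≤ R := by simpa using hR hmem
        have h2 : ‖y‖ ≤ ‖a‖ + ‖a - y‖ := by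
          calc ‖y‖ = ‖a - (a - y)‖ := by simp
            _ ≤ _ := norm_sub_le _ _
        linarith
      have hx1 := hz x (by linarith)
      have hx2 := hz (x + v) ((norm_add_le _ _).trans (by linarith))
      rw [hΦy]
      simp only
      rw [image_eq_zero_of_notMem_tsupport hx1, image_eq_zero_of_notMem_tsupport hx2,
        Finset.sum_eq_zero]
      · simp
      · intro i _
        rw [image_eq_zero_of_notMem_tsupport (fun h => hx1 (tsupport_pd_subset _ i h)), mul_zero]
    have hld : ∀ l : List (Fin d), l.length ≤ N → ∀ y, ‖ld l Φ y‖ ≤ M * ‖v‖ ^ 2 := by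
      intro l hl y
      have e1 : ld l Φ y = (-1 : ℂ) ^ l.length * (ld l φ (x - y + v) - ld l φ (x - y)
          - ∑ i, (v i : ℂ) * pd i (ld l φ) (x - y)) := by
        rw [hΦy, ld_sub ((hsm _).sub (hsm _)) (ContDiff.sum fun i _ => hsm' i),
          ld_sub (hsm _) (hsm _), ld_sum _ hsm']
        have e2 : ∀ i, ld l (fun y => (v i : ℂ) * pd i φ (x - y)) y
            = (-1 : ℂ) ^ l.length * ((v i : ℂ) * pd i (ld l φ) (x - y)) := by
          intro i
          rw [ld_const_mul (u := fun y => pd i φ (x - y)) (reflTranslate (tpd i φ) x).smooth]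
          have := ld_reflTranslate (tpd i φ) x l y
          simp only [coe_tpd, ld_pd φ.smooth] at this
          have h' : ld l (fun y => pd i φ (x - y)) y = ld l (reflTranslate (tpd i φ) x) y := rfl
          simp only [h', this]; ring
        simp only [e2]
        rw [← Finset.mul_sum]
        have e3 := ld_reflTranslate φ (x + v) l y
        have e4 := ld_reflTranslate φ x l y
        change ld l (fun y => φ (x + v - y)) y = _ at e3
        change ld l (fun y => φ (x - y)) y = _ at e4
        rw [e3, e4, show x + v - y = x - y + v by abel]
        ring
      rw [e1, norm_mul]
      simp only [norm_pow, norm_neg, norm_one, one_pow, one_mul]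
      refine norm_add_sub_taylor_two_le (φ.smooth.ld l) (fun z => ?_) _ _
      exact (Sg_ld_le 2 l φ z).trans ((Sg_mono (by omega) _ _).trans (hM z))
    have := hN Φ hsupp ((1 + d : ℝ) ^ N * (M * ‖v‖ ^ 2)) (by positivity)
      (fun y => Sg_le_of_ld_le fun l hl => hld l hl y)
    refine this.trans (le_of_eq ?_)
    rw [Real.norm_of_nonneg (by positivity)]; ring
  · exact Asymptotics.isLittleO_norm_pow_id one_lt_two

lemma pd_dconv (f : Distr d) (φ : TF d) (i : Fin d) :
    pd i (dconv f φ) = dconv f (tpd i φ) := by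
  funext x
  simp only [pd, dirD]
  rw [(hasFDerivAt_dconv f φ x).fderiv]
  simp

lemma smooth_dconv (f : Distr d) (φ : TF d) : Smooth (dconv f φ) := by
  refine smooth_of_closed (fun u => ∃ φ : TF d, u = dconv f φ) ?_ ?_ ⟨φ, rfl⟩
  · rintro _ ⟨φ, rfl⟩ x; exact (hasFDerivAt_dconv f φ x).differentiableAt
  · rintro _ ⟨φ, rfl⟩ i; exact ⟨_, pd_dconv f φ i⟩

lemma ld_dconv (f : Distr d) (φ : TF d) (l : List (Fin d)) :
    ld l (dconv f φ) = dconv f (tld l φ) := by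
  induction l with
  | nil => rfl
  | cons i l ih => rw [ld_cons, ih, pd_dconv]; rfl

/-! ### Convolutions of functions with test functions -/

lemma cv_eq_convolution (h ψ : Eu d → ℂ) :
    cv h ψ = convolution h ψ (ContinuousLinearMap.mul ℝ ℂ) volume := by
  funext x; rw [convolution_eq_swap]; rfl

lemma cv_comm (h ψ : Eu d → ℂ) : cv h ψ = cv ψ h := by
  funext x
  unfold cv
  rw [← integral_sub_left_eq_self _ volume x]
  simp only [sub_sub_cancel, mul_comm]

lemma tconv_eq_cv (φ ψ : TF d) : tconv φ ψ = cv φ ψ := by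
  rw [cv_comm]
  funext x
  simp only [tconv, convolution_def, cv]
  simp only [ContinuousLinearMap.mul_apply', mul_comm]

lemma smooth_cv {h : Eu d → ℂ} (hh : LocallyIntegrable h volume) (ψ : TF d) :
    Smooth (cv h ψ) := by
  rw [cv_eq_convolution]
  exact ψ.hasCompactSupport.contDiff_convolution_right _ hh ψ.contDiff

lemma pd_cv_right {h : Eu d → ℂ} (hh : LocallyIntegrable h volume) (ψ : TF d) (i : Fin d) :
    pd i (cv h ψ) = cv h (pd i ψ) := by
  funext x
  have h1 := ψ.hasCompactSupport.hasFDerivAt_convolution_right (ContinuousLinearMap.mul ℝ ℂ)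
    hh (ψ.contDiff.of_le (by exact_mod_cast le_top)) x
  simp only [pd, dirD]
  rw [cv_eq_convolution, h1.fderiv, convolution_precompR_apply _ hh
    (ψ.hasCompactSupport.fderiv ℝ) (ψ.contDiff.continuous_fderiv (by simp)), cv_eq_convolution]
  rfl

lemma pd_cv_left {h : Eu d → ℂ} (hh : Smooth h) (ψ : TF d) (i : Fin d) :
    pd i (cv h ψ) = cv (pd i h) ψ := by
  rw [pd_cv_right hh.continuous.locallyIntegrable]
  funext x
  unfold cv
  have hr : Smooth fun y => h (x - y) := hh.comp (contDiff_const.sub contDiff_id)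
  have h2 : ∀ y, pd i (fun y => h (x - y)) y = - pd i h (x - y) := fun y =>
    congrFun (pd_comp_sub_left hh.diff x i) y
  have := integral_mul_fderiv_eq_neg_fderiv_mul_of_integrable (𝕜 := ℂ) (μ := volume)
    (f := fun y : Eu d => h (x - y)) (g := ψ) (v := EuclideanSpace.single i (1 : ℝ))
    (integrable_cont_mul_tf (hr.pd i).continuous ψ)
    (integrable_cont_mul_tf hr.continuous (tpd i ψ))
    (integrable_cont_mul_tf hr.continuous ψ) (fun y _ => hr.diff y) (fun y _ => ψ.smooth.diff y)
  change ∫ y, h (x - y) * pd i ψ y = - ∫ y, pd i (fun y => h (x - y)) y * ψ y at this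
  rw [this, ← integral_neg]
  simp only [h2, neg_mul, neg_neg]

lemma ld_cv_left {h : Eu d → ℂ} (hh : Smooth h) (ψ : TF d) (l : List (Fin d)) :
    ld l (cv h ψ) = cv (ld l h) ψ := by
  induction l with
  | nil => rfl
  | cons i l ih => rw [ld_cons, ih, pd_cv_left (hh.ld l)]; rfl

lemma ld_cv_right {h : Eu d → ℂ} (hh : LocallyIntegrable h volume) (ψ : TF d) (l : List (Fin d)) :
    ld l (cv h ψ) = cv h (ld l ψ) := by
  induction l with
  | nil => rfl
  | cons i l ih => rw [ld_cons, ih, ← coe_tld, pd_cv_right hh, coe_tld]; rfl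

lemma cv_ne_zero {h : Eu d → ℂ} {ψ : TF d} {R r : ℝ} (hR : tsupport ψ ⊆ Metric.closedBall 0 R)
    (hr : tsupport h ⊆ Metric.closedBall 0 r) (x : Eu d) (hx : cv h ψ x ≠ 0) : ‖x‖ ≤ r + R := by
  by_contra hcon
  push Not at hcon
  refine hx (integral_eq_zero_of_ae (Filter.Eventually.of_forall fun y => ?_))
  by_contra hy
  have h1 : ‖x - y‖ ≤ r := norm_le_of_ne_zero hr (left_ne_zero_of_mul hy)
  have h2 : ‖y‖ ≤ R := norm_le_of_ne_zero hR (right_ne_zero_of_mul hy)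
  have h3 : ‖x‖ ≤ ‖x - y‖ + ‖y‖ := by simpa using norm_add_le (x - y) y
  linarith

/-- The convolution of two test functions, as a test function. -/
def tcv (φ ψ : TF d) : TF d where
  toFun := cv φ ψ
  contDiff' := smooth_cv φ.continuous.locallyIntegrable ψ
  hasCompactSupport' := by
    obtain ⟨r, -, hr⟩ := exists_tsupport_subset φ
    obtain ⟨R, -, hR⟩ := exists_tsupport_subset ψ
    exact (isCompact_closedBall (0 : Eu d) (r + R)).of_isClosed_subset (isClosed_tsupport _)
      (tsupport_subset_closedBall (cv_ne_zero hR hr))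
  tsupport_subset' := fun _ _ => trivial

@[simp] lemma coe_tcv (φ ψ : TF d) : (tcv φ ψ : Eu d → ℂ) = cv φ ψ := rfl

lemma tsupport_tcv {φ ψ : TF d} {R r : ℝ} (hR : tsupport ψ ⊆ Metric.closedBall 0 R)
    (hr : tsupport φ ⊆ Metric.closedBall 0 r) :
    tsupport (tcv φ ψ) ⊆ Metric.closedBall 0 (r + R) :=
  tsupport_subset_closedBall (cv_ne_zero hR hr)

/-! ### Convolution of a distribution with the convolution of two test functions -/

instance (N : ℕ) : Fintype {l : List (Fin d) // l.length ≤ N} :=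
  haveI : Finite {l : List (Fin d) // l.length ≤ N} := (List.finite_length_le (Fin d) N).to_subtype
  Fintype.ofFinite _

/-- The jet of order `N` of a test function: the family of its partial derivatives of order at most
`N` in the Banach space of families of bounded continuous functions. -/
def jet (N : ℕ) :
    TF d →ₗ[ℂ] ({l : List (Fin d) // l.length ≤ N} → BoundedContinuousFunction (Eu d) ℂ) where
  toFun φ := fun l => TestFunction.toBoundedContinuousFunctionCLM ℂ (tld l.1 φ)
  map_add' φ ψ := by
    funext l; ext x
    change tld l.1 (φ + ψ) x = tld l.1 φ x + tld l.1 ψ x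
    simp only [coe_tld]
    exact congrFun (ld_add φ.smooth ψ.smooth l.1) x
  map_smul' c φ := by
    funext l; ext x
    change tld l.1 (c • φ) x = c * tld l.1 φ x
    simp only [coe_tld]
    exact congrFun (ld_const_mul φ.smooth c l.1) x

lemma jet_apply (N : ℕ) (φ : TF d) (l : {l : List (Fin d) // l.length ≤ N}) (x : Eu d) :
    jet N φ l x = ld l.1 φ x := by
  change tld l.1 φ x = _
  rw [coe_tld]

lemma norm_jet_le {N : ℕ} {φ : TF d} {A : ℝ} (hA : 0 ≤ A)
    (h : ∀ l : List (Fin d), l.length ≤ N → ∀ x, ‖ld l φ x‖ ≤ A) : ‖jet N φ‖ ≤ A := by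
  rw [pi_norm_le_iff_of_nonneg hA]
  intro l
  rw [BoundedContinuousFunction.norm_le hA]
  intro x
  rw [jet_apply]
  exact h l.1 l.2 x

/-- On the test functions supported in a compact set, a distribution is a continuous linear
functional of finitely many derivatives. -/
lemma exists_jet_functional (f : Distr d) {K : Set (Eu d)} (hK : IsCompact K) :
    ∃ (N : ℕ) (F : ({l : List (Fin d) // l.length ≤ N} → BoundedContinuousFunction (Eu d) ℂ) →L[ℂ] ℂ),
      ∀ φ : TF d, tsupport φ ⊆ K → f φ = F (jet N φ) := by
  obtain ⟨N, C, hC, hN⟩ := exists_order f hK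
  let V : Submodule ℂ (TF d) :=
    { carrier := {φ | tsupport φ ⊆ K}
      add_mem' := fun {φ ψ} hφ hψ => (tsupport_add φ ψ).trans (Set.union_subset hφ hψ)
      zero_mem' := by
        change tsupport (0 : Eu d → ℂ) ⊆ K
        simp
      smul_mem' := fun c φ hφ =>
        (tsupport_smul_subset_right (fun _ : Eu d => c) (φ : Eu d → ℂ)).trans hφ }
  let J := (jet (d := d) N).comp V.subtype
  have hJ : Function.Injective J := by
    intro φ ψ h
    ext x
    have := congrArg (fun b => b ⟨[], by simp⟩ x) h
    simp only [J, LinearMap.comp_apply, Submodule.subtype_apply, jet_apply, ld_nil] at this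
    exact this
  let e := LinearEquiv.ofInjective J hJ
  let g : LinearMap.range J →ₗ[ℂ] ℂ := f.toLinearMap.comp (V.subtype.comp e.symm.toLinearMap)
  have hg : ∀ b, ‖g b‖ ≤ (C * (1 + d : ℝ) ^ N) * ‖b‖ := by
    intro b
    obtain ⟨φ, rfl⟩ := e.surjective b
    have h1 : g (e φ) = f φ.1 := by simp [g]
    have h2 : ‖e φ‖ = ‖jet N φ.1‖ := rfl
    rw [h1, h2, mul_assoc]
    refine hN φ.1 φ.2 _ (by positivity) fun x => Sg_le_of_ld_le fun l hl => ?_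
    rw [← jet_apply N φ.1 ⟨l, hl⟩ x]
    exact (BoundedContinuousFunction.norm_coe_le_norm _ _).trans (norm_le_pi_norm _ _)
  obtain ⟨F, hF, -⟩ := exists_extension_norm_eq (LinearMap.range J) (g.mkContinuous _ hg)
  refine ⟨N, F, fun φ hφ => ?_⟩
  have h1 := hF (e ⟨φ, hφ⟩)
  have h2 : ((e ⟨φ, hφ⟩ : LinearMap.range J) :
    {l : List (Fin d) // l.length ≤ N} → BoundedContinuousFunction (Eu d) ℂ) = jet N φ := rfl
  rw [h2] at h1
  rw [h1]
  simp [g]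

lemma ld_tf_sub (φ ψ : TF d) (l : List (Fin d)) (x : Eu d) :
    ld l ((φ - ψ : TF d) : Eu d → ℂ) x = ld l φ x - ld l ψ x :=
  congrFun (ld_sub φ.smooth ψ.smooth l) x

lemma exists_jet_reflTranslate_lipschitz (N : ℕ) (φ : TF d) : ∃ M : ℝ, 0 ≤ M ∧ ∀ x y : Eu d,
    ‖jet N (reflTranslate φ x) - jet N (reflTranslate φ y)‖ ≤ M * ‖x - y‖ := by
  obtain ⟨M, hM0, hM⟩ := exists_Sg_le φ (N + 1)
  refine ⟨M, hM0, fun x y => ?_⟩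
  rw [← map_sub]
  refine norm_jet_le (by positivity) fun l hl z => ?_
  rw [ld_tf_sub, ld_reflTranslate, ld_reflTranslate, ← mul_sub, norm_mul,
    show x - z = y - z + (x - y) by abel]
  simp only [norm_pow, norm_neg, norm_one, one_pow, one_mul]
  refine norm_add_sub_taylor_one_le (φ.smooth.ld l) (fun w => ?_) _ _
  exact (Sg_ld_le 1 l φ w).trans ((Sg_mono (by omega) _ _).trans (hM w))

/-- `f * (φ * θ) = (f * φ) * θ`: the distribution is interchanged with the integral defining the
convolution `φ * θ`, which converges as a Bochner integral of jets. -/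
lemma dconv_tcv (f : Distr d) (φ θ : TF d) : dconv f (tcv φ θ) = cv (dconv f φ) θ := by
  funext x
  obtain ⟨r, hr0, hr⟩ := exists_tsupport_subset φ
  obtain ⟨R, hR0, hR⟩ := exists_tsupport_subset θ
  obtain ⟨N, F, hF⟩ := exists_jet_functional f
    (isCompact_closedBall (0 : Eu d) (‖x‖ + R + (r + R)))
  obtain ⟨M, hM0, hM⟩ := exists_jet_reflTranslate_lipschitz N φ
  have hcontJ : Continuous fun a : Eu d => jet N (reflTranslate φ a) := by
    refine (LipschitzWith.of_dist_le_mul (K := ⟨M, hM0⟩) fun a b => ?_).continuous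
    rw [dist_eq_norm, dist_eq_norm]; exact hM a b
  set Ψ : Eu d → ({l : List (Fin d) // l.length ≤ N} → BoundedContinuousFunction (Eu d) ℂ) :=
    fun y => θ y • jet N (reflTranslate φ (x - y)) with hΨ
  have hint : Integrable Ψ := by
    refine Continuous.integrable_of_hasCompactSupport ?_ ?_
    · exact θ.continuous.smul (hcontJ.comp (by fun_prop))
    · exact θ.hasCompactSupport.smul_right
  have hval : ∫ y, Ψ y = jet N (reflTranslate (tcv φ θ) x) := by
    funext l; ext z
    let ev : ({l : List (Fin d) // l.length ≤ N} → BoundedContinuousFunction (Eu d) ℂ) →L[ℂ] ℂ :=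
      (BoundedContinuousFunction.evalCLM ℂ z).comp
        (ContinuousLinearMap.proj (R := ℂ) (φ := fun _ => BoundedContinuousFunction (Eu d) ℂ) l)
    have h1 : (∫ y, Ψ y) l z = ∫ y, Ψ y l z := (ev.integral_comp_comm hint).symm
    rw [h1, jet_apply, ld_reflTranslate, coe_tcv, ld_cv_left φ.smooth, cv, ← integral_const_mul]
    refine integral_congr_ae (Filter.Eventually.of_forall fun y => ?_)
    change θ y * jet N (reflTranslate φ (x - y)) l z = _
    beta_reduce
    rw [jet_apply, ld_reflTranslate, show x - z - y = x - y - z by abel]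
    ring
  have hL : dconv f (tcv φ θ) x = F (∫ y, Ψ y) := by
    rw [hval, dconv]
    refine hF _ ((tsupport_reflTranslate (tsupport_tcv hR hr) le_rfl).trans
      (Metric.closedBall_subset_closedBall (by linarith)))
  rw [hL, ← F.integral_comp_comm hint, cv]
  refine integral_congr_ae (Filter.Eventually.of_forall fun y => ?_)
  simp only [hΨ, map_smul, smul_eq_mul]
  by_cases hy : θ y = 0
  · simp [hy]
  · have hyR : ‖y‖ ≤ R := norm_le_of_ne_zero hR hy
    rw [← hF, dconv, mul_comm]
    refine (tsupport_reflTranslate hr (r := ‖x‖ + R) ?_).trans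
      (Metric.closedBall_subset_closedBall (by linarith))
    exact (norm_sub_le _ _).trans (by linarith)

/-- A distribution given by a continuous function acts by convolution as that function. -/
lemma dconv_of_represents {g : Eu d → ℂ} {f : Distr d} (hf : Represents g f) (φ : TF d) :
    dconv f φ = cv g φ := by
  rw [cv_comm]
  funext x
  rw [dconv, hf]
  refine integral_congr_ae (Filter.Eventually.of_forall fun y => ?_)
  simp only [reflTranslate_apply, mul_comm]

/-- If `∫ φ = 1`, then `φ_k` is an approximate identity, with rate `2^{-k}` on smooth functions. -/
lemma exists_norm_cv_dilate_sub_le (φ : TF d) (hφ : ∫ x, φ x = 1) : ∃ C : ℝ, 0 ≤ C ∧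
    ∀ (u : Eu d → ℂ), Smooth u → ∀ M : ℝ, (∀ x, Sg 1 u x ≤ M) → ∀ (k : ℕ) (x : Eu d),
      ‖cv u (dilate φ k) x - u x‖ ≤ C * M * (2⁻¹ : ℝ) ^ k := by
  refine ⟨∫ y, ‖y‖ * ‖φ y‖, integral_nonneg fun y => by positivity, fun u hu M hM k x => ?_⟩
  have h1 : Integrable fun y : Eu d => u (x + (2⁻¹ : ℝ) ^ k • (-y)) * φ y :=
    integrable_cont_mul_tf (by have := hu.continuous; fun_prop) φ
  have h2 : Integrable fun y : Eu d => u x * φ y := integrable_cont_mul_tf continuous_const φ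
  have h3 : cv u (dilate φ k) x - u x
      = ∫ y, (u (x + (2⁻¹ : ℝ) ^ k • (-y)) - u x) * φ y := by
    simp only [sub_mul]
    rw [integral_sub h1 h2, integral_const_mul, hφ, mul_one, cv_dilate]
  rw [h3, ← integral_mul_const, ← integral_mul_const]
  have hint : Integrable fun y : Eu d => ‖y‖ * ‖φ y‖ * M * (2⁻¹ : ℝ) ^ k := by
    refine (Integrable.mul_const ?_ _).mul_const _
    have := (integrable_cont_mul_tf (h := fun y : Eu d => ((‖y‖ : ℝ) : ℂ))
      (by fun_prop) φ).norm
    simpa using this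
  refine norm_integral_le_of_norm_le hint (Filter.Eventually.of_forall fun y => ?_)
  rw [norm_mul]
  refine (mul_le_mul_of_nonneg_right (norm_add_sub_taylor_one_le hu hM _ _)
    (norm_nonneg _)).trans (le_of_eq ?_)
  rw [norm_smul, norm_neg, Real.norm_of_nonneg (by positivity)]
  ring

lemma tsupport_dilate {φ : TF d} {R : ℝ} (hR : tsupport φ ⊆ Metric.closedBall 0 R) (j : ℕ) :
    tsupport (dilate φ j) ⊆ Metric.closedBall 0 R := by
  refine tsupport_subset_closedBall fun x hx => ?_
  rw [dilate_apply] at hx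
  have h1 := norm_le_of_ne_zero hR (right_ne_zero_of_mul hx)
  rw [norm_smul, Real.norm_of_nonneg (by positivity)] at h1
  exact (le_mul_of_one_le_left (norm_nonneg _) (one_le_pow₀ one_le_two)).trans h1

/-- If `∫ φ = 1`, then `f * φ_k * θ` converges to `f * θ`. -/
lemma tendsto_dconv_tcv_dilate (f : Distr d) (φ : TF d) (hφ : ∫ x, φ x = 1) (θ : TF d) (x : Eu d) :
    Filter.Tendsto (fun k => dconv f (tcv (dilate φ k) θ) x) Filter.atTop (nhds (dconv f θ x)) := by
  obtain ⟨r, hr0, hr⟩ := exists_tsupport_subset φ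
  obtain ⟨R, hR0, hR⟩ := exists_tsupport_subset θ
  obtain ⟨N, C, hC, hN⟩ := exists_order f (isCompact_closedBall (0 : Eu d) (‖x‖ + (r + R)))
  obtain ⟨D, hD, hDφ⟩ := exists_norm_cv_dilate_sub_le φ hφ
  obtain ⟨M, hM0, hM⟩ := exists_Sg_le θ (N + 1)
  rw [tendsto_iff_norm_sub_tendsto_zero]
  have hlim : Filter.Tendsto (fun k : ℕ => C * ((1 + d : ℝ) ^ N * (D * M * (2⁻¹ : ℝ) ^ k)))
      Filter.atTop (nhds 0) := by
    have := tendsto_pow_atTop_nhds_zero_of_lt_one (r := (2⁻¹ : ℝ)) (by norm_num) (by norm_num)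
    simpa using (((this.const_mul (D * M)).const_mul ((1 + d : ℝ) ^ N)).const_mul C)
  refine squeeze_zero (fun _ => norm_nonneg _) (fun k => ?_) hlim
  rw [← dconv_sub, dconv]
  have hsub : tsupport (tcv (dilate φ k) θ - θ) ⊆ Metric.closedBall 0 (r + R) := by
    refine (tsupport_sub _ _).trans (Set.union_subset (tsupport_tcv hR (tsupport_dilate hr k)) ?_)
    exact hR.trans (Metric.closedBall_subset_closedBall (by linarith))
  refine hN _ (tsupport_reflTranslate hsub le_rfl) _ (by positivity) fun y =>
    Sg_le_of_ld_le fun l hl => ?_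
  rw [ld_reflTranslate, norm_mul]
  simp only [norm_pow, norm_neg, norm_one, one_pow, one_mul]
  rw [ld_tf_sub, coe_tcv, cv_comm, ld_cv_left θ.smooth]
  exact hDφ _ (θ.smooth.ld l) M
    (fun z => (Sg_ld_le 1 l θ z).trans ((Sg_mono (by omega) _ _).trans (hM z))) k _

/-! ### Weighted norms and local averages -/

/-- Minkowski's integral inequality for a finite measure, with a uniform bound on the sections. -/
lemma eLpNorm_lintegral_le {α β : Type*} [MeasurableSpace α] [MeasurableSpace β] {μ : Measure α}
    {ν : Measure β} [SFinite μ] [IsFiniteMeasure ν] {p : ℝ≥0∞} (hp : 1 ≤ p) {F : α → β → ℝ≥0∞}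
    (hF : Measurable (Function.uncurry F)) {M : ℝ≥0∞}
    (hM : ∀ᵐ y ∂ν, eLpNorm (fun x => F x y) p μ ≤ M) :
    eLpNorm (fun x => ∫⁻ y, F x y ∂ν) p μ ≤ ν Set.univ * M := by
  have hFx : ∀ x, Measurable (F x) := fun x => hF.comp (measurable_const.prodMk measurable_id)
  rcases eq_or_ne p ∞ with rfl | hpt
  · rw [eLpNorm_exponent_top]
    refine eLpNormEssSup_le_of_ae_enorm_bound ?_
    have h1 : ∀ᵐ y ∂ν, ∀ᵐ x ∂μ, F x y ≤ M := by
      filter_upwards [hM] with y hy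
      rw [eLpNorm_exponent_top] at hy
      filter_upwards [ae_le_eLpNormEssSup (f := fun x => F x y) (μ := μ)] with x hx
      exact hx.trans hy
    have hms : MeasurableSet {q : α × β | F q.1 q.2 ≤ M} := measurableSet_le hF measurable_const
    rw [← Measure.ae_ae_comm hms] at h1
    filter_upwards [h1] with x hx
    change ∫⁻ y, F x y ∂ν ≤ _
    calc ∫⁻ y, F x y ∂ν ≤ ∫⁻ _, M ∂ν := lintegral_mono_ae hx
      _ = ν Set.univ * M := by rw [lintegral_const, mul_comm]
  · have hp0 : p ≠ 0 := (zero_lt_one.trans_le hp).ne'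
    have hq0 : 0 < p.toReal := ENNReal.toReal_pos hp0 hpt
    have hq1 : 1 ≤ p.toReal := by simpa using ENNReal.toReal_mono hpt hp
    have h1 : ∀ x, (∫⁻ y, F x y ∂ν) ≤ eLpNorm (F x) p ν * ν Set.univ ^ (1 - 1 / p.toReal) := by
      intro x
      have := eLpNorm_le_eLpNorm_mul_rpow_measure_univ (f := F x) hp (hFx x).aestronglyMeasurable
        (μ := ν)
      simpa [eLpNorm_one_eq_lintegral_enorm] using this
    have hx : ∀ x, eLpNorm (F x) p ν ^ p.toReal = ∫⁻ y, F x y ^ p.toReal ∂ν := by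
      intro x
      rw [eLpNorm_eq_lintegral_rpow_enorm_toReal hp0 hpt, ← ENNReal.rpow_mul,
        one_div_mul_cancel hq0.ne', ENNReal.rpow_one]
      rfl
    have hy : ∀ᵐ y ∂ν, ∫⁻ x, F x y ^ p.toReal ∂μ ≤ M ^ p.toReal := by
      filter_upwards [hM] with y hy
      rw [eLpNorm_eq_lintegral_rpow_enorm_toReal hp0 hpt] at hy
      have := ENNReal.rpow_le_rpow hy hq0.le
      rwa [← ENNReal.rpow_mul, one_div_mul_cancel hq0.ne', ENNReal.rpow_one] at this
    rw [eLpNorm_eq_lintegral_rpow_enorm_toReal hp0 hpt]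
    rw [one_div, ENNReal.rpow_inv_le_iff hq0]
    calc ∫⁻ x, ‖∫⁻ y, F x y ∂ν‖ₑ ^ p.toReal ∂μ
        ≤ ∫⁻ x, (∫⁻ y, F x y ^ p.toReal ∂ν) *
            (ν Set.univ ^ (1 - 1 / p.toReal)) ^ p.toReal ∂μ := by
          refine lintegral_mono fun x => ?_
          rw [← hx, ← ENNReal.mul_rpow_of_nonneg _ _ hq0.le]
          exact ENNReal.rpow_le_rpow (h1 x) hq0.le
      _ = (∫⁻ x, ∫⁻ y, F x y ^ p.toReal ∂ν ∂μ) *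
            (ν Set.univ ^ (1 - 1 / p.toReal)) ^ p.toReal := by
          rw [lintegral_mul_const]
          exact Measurable.lintegral_prod_right' (hF.pow_const _)
      _ = (∫⁻ y, ∫⁻ x, F x y ^ p.toReal ∂μ ∂ν) *
            (ν Set.univ ^ (1 - 1 / p.toReal)) ^ p.toReal := by
          rw [lintegral_lintegral_swap]
          exact (hF.pow_const _).aemeasurable
      _ ≤ (M ^ p.toReal * ν Set.univ) * (ν Set.univ ^ (1 - 1 / p.toReal)) ^ p.toReal := by
          gcongr
          calc _ ≤ ∫⁻ _, M ^ p.toReal ∂ν := lintegral_mono_ae hy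
            _ = _ := lintegral_const _
      _ = (ν Set.univ * M) ^ p.toReal := by
          rw [ENNReal.mul_rpow_of_nonneg _ _ hq0.le, ← ENNReal.rpow_mul, mul_assoc, mul_comm]
          congr 1
          rcases eq_or_ne (ν Set.univ) 0 with h0 | h0
          · rw [h0, zero_mul, ENNReal.zero_rpow_of_pos hq0]
          · nth_rewrite 1 [← ENNReal.rpow_one (ν Set.univ)]
            rw [← ENNReal.rpow_add _ _ h0 (measure_ne_top _ _)]
            congr 1
            field_simp
            ring

/-- The weighted norm `‖S e^{s ω}‖_{L^p}` of a real function `S`. -/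
def wt (ω : Eu d → ℝ) (p : ℝ≥0∞) (s : ℝ) (S : Eu d → ℝ) : ℝ≥0∞ :=
  eLpNorm (fun x => S x * Real.exp (s * ω x)) p volume

lemma eLpNorm_mul_exp_eq_wt (ω : Eu d → ℝ) (p : ℝ≥0∞) (s : ℝ) (u : Eu d → ℂ) :
    eLpNorm (fun x => u x * (Real.exp (s * ω x) : ℂ)) p volume = wt ω p s fun x => ‖u x‖ := by
  refine eLpNorm_congr_norm_ae (Filter.Eventually.of_forall fun x => ?_)
  simp only [norm_mul, Complex.norm_real, Real.norm_eq_abs, abs_norm]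

lemma wt_mono {s : ℝ} {S T : Eu d → ℝ} (h0 : ∀ x, 0 ≤ S x) (h : ∀ x, S x ≤ T x) :
    wt ω p s S ≤ wt ω p s T := by
  refine eLpNorm_mono fun x => ?_
  rw [norm_mul, norm_mul, Real.norm_of_nonneg (h0 x), Real.norm_of_nonneg ((h0 x).trans (h x))]
  exact mul_le_mul_of_nonneg_right (h x) (norm_nonneg _)

lemma wt_mono_weight {s t : ℝ} {S : Eu d → ℝ} (h : ∀ x, s * ω x ≤ t * ω x) :
    wt ω p s S ≤ wt ω p t S := by
  refine eLpNorm_mono fun x => ?_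
  rw [norm_mul, norm_mul]
  refine mul_le_mul_of_nonneg_left ?_ (norm_nonneg _)
  simpa using h x

lemma wt_const_mul {s c : ℝ} (hc : 0 ≤ c) (S : Eu d → ℝ) :
    wt ω p s (fun x => c * S x) = ENNReal.ofReal c * wt ω p s S := by
  have h := eLpNorm_const_smul c (fun x => S x * Real.exp (s * ω x)) p (volume : Measure (Eu d))
  rw [Real.enorm_eq_ofReal hc] at h
  unfold wt
  rw [← h]
  congr 1; funext x; simp [mul_assoc]

lemma continuous_mul_exp {ω : Eu d → ℝ} (hω : Continuous ω) (s : ℝ) {S : Eu d → ℝ}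
    (hS : Continuous S) : Continuous fun x => S x * Real.exp (s * ω x) := by fun_prop

lemma wt_add_le (hω : Continuous ω) (hp : 1 ≤ p) {s : ℝ} {S T : Eu d → ℝ} (hS : Continuous S)
    (hT : Continuous T) : wt ω p s (fun x => S x + T x) ≤ wt ω p s S + wt ω p s T := by
  have := eLpNorm_add_le (continuous_mul_exp hω s hS).aestronglyMeasurable (μ := volume)
    (continuous_mul_exp hω s hT).aestronglyMeasurable hp
  refine le_trans (le_of_eq ?_) this
  unfold wt; congr 1; funext x; simp [add_mul]

lemma wt_sum_le (hω : Continuous ω) (hp : 1 ≤ p) {s : ℝ} {ι : Type*} (t : Finset ι)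
    {S : ι → Eu d → ℝ} (hS : ∀ i, Continuous (S i)) :
    wt ω p s (fun x => ∑ i ∈ t, S i x) ≤ ∑ i ∈ t, wt ω p s (S i) := by
  have := eLpNorm_sum_le (s := t) (f := fun i x => S i x * Real.exp (s * ω x))
    (fun i _ => (continuous_mul_exp hω s (hS i)).aestronglyMeasurable (μ := volume)) hp
  refine le_trans (le_of_eq ?_) this
  unfold wt; congr 1; funext x; simp [Finset.sum_mul]

lemma wt_Sg_le (hω : Continuous ω) (hp : 1 ≤ p) {s : ℝ} {u : Eu d → ℂ} (hu : Smooth u) {m : ℕ}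
    {A : ℝ≥0∞} (h : ∀ l : List (Fin d), l.length ≤ m → wt ω p s (fun x => ‖ld l u x‖) ≤ A) :
    wt ω p s (Sg m u) ≤ (1 + d : ℝ≥0∞) ^ m * A := by
  induction m generalizing u with
  | zero =>
    rw [pow_zero, one_mul]
    exact h [] (by simp)
  | succ m ih =>
    have h1 : ∀ i, wt ω p s (Sg m (pd i u)) ≤ (1 + d : ℝ≥0∞) ^ m * A := by
      intro i
      refine ih (hu.pd i) fun l hl => ?_
      have := h (l ++ [i]) (by simpa using hl)
      rwa [ld_append] at this
    calc wt ω p s (Sg (m + 1) u)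
        ≤ wt ω p s (fun x => ‖u x‖) + wt ω p s (fun x => ∑ i, Sg m (pd i u) x) :=
          wt_add_le hω hp hu.continuous.norm
            (continuous_finsetSum _ fun i _ => (hu.pd i).continuous_Sg m)
      _ ≤ A + ∑ i, wt ω p s (Sg m (pd i u)) :=
          add_le_add (h [] (by simp)) (wt_sum_le hω hp _ fun i => (hu.pd i).continuous_Sg m)
      _ ≤ A + ∑ _i : Fin d, (1 + d : ℝ≥0∞) ^ m * A := by gcongr with i; exact h1 i
      _ = A + d * ((1 + d : ℝ≥0∞) ^ m * A) := by simp
      _ ≤ (1 + d : ℝ≥0∞) ^ m * A + d * ((1 + d : ℝ≥0∞) ^ m * A) := by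
          gcongr
          exact le_mul_of_one_le_left' (one_le_pow₀ (by simp))
      _ = _ := by ring

/-- Taking local averages is bounded on weighted `L^p`, from the weight `e^{s' ω}` to the weight
`e^{s ω}`, if the first dominates the second up to translations by vectors of length `< R`. -/
lemma wt_average_le (hω : Continuous ω) (hp : 1 ≤ p) {R s s' : ℝ}
    (hw : ∀ x y, ‖y‖ ≤ R → s * ω x ≤ s' * ω (x + y)) {S : Eu d → ℝ} (hS : Continuous S) :
    wt ω p s (fun x => ∫ y in Metric.ball (0 : Eu d) R, S (x + y))
      ≤ volume (Metric.ball (0 : Eu d) R) * wt ω p s' S := by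
  set F : Eu d → Eu d → ℝ≥0∞ := fun x y => ‖S (x + y) * Real.exp (s * ω x)‖ₑ with hF
  have hFm : Measurable (Function.uncurry F) := by
    have : Continuous (Function.uncurry F) := by
      simp only [hF, Function.uncurry_def]; fun_prop
    exact this.measurable
  have : IsFiniteMeasure ((volume : Measure (Eu d)).restrict (Metric.ball (0 : Eu d) R)) :=
    ⟨by rw [Measure.restrict_apply_univ]; exact measure_ball_lt_top⟩
  have key := eLpNorm_lintegral_le (μ := (volume : Measure (Eu d)))
    (ν := (volume : Measure (Eu d)).restrict (Metric.ball (0 : Eu d) R)) hp hFm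
    (M := wt ω p s' S) ?_
  · rw [Measure.restrict_apply_univ] at key
    refine le_trans (eLpNorm_mono_enorm fun x => ?_) key
    rw [← integral_mul_const]
    exact enorm_integral_le_lintegral_enorm _
  · refine (ae_restrict_iff' measurableSet_ball).mpr (Filter.Eventually.of_forall fun y hy => ?_)
    have hy' : ‖y‖ ≤ R := (mem_ball_zero_iff.mp hy).le
    have h1 : eLpNorm (fun x => F x y) p volume
        ≤ eLpNorm ((fun x => S x * Real.exp (s' * ω x)) ∘ fun x => x + y) p volume := by
      refine eLpNorm_mono_enorm fun x => ?_
      change ‖S (x + y) * Real.exp (s * ω x)‖ₑ ≤ ‖S (x + y) * Real.exp (s' * ω (x + y))‖ₑ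
      rw [enorm_mul, enorm_mul]
      gcongr
      rw [Real.enorm_eq_ofReal (Real.exp_pos _).le, Real.enorm_eq_ofReal (Real.exp_pos _).le]
      exact ENNReal.ofReal_le_ofReal (Real.exp_le_exp.mpr (hw x y hy'))
    refine h1.trans (le_of_eq ?_)
    exact eLpNorm_comp_measurePreserving (continuous_mul_exp hω s' hS).aestronglyMeasurable
      (measurePreserving_add_right volume y)

/-- Local averages are locally bounded by any weighted `L^p` norm. -/
lemma exists_average_le_wt (hω : Continuous ω) (hp : 1 ≤ p) (s R ρ : ℝ) :
    ∃ C : ℝ, 0 ≤ C ∧ ∀ S : Eu d → ℝ, Continuous S → (∀ x, 0 ≤ S x) → ∀ b : ℝ, 0 ≤ b →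
      wt ω p s S ≤ ENNReal.ofReal b → ∀ x : Eu d, ‖x‖ ≤ ρ →
      ∫ y in Metric.ball (0 : Eu d) R, S (x + y) ≤ C * b := by
  set B : Set (Eu d) := Metric.closedBall 0 (ρ + R) with hB
  obtain ⟨c, hc⟩ := (isCompact_closedBall (0 : Eu d) (ρ + R)).exists_bound_of_continuousOn
    (f := fun x => Real.exp (-(s * ω x))) (by fun_prop)
  set q : ℝ := 1 / (1 : ℝ≥0∞).toReal - 1 / p.toReal with hq
  have hq0 : 0 ≤ q := by
    rw [hq, ENNReal.toReal_one, div_one, sub_nonneg]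
    rcases eq_or_ne p ∞ with rfl | hpt
    · simp
    · rw [div_le_one (ENNReal.toReal_pos (zero_lt_one.trans_le hp).ne' hpt)]
      simpa using ENNReal.toReal_mono hpt hp
  have hv : volume B ^ q ≠ ∞ := ENNReal.rpow_ne_top_of_nonneg hq0 measure_closedBall_lt_top.ne
  refine ⟨(max c 0) * (volume B ^ q).toReal, by positivity, fun S hS hS0 b hb hSb x hx => ?_⟩
  have hintB : IntegrableOn S B := hS.continuousOn.integrableOn_compact (isCompact_closedBall _ _)
  have h1 : ∫ y in Metric.ball (0 : Eu d) R, S (x + y) ≤ ∫ y in B, S y := by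
    have := (measurePreserving_add_left (volume : Measure (Eu d)) x).setIntegral_preimage_emb
      (MeasurableEquiv.addLeft x).measurableEmbedding S (Metric.ball x R)
    have h2 : (fun z => x + z) ⁻¹' (Metric.ball x R) = Metric.ball (0 : Eu d) R := by
      ext z; simp [dist_eq_norm]
    rw [h2] at this
    rw [this]
    refine setIntegral_mono_set hintB (Filter.Eventually.of_forall hS0)
      (Filter.Eventually.of_forall ?_)
    refine Metric.ball_subset_closedBall.trans (Metric.closedBall_subset_closedBall' ?_)
    simp only [dist_zero_right]; linarith
  refine h1.trans ?_
  have h3 : ENNReal.ofReal (∫ y in B, S y)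
      ≤ ENNReal.ofReal (max c 0 * (volume B ^ q).toReal * b) := by
    rw [ofReal_integral_eq_lintegral_ofReal hintB (Filter.Eventually.of_forall hS0)]
    have h4 : ∫⁻ y in B, ENNReal.ofReal (S y)
        = eLpNorm S 1 (volume.restrict B) := by
      rw [eLpNorm_one_eq_lintegral_enorm]
      refine lintegral_congr fun y => ?_
      rw [Real.enorm_eq_ofReal (hS0 y)]
    rw [h4]
    refine (eLpNorm_le_eLpNorm_mul_rpow_measure_univ hp hS.aestronglyMeasurable).trans ?_
    rw [Measure.restrict_apply_univ]
    have h5 : eLpNorm S p (volume.restrict B) ≤ ENNReal.ofReal (max c 0) * ENNReal.ofReal b := by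
      have h6 : eLpNorm S p (volume.restrict B)
          ≤ eLpNorm ((max c 0) • fun x => S x * Real.exp (s * ω x)) p (volume.restrict B) := by
        refine eLpNorm_mono_ae ?_
        refine (ae_restrict_iff' measurableSet_closedBall).mpr
          (Filter.Eventually.of_forall fun y hy => ?_)
        have h7 := hc y hy
        rw [Real.norm_of_nonneg (Real.exp_pos _).le] at h7
        simp only [Pi.smul_apply, smul_eq_mul, norm_mul, Real.norm_of_nonneg (Real.exp_pos _).le,
          Real.norm_of_nonneg (hS0 y), Real.norm_of_nonneg (le_max_right c 0)]
        calc S y = S y * (Real.exp (-(s * ω y)) * Real.exp (s * ω y)) := by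
              rw [← Real.exp_add]; simp
          _ ≤ S y * (max c 0 * Real.exp (s * ω y)) := by
              have := hS0 y
              gcongr
              exact h7.trans (le_max_left _ _)
          _ = _ := by ring
      rw [eLpNorm_const_smul, Real.enorm_eq_ofReal (le_max_right c 0)] at h6
      refine h6.trans ?_
      gcongr
      exact (eLpNorm_mono_measure _ Measure.restrict_le_self).trans hSb
    calc _ ≤ ENNReal.ofReal (max c 0) * ENNReal.ofReal b * volume B ^ q := by gcongr
      _ = _ := by
        rw [ENNReal.ofReal_mul (by positivity), ENNReal.ofReal_mul (by positivity),
          ENNReal.ofReal_toReal hv]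
        ring
  exact (ENNReal.ofReal_le_ofReal_iff (by positivity)).mp h3

/-- The weighted form of `exists_norm_cv_dilate_le`. -/
lemma exists_wt_cv_dilate_le (hω : Continuous ω) (hp : 1 ≤ p) {L : ℕ} {ψ : TF d}
    (hψ : MomentsVanish L ψ) {R : ℝ} (hR : tsupport ψ ⊆ Metric.closedBall 0 R) :
    ∃ C : ℝ, 0 ≤ C ∧ ∀ s s' : ℝ, (∀ x y, ‖y‖ ≤ R + 1 → s * ω x ≤ s' * ω (x + y)) →
      ∀ (h : Eu d → ℂ), Smooth h → ∀ j : ℕ,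
      wt ω p s (fun x => ‖cv h (dilate ψ j) x‖)
        ≤ ENNReal.ofReal (C * (2⁻¹ : ℝ) ^ (L * j)) * wt ω p s' (Sg (L + d + 1) h) := by
  obtain ⟨C, hC, hle⟩ := exists_norm_cv_dilate_le hψ hR
  set V := volume (Metric.ball (0 : Eu d) (R + 1)) with hV
  have hVt : V ≠ ∞ := measure_ball_lt_top.ne
  refine ⟨C * V.toReal, by positivity, fun s s' hw h hh j => ?_⟩
  refine (wt_mono (fun x => norm_nonneg _) (fun x => hle h hh j x)).trans ?_
  rw [wt_const_mul (by positivity)]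
  calc _ ≤ ENNReal.ofReal (C * (2⁻¹ : ℝ) ^ (L * j)) * (V * wt ω p s' (Sg (L + d + 1) h)) := by
        gcongr
        exact wt_average_le hω hp hw (hh.continuous_Sg _)
    _ = _ := by
        rw [mul_right_comm C, ENNReal.ofReal_mul (p := C * (2⁻¹ : ℝ) ^ (L * j)) (by positivity),
          ENNReal.ofReal_toReal hVt, mul_assoc]

/-- Iterating the growth condition on `ω`. -/
lemma exists_weight_le (hω0 : ∀ x, 0 ≤ ω x)
    (hω : ∃ C : ℝ, 0 < C ∧ ∀ x y : Eu d, ‖y‖ ≤ 1 → ω (x + y) ≤ C * ω x) (R : ℝ) :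
    ∃ κ : ℕ, ∀ x y : Eu d, ‖y‖ ≤ R → ω (x + y) ≤ κ * ω x := by
  obtain ⟨C, hC, h⟩ := hω
  have hk : ∀ k : ℕ, ∀ x y : Eu d, ‖y‖ ≤ 1 → ω (x + (k : ℝ) • y) ≤ C ^ k * ω x := by
    intro k
    induction k with
    | zero => intro x y _; simp
    | succ k ih =>
      intro x y hy
      have : x + ((k + 1 : ℕ) : ℝ) • y = (x + (k : ℝ) • y) + y := by
        push_cast; rw [add_smul, one_smul, add_assoc]
      rw [this]
      refine (h _ _ hy).trans ?_
      rw [pow_succ', mul_assoc]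
      exact mul_le_mul_of_nonneg_left (ih x y hy) hC.le
  obtain ⟨k, hkR⟩ := exists_nat_ge (max R 1)
  obtain ⟨κ, hκ⟩ := exists_nat_ge (C ^ k)
  have hk1 : (1 : ℝ) ≤ k := (le_max_right _ _).trans hkR
  refine ⟨κ, fun x y hy => ?_⟩
  have h1 := hk k x ((k : ℝ)⁻¹ • y) (by
    rw [norm_smul, norm_inv, Real.norm_natCast, inv_mul_le_iff₀ (by linarith), mul_one]
    exact hy.trans ((le_max_left _ _).trans hkR))
  rw [smul_smul, mul_inv_cancel₀ (by linarith), one_smul] at h1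
  exact h1.trans (mul_le_mul_of_nonneg_right hκ (hω0 x))

lemma exists_weight_comparison (hω0 : ∀ x, 0 ≤ ω x)
    (hω : ∃ C : ℝ, 0 < C ∧ ∀ x y : Eu d, ‖y‖ ≤ 1 → ω (x + y) ≤ C * ω x) (R : ℝ) :
    ∃ κ : ℕ, ∀ x y : Eu d, ‖y‖ ≤ R → ω (x + y) ≤ κ * ω x ∧ ω x ≤ κ * ω (x + y) := by
  obtain ⟨κ, hκ⟩ := exists_weight_le hω0 hω R
  refine ⟨κ, fun x y hy => ⟨hκ x y hy, ?_⟩⟩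
  have := hκ (x + y) (-y) (by rwa [norm_neg])
  simpa using this

/-- Finiteness of the suprema in the growth conditions means growth at most like `2^{rj}`. -/
lemma iSup_lt_top_iff (r : ℝ) (a : ℕ → Fin 2 → ℝ≥0∞) :
    (⨆ (j : ℕ) (ℓ : Fin 2), ENNReal.ofReal ((2 : ℝ) ^ (-(r * j))) * a j ℓ) < ∞ ↔
      ∃ A : ℝ, 0 ≤ A ∧ ∀ j ℓ, a j ℓ ≤ ENNReal.ofReal (A * (2 : ℝ) ^ (r * j)) := by
  have hmul : ∀ j : ℕ, ENNReal.ofReal ((2 : ℝ) ^ (r * j)) * ENNReal.ofReal ((2 : ℝ) ^ (-(r * j)))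
      = 1 := by
    intro j
    rw [← ENNReal.ofReal_mul (by positivity), ← Real.rpow_add two_pos]
    simp
  constructor
  · intro h
    refine ⟨(⨆ (j : ℕ) (ℓ : Fin 2), ENNReal.ofReal ((2 : ℝ) ^ (-(r * j))) * a j ℓ).toReal,
      ENNReal.toReal_nonneg, fun j ℓ => ?_⟩
    rw [ENNReal.ofReal_mul ENNReal.toReal_nonneg, ENNReal.ofReal_toReal h.ne]
    calc a j ℓ = (ENNReal.ofReal ((2 : ℝ) ^ (-(r * j))) * a j ℓ)
          * ENNReal.ofReal ((2 : ℝ) ^ (r * j)) := by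
          rw [mul_comm, ← mul_assoc, hmul, one_mul]
      _ ≤ _ := by
          gcongr
          exact le_iSup₂ (f := fun j ℓ => ENNReal.ofReal ((2 : ℝ) ^ (-(r * (j : ℕ)))) * a j ℓ) j ℓ
  · rintro ⟨A, hA, h⟩
    refine lt_of_le_of_lt (iSup₂_le fun j ℓ => ?_) (ENNReal.ofReal_lt_top (r := A))
    calc _ ≤ ENNReal.ofReal ((2 : ℝ) ^ (-(r * j))) * ENNReal.ofReal (A * (2 : ℝ) ^ (r * j)) := by
          gcongr; exact h j ℓ
      _ = ENNReal.ofReal A := by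
          rw [ENNReal.ofReal_mul hA, mul_left_comm, mul_comm (ENNReal.ofReal ((2 : ℝ) ^ (-(r * j)))),
            hmul, mul_one]

/-! ### The spaces of weighted smooth functions and their multipliers -/

lemma mem_KSpace_iff (hω : Continuous ω) {u : Eu d → ℂ} : u ∈ KSpace ω p ↔
    Smooth u ∧ ∀ (n : ℕ) (l : List (Fin d)), wt ω p n (fun x => ‖ld l u x‖) < ∞ := by
  refine and_congr_right fun hu => ?_
  have key : ∀ (n : ℕ), (∀ α, MemLp (fun x => pderiv α u x * (Real.exp (n * ω x) : ℂ)) p volume) ↔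
      ∀ l, wt ω p n (fun x => ‖ld l u x‖) < ∞ := by
    intro n
    rw [forall_pderiv_iff (P := fun v => MemLp (fun x => v x * (Real.exp (n * ω x) : ℂ)) p volume) hu]
    refine forall_congr' fun l => ?_
    rw [← eLpNorm_mul_exp_eq_wt]
    refine ⟨fun h => h.2, fun h => ⟨?_, h⟩⟩
    have h1 := (Smooth.ld (u := u) hu l).continuous
    exact (h1.mul (Complex.continuous_ofReal.comp (by fun_prop))).aestronglyMeasurable
  exact forall_congr' key

lemma KSpace.pd (hω : Continuous ω) {u : Eu d → ℂ} (hu : u ∈ KSpace ω p) (i : Fin d) :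
    pd i u ∈ KSpace ω p := by
  rw [mem_KSpace_iff hω] at hu ⊢
  refine ⟨hu.1.pd i, fun n l => ?_⟩
  have := hu.2 n (l ++ [i])
  rwa [ld_append] at this

lemma KSpace.sub (hω : Continuous ω) (hp : 1 ≤ p) {u v : Eu d → ℂ} (hu : u ∈ KSpace ω p)
    (hv : v ∈ KSpace ω p) : (fun x => u x - v x) ∈ KSpace ω p := by
  rw [mem_KSpace_iff hω] at hu hv ⊢
  refine ⟨hu.1.sub hv.1, fun n l => ?_⟩
  rw [ld_sub hu.1 hv.1]
  refine lt_of_le_of_lt ((wt_mono (T := fun x => ‖ld l u x‖ + ‖ld l v x‖)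
    (fun x => norm_nonneg _) fun x => norm_sub_le _ _).trans
    (wt_add_le hω hp (hu.1.ld l).continuous.norm (hv.1.ld l).continuous.norm)) ?_
  exact ENNReal.add_lt_top.mpr ⟨hu.2 n l, hv.2 n l⟩

/-- The space of multipliers is stable under differentiation, by the product rule. -/
lemma MultiplierSpace.pd (hω : Continuous ω) (hp : 1 ≤ p) {g : Eu d → ℂ}
    (hg : g ∈ MultiplierSpace ω p) (i : Fin d) : pd i g ∈ MultiplierSpace ω p := by
  refine ⟨Smooth.pd hg.1 i, fun φ hφ => ?_⟩
  have hgs : Smooth g := hg.1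
  have hφs : Smooth φ := hφ.1
  have h1 : (fun x => Mollif.pd i g x * φ x)
      = fun x => Mollif.pd i (fun y => g y * φ y) x - g x * Mollif.pd i φ x := by
    rw [pd_mul hgs.diff hφs.diff]
    funext x; ring
  rw [h1]
  exact KSpace.sub hω hp (KSpace.pd hω (hg.2 φ hφ) i) (hg.2 _ (KSpace.pd hω hφ i))

lemma exists_bump (d : ℕ) : ∃ (θ : TF d) (b : Eu d → ℝ), (∀ x, θ x = (b x : ℂ)) ∧ (∀ x, 0 ≤ b x) ∧
    Integrable b ∧ ∫ x, b x = 1 ∧ tsupport θ ⊆ Metric.closedBall 0 1 := by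
  let β : ContDiffBump (0 : Eu d) := ⟨1 / 2, 1, by norm_num, by norm_num⟩
  let b : Eu d → ℝ := β.normed volume
  have hb : tsupport (fun x => (b x : ℂ)) ⊆ Metric.closedBall 0 1 := by
    refine tsupport_subset_closedBall fun x hx => ?_
    have : x ∈ tsupport b := subset_tsupport _ (by simpa using hx)
    rw [β.tsupport_normed_eq] at this
    simpa using this
  let θ : TF d :=
    { toFun := fun x => (b x : ℂ)
      contDiff' := Complex.ofRealCLM.contDiff.comp β.contDiff_normed
      hasCompactSupport' :=
        (isCompact_closedBall (0 : Eu d) 1).of_isClosed_subset (isClosed_tsupport _) hb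
      tsupport_subset' := fun _ _ => trivial }
  exact ⟨θ, b, fun x => rfl, fun x => β.nonneg_normed x, β.integrable_normed, β.integral_normed, hb⟩

/-- If `F` has infinite `L^p` norm, then its truncations to large balls have large norms. -/
lemma exists_large_truncation {F : Eu d → ℝ} (hF : Continuous F)
    (htop : eLpNorm F p volume = ∞) (n : ℕ) : ∃ r : ℕ, ∀ ρ : ℝ, (r : ℝ) ≤ ρ →
      (n : ℝ≥0∞) ≤ eLpNorm ((Metric.ball (0 : Eu d) ρ).indicator F) p volume := by
  have hex : ∃ r : ℕ, (n : ℝ≥0∞) ≤ eLpNorm ((Metric.ball (0 : Eu d) r).indicator F) p volume := by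
    by_contra hcon
    push Not at hcon
    have h1 := Lp.eLpNorm_lim_le_liminf_eLpNorm (p := p) (μ := (volume : Measure (Eu d)))
      (f := fun r : ℕ => (Metric.ball (0 : Eu d) r).indicator F)
      (fun r => hF.aestronglyMeasurable.indicator measurableSet_ball) F
      (Filter.Eventually.of_forall fun x => ?_)
    · rw [htop] at h1
      have h2 : Filter.liminf (fun r : ℕ => eLpNorm ((Metric.ball (0 : Eu d) r).indicator F) p volume)
          Filter.atTop ≤ n := by
        refine (Filter.liminf_le_liminf (Filter.Eventually.of_forall fun r => (hcon r).le)).trans ?_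
        simp
      exact absurd (h1.trans h2) (by simp)
    · obtain ⟨r, hr⟩ := exists_nat_gt ‖x‖
      refine tendsto_const_nhds.congr' ?_
      filter_upwards [Filter.eventually_ge_atTop r] with k hk
      rw [Set.indicator_of_mem]
      rw [mem_ball_zero_iff]
      exact hr.trans_le (by exact_mod_cast hk)
  obtain ⟨r, hr⟩ := hex
  refine ⟨r, fun ρ hρ => hr.trans (eLpNorm_mono fun x => ?_)⟩
  exact norm_indicator_le_of_subset (Metric.ball_subset_ball hρ) _ _

/-- The exponent `N(x)` is the least `n` with `‖x‖ < ρ n`; it tends to infinity as slowly as desired. -/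
lemma exists_slow_exponent {ρ : ℕ → ℝ} (hmono : Monotone ρ) (htop : ∀ n : ℕ, (n : ℝ) ≤ ρ n) :
    ∃ N : Eu d → ℕ, Measurable N ∧ ∀ x n, N x ≤ n ↔ ‖x‖ < ρ n := by
  classical
  have hex : ∀ x : Eu d, ∃ n, ‖x‖ < ρ n := fun x => by
    obtain ⟨n, hn⟩ := exists_nat_gt ‖x‖
    exact ⟨n, hn.trans_le (htop n)⟩
  refine ⟨fun x => Nat.find (hex x), measurable_find hex fun k => ?_, fun x n => ?_⟩
  · exact (isOpen_lt continuous_norm continuous_const).measurableSet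
  · rw [Nat.find_le_iff]
    exact ⟨fun ⟨m, hm, h⟩ => h.trans_le (hmono hm), fun h => ⟨n, le_rfl, h⟩⟩

/-- A function in `𝓚^∞_ω` that decreases as slowly as desired: the mollification of
`e^{-N(x) ω(x)}`, where the exponent `N` tends to infinity slowly. -/
lemma exists_test_function (hω0 : ∀ x, 0 ≤ ω x) (hωc : Continuous ω) {κ : ℕ}
    (hκ : ∀ x y : Eu d, ‖y‖ ≤ 1 → ω (x + y) ≤ κ * ω x ∧ ω x ≤ κ * ω (x + y))
    {ρ : ℕ → ℝ} (hmono : Monotone ρ) (htop : ∀ n : ℕ, (n : ℝ) ≤ ρ n) :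
    ∃ φ ∈ KSpace ω ∞, ∀ (n : ℕ) (x : Eu d), ‖x‖ + 1 < ρ n →
      Real.exp (-(n * κ : ℕ) * ω x) ≤ ‖φ x‖ := by
  obtain ⟨N, hNm, hN⟩ := exists_slow_exponent (d := d) hmono htop
  obtain ⟨θ, b, hθb, hb0, hbi, hb1, hθ⟩ := exists_bump d
  set v : Eu d → ℝ := fun x => Real.exp (-(N x * ω x)) with hv
  have hvm : Measurable v := by
    have : Measurable fun x => (N x : ℝ) := measurable_from_nat.comp hNm
    exact Real.measurable_exp.comp ((this.mul hωc.measurable).neg)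
  have hv0 : ∀ x, 0 ≤ v x := fun x => (Real.exp_pos _).le
  have hv1 : ∀ x, v x ≤ 1 := fun x => Real.exp_le_one_iff.mpr (by
    have := hω0 x
    have : 0 ≤ (N x : ℝ) * ω x := by positivity
    linarith)
  have hvl : LocallyIntegrable (fun x => (v x : ℂ)) volume := by
    refine (locallyIntegrable_const (1 : ℝ)).mono
      (Complex.measurable_ofReal.comp hvm).aestronglyMeasurable
      (Filter.Eventually.of_forall fun x => ?_)
    simpa [abs_of_nonneg (hv0 x)] using hv1 x
  have hbound : ∀ m : ℕ, ∃ B : ℝ, 0 ≤ B ∧ ∀ x y : Eu d, ‖y‖ ≤ 1 →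
      v (x - y) ≤ B * Real.exp (-(m * ω x)) := by
    intro m
    obtain ⟨B, hB⟩ := (isCompact_closedBall (0 : Eu d) (ρ (m * κ) + 1)).exists_bound_of_continuousOn
      (f := fun x => Real.exp (m * ω x)) (by fun_prop)
    refine ⟨max B 1, le_trans zero_le_one (le_max_right _ _), fun x y hy => ?_⟩
    by_cases hNx : m * κ ≤ N (x - y)
    · have h1 : ω x ≤ κ * ω (x - y) := by
        have := (hκ (x - y) y hy).1
        simpa using this
      have h2 : (m : ℝ) * ω x ≤ N (x - y) * ω (x - y) := by
        calc (m : ℝ) * ω x ≤ m * (κ * ω (x - y)) := by gcongr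
          _ = ((m * κ : ℕ) : ℝ) * ω (x - y) := by push_cast; ring
          _ ≤ N (x - y) * ω (x - y) := by
              have := hω0 (x - y)
              gcongr
      calc v (x - y) ≤ Real.exp (-(m * ω x)) := Real.exp_le_exp.mpr (by linarith)
        _ ≤ _ := le_mul_of_one_le_left (Real.exp_pos _).le (le_max_right _ _)
    · have h1 : ‖x - y‖ < ρ (m * κ) := (hN _ _).mp (by omega)
      have h2 : ‖x‖ ≤ ρ (m * κ) + 1 := by
        have : ‖x‖ ≤ ‖x - y‖ + ‖y‖ := by simpa using norm_add_le (x - y) y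
        linarith
      have h3 := hB x (by simpa using h2)
      rw [Real.norm_of_nonneg (Real.exp_pos _).le] at h3
      calc v (x - y) ≤ 1 := hv1 _
        _ = Real.exp (m * ω x) * Real.exp (-(m * ω x)) := by rw [← Real.exp_add]; simp
        _ ≤ _ := by
          gcongr
          exact h3.trans (le_max_left _ _)
  refine ⟨cv (fun x => (v x : ℂ)) θ, ?_, ?_⟩
  · rw [mem_KSpace_iff hωc]
    refine ⟨smooth_cv hvl θ, fun m l => ?_⟩
    obtain ⟨B, hB0, hB⟩ := hbound m
    rw [ld_cv_right hvl]
    have hθl : Integrable (ld l θ) := by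
      rw [← coe_tld]
      exact (tld l θ).continuous.integrable_of_hasCompactSupport (tld l θ).hasCompactSupport
    have hsupp : ∀ y, ld l θ y ≠ 0 → ‖y‖ ≤ 1 := by
      intro y hy
      by_contra hcon
      have h0 : y ∉ tsupport θ := fun h => hcon (by simpa using hθ h)
      have := norm_le_Sg l.length (ld l θ) y
      have h2 := Sg_ld_le 0 l θ y
      rw [zero_add, Sg_eq_zero h0] at h2
      exact hy (norm_le_zero_iff.mp h2)
    have hpt : ∀ x, ‖cv (fun x => (v x : ℂ)) (ld l θ) x‖
        ≤ (∫ y, ‖ld l θ y‖) * B * Real.exp (-(m * ω x)) := by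
      intro x
      rw [mul_assoc, ← integral_mul_const]
      refine norm_integral_le_of_norm_le (hθl.norm.mul_const _)
        (Filter.Eventually.of_forall fun y => ?_)
      rw [norm_mul, mul_comm]
      by_cases hy : ld l θ y = 0
      · simp [hy]
      · refine mul_le_mul_of_nonneg_left ?_ (norm_nonneg _)
        simpa [abs_of_nonneg (hv0 _)] using hB x y (hsupp y hy)
    refine lt_of_le_of_lt (eLpNorm_le_of_ae_bound (C := (∫ y, ‖ld l θ y‖) * B)
      (Filter.Eventually.of_forall fun x => ?_)) ?_
    · rw [norm_mul, norm_norm, Real.norm_of_nonneg (Real.exp_pos _).le]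
      calc _ ≤ (∫ y, ‖ld l θ y‖) * B * Real.exp (-(m * ω x)) * Real.exp (m * ω x) := by
            gcongr; exact hpt x
        _ = _ := by rw [mul_assoc, ← Real.exp_add]; simp
    · simp
  · intro n x hx
    have hval : cv (fun x => (v x : ℂ)) θ x = ((∫ y, v (x - y) * b y : ℝ) : ℂ) := by
      rw [cv, ← integral_complex_ofReal]
      refine integral_congr_ae (Filter.Eventually.of_forall fun y => ?_)
      simp [hθb]
    rw [hval, Complex.norm_real]
    refine le_trans ?_ (Real.le_norm_self _)
    have hint : Integrable fun y => v (x - y) * b y := by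
      refine hbi.bdd_mul (c := 1) (hvm.comp (measurable_const.sub measurable_id)).aestronglyMeasurable
        (Filter.Eventually.of_forall fun y => ?_)
      rw [Real.norm_of_nonneg (hv0 _)]; exact hv1 _
    have : Real.exp (-(n * κ : ℕ) * ω x) = ∫ y, Real.exp (-(n * κ : ℕ) * ω x) * b y := by
      rw [integral_const_mul, hb1, mul_one]
    rw [this]
    refine integral_mono (hbi.const_mul _) hint fun y => ?_
    by_cases hy : b y = 0
    · simp [hy]
    · have hy1 : ‖y‖ ≤ 1 := norm_le_of_ne_zero hθ (by simpa [hθb] using hy)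
      refine mul_le_mul_of_nonneg_right ?_ (hb0 y)
      refine Real.exp_le_exp.mpr ?_
      have h1 : N (x - y) ≤ n := (hN _ _).mpr (lt_of_le_of_lt (norm_sub_le _ _) (by linarith))
      have h2 : ω (x - y) ≤ κ * ω x := by
        have := (hκ x (-y) (by rwa [norm_neg])).1
        simpa [sub_eq_add_neg] using this
      have h3 : (N (x - y) : ℝ) * ω (x - y) ≤ n * (κ * ω x) := by
        have := hω0 (x - y)
        gcongr
      push_cast
      nlinarith

/-- Each derivative of a multiplier is in `L^p` for some weight `e^{-nω}`. Otherwise there is a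
function `φ ∈ 𝓚^∞_ω` decreasing so slowly that `g φ ∉ L^p`. -/
lemma MultiplierSpace.exists_wt_lt_top (hω0 : ∀ x, 0 ≤ ω x) (hωc : Continuous ω)
    (hω : ∃ C : ℝ, 0 < C ∧ ∀ x y : Eu d, ‖y‖ ≤ 1 → ω (x + y) ≤ C * ω x) (hp : 1 ≤ p)
    {g : Eu d → ℂ} (hg : g ∈ MultiplierSpace ω p) (l : List (Fin d)) :
    ∃ n : ℕ, wt ω p (-n) (fun x => ‖ld l g x‖) < ∞ := by
  have hl : ld l g ∈ MultiplierSpace ω p := by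
    induction l with
    | nil => exact hg
    | cons i l ih => exact MultiplierSpace.pd hωc hp ih i
  revert hl
  generalize ld l g = u
  intro hu
  by_contra hcon
  push Not at hcon
  obtain ⟨κ, hκ⟩ := exists_weight_comparison hω0 hω 1
  have hus : Smooth u := hu.1
  have hF : ∀ n : ℕ, Continuous fun x => ‖u x‖ * Real.exp (-(n * κ : ℕ) * ω x) := fun n =>
    continuous_mul_exp hωc _ hus.continuous.norm
  have hr := fun n : ℕ => exists_large_truncation (p := p) (hF n) (top_le_iff.mp (hcon (n * κ))) n
  choose r hr using hr
  obtain ⟨φ, hφ, hlow⟩ := exists_test_function hω0 hωc hκ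
    (ρ := fun n => (∑ k ∈ Finset.range (n + 1), (r k : ℝ)) + n + 1)
    (monotone_nat_of_le_succ fun n => by
      rw [Finset.sum_range_succ _ (n + 1)]
      have : (0 : ℝ) ≤ r (n + 1) := Nat.cast_nonneg _
      push_cast; linarith)
    (fun n => by
      have : (0 : ℝ) ≤ ∑ k ∈ Finset.range (n + 1), (r k : ℝ) :=
        Finset.sum_nonneg fun _ _ => Nat.cast_nonneg _
      linarith)
  have h1 := ((mem_KSpace_iff hωc).mp (hu.2 φ hφ)).2 0 []
  obtain ⟨n, hn⟩ := ENNReal.exists_nat_gt h1.ne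
  refine absurd hn (not_lt.mpr ?_)
  refine (hr n ((∑ k ∈ Finset.range (n + 1), (r k : ℝ)) + n) ?_).trans (eLpNorm_mono fun x => ?_)
  · have : (r n : ℝ) ≤ ∑ k ∈ Finset.range (n + 1), (r k : ℝ) :=
      Finset.single_le_sum (f := fun k => (r k : ℝ)) (fun _ _ => Nat.cast_nonneg _) (by simp)
    have : (0 : ℝ) ≤ n := Nat.cast_nonneg _
    linarith
  · by_cases hx : x ∈ Metric.ball (0 : Eu d) ((∑ k ∈ Finset.range (n + 1), (r k : ℝ)) + n)
    · rw [Set.indicator_of_mem hx]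
      have h2 := hlow n x (by rw [mem_ball_zero_iff] at hx; linarith)
      simp only [ld_nil, Nat.cast_zero, zero_mul, Real.exp_zero, mul_one, norm_mul, norm_norm,
        Real.norm_of_nonneg (Real.exp_pos _).le]
      exact mul_le_mul_of_nonneg_left h2 (norm_nonneg _)
    · rw [Set.indicator_of_notMem hx, norm_zero]; exact norm_nonneg _

/-- Conversely, these weighted bounds for all derivatives characterize the multipliers. -/
lemma mem_MultiplierSpace_of_wt_lt_top (hωc : Continuous ω) (hp : 1 ≤ p) {g : Eu d → ℂ}
    (hg : Smooth g) (h : ∀ l : List (Fin d), ∃ n : ℕ, wt ω p (-n) (fun x => ‖ld l g x‖) < ∞) :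
    g ∈ MultiplierSpace ω p := by
  refine ⟨hg, fun φ hφ => ?_⟩
  have hφs : Smooth φ := hφ.1
  rw [mem_KSpace_iff hωc]
  refine ⟨hg.mul hφs, fun n l => ?_⟩
  induction l using List.reverseRecOn generalizing g φ with
  | nil =>
    obtain ⟨m, hm⟩ := h []
    have h1 := ((mem_KSpace_iff hωc).mp hφ).2 (n + m) []
    rw [wt, eLpNorm_exponent_top] at h1
    set C := eLpNormEssSup (fun x => ‖ld [] φ x‖ * Real.exp ((n + m : ℕ) * ω x)) volume with hC
    have hae : ∀ᵐ x : Eu d, ‖φ x‖ * Real.exp ((n + m : ℕ) * ω x) ≤ C.toReal := by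
      filter_upwards [ae_le_eLpNormEssSup
        (f := fun x => ‖ld [] φ x‖ * Real.exp ((n + m : ℕ) * ω x)) (μ := volume)] with x hx
      have := ENNReal.toReal_mono h1.ne hx
      rw [toReal_enorm, Real.norm_of_nonneg (by positivity)] at this
      exact this
    refine lt_of_le_of_lt ?_ (ENNReal.mul_lt_top (ENNReal.ofReal_lt_top (r := C.toReal)) hm)
    rw [← wt_const_mul ENNReal.toReal_nonneg]
    refine eLpNorm_mono_ae ?_
    filter_upwards [hae] with x hx
    rw [norm_mul, norm_mul, Real.norm_of_nonneg (Real.exp_pos _).le,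
      Real.norm_of_nonneg (Real.exp_pos _).le, norm_norm, norm_mul, norm_norm,
      Real.norm_of_nonneg ENNReal.toReal_nonneg]
    simp only [ld_nil, norm_mul]
    have : Real.exp (n * ω x) = Real.exp ((n + m : ℕ) * ω x) * Real.exp (-m * ω x) := by
      rw [← Real.exp_add]; congr 1; push_cast; ring
    rw [this]
    calc ‖g x‖ * ‖φ x‖ * (Real.exp ((n + m : ℕ) * ω x) * Real.exp (-m * ω x))
        = (‖φ x‖ * Real.exp ((n + m : ℕ) * ω x)) * (‖g x‖ * Real.exp (-m * ω x)) := by ring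
      _ ≤ C.toReal * (‖g x‖ * Real.exp (-m * ω x)) := by gcongr
      _ = _ := by ring
  | append_singleton l i ih =>
    have h1 := ih (hg.pd i) (fun l' => by
      obtain ⟨m, hm⟩ := h (l' ++ [i])
      rw [ld_append] at hm
      exact ⟨m, hm⟩) φ hφ hφs
    have h2 := ih hg h (pd i φ) (KSpace.pd hωc hφ i) (hφs.pd i)
    have hs1 : Smooth fun x => pd i g x * φ x := (hg.pd i).mul hφs
    have hs2 : Smooth fun x => g x * pd i φ x := hg.mul (hφs.pd i)
    have h3 : ld (l ++ [i]) (fun x => g x * φ x)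
        = fun x => ld l (fun x => pd i g x * φ x) x + ld l (fun x => g x * pd i φ x) x := by
      rw [ld_append, ← ld_add hs1 hs2, ← pd_mul hg.diff hφs.diff]
      rfl
    rw [h3]
    refine lt_of_le_of_lt ((wt_mono (T := fun x => ‖ld l (fun x => pd i g x * φ x) x‖
      + ‖ld l (fun x => g x * pd i φ x) x‖) (fun x => norm_nonneg _)
      fun x => norm_add_le _ _).trans
      (wt_add_le hωc hp (hs1.ld l).continuous.norm (hs2.ld l).continuous.norm)) ?_
    exact ENNReal.add_lt_top.mpr ⟨h1, h2⟩

/-! ### Series of smooth functions -/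

/-- A series of smooth functions all of whose derivatives converge normally on bounded sets can be
differentiated term by term. -/
lemma smooth_tsum {u : ℕ → Eu d → ℂ} (hu : ∀ k, Smooth (u k))
    (hb : ∀ (l : List (Fin d)) (ρ : ℝ), ∃ b : ℕ → ℝ, Summable b ∧
      ∀ k x, ‖x‖ ≤ ρ → ‖ld l (u k) x‖ ≤ b k) :
    Smooth (fun x => ∑' k, u k x) ∧
      ∀ l, ld l (fun x => ∑' k, u k x) = fun x => ∑' k, ld l (u k) x := by
  have hsum : ∀ l x, Summable fun k => ld l (u k) x := fun l x => by
    obtain ⟨b, hb1, hb2⟩ := hb l ‖x‖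
    exact Summable.of_norm_bounded hb1 fun k => hb2 k x le_rfl
  have hder : ∀ l x, HasFDerivAt (fun y => ∑' k, ld l (u k) y)
      (∑' k, fderiv ℝ (ld l (u k)) x) x ∧ Summable fun k => fderiv ℝ (ld l (u k)) x := by
    intro l x
    choose b hb1 hb2 using fun i : Fin d => hb (i :: l) (‖x‖ + 1)
    have hB : Summable fun k => ∑ i, b i k := summable_sum fun i _ => hb1 i
    have hle : ∀ k y, y ∈ Metric.ball (0 : Eu d) (‖x‖ + 1) →
        ‖fderiv ℝ (ld l (u k)) y‖ ≤ ∑ i, b i k := fun k y hy =>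
      (norm_fderiv_le_sum _ _).trans (Finset.sum_le_sum fun i _ => hb2 i k y
        (mem_ball_zero_iff.mp hy).le)
    have hx : x ∈ Metric.ball (0 : Eu d) (‖x‖ + 1) := by rw [mem_ball_zero_iff]; linarith
    exact ⟨hasFDerivAt_tsum_of_isPreconnected hB Metric.isOpen_ball
      (convex_ball _ _).isPreconnected (fun k y _ => (((hu k).ld l).diff y).hasFDerivAt) hle hx
      (hsum l x) hx, Summable.of_norm_bounded hB fun k => hle k x hx⟩
  have hpd : ∀ l i, pd i (fun y => ∑' k, ld l (u k) y) = fun y => ∑' k, ld (i :: l) (u k) y := by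
    intro l i
    funext x
    simp only [pd, dirD]
    rw [(hder l x).1.fderiv]
    exact (ContinuousLinearMap.apply ℝ ℂ (EuclideanSpace.single i (1 : ℝ))).map_tsum (hder l x).2
  refine ⟨smooth_of_closed (fun v => ∃ l, v = fun x => ∑' k, ld l (u k) x) ?_ ?_ ⟨[], rfl⟩,
    fun l => ?_⟩
  · rintro _ ⟨l, rfl⟩ x; exact (hder l x).1.differentiableAt
  · rintro _ ⟨l, rfl⟩ i; exact ⟨i :: l, hpd l i⟩
  · induction l with
    | nil => rfl
    | cons i l ih => rw [ld_cons, ih, hpd]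

/-! ### Convolutors are bounded on bounded sequences of test functions -/

lemma summable_norm_lp_one (c : lp (fun _ : ℕ => ℂ) 1) : Summable fun k => ‖c k‖ :=
  (lp.memℓp c).summable_of_one.norm

/-- The absolutely convergent combination `∑ c_k a_k` of a sequence `a` of test functions that is
bounded in `𝓓`. -/
def tfSeries (a : ℕ → TF d) (R : ℝ) (hR : ∀ k, tsupport (a k) ⊆ Metric.closedBall 0 R)
    (ha : ∀ l : List (Fin d), ∃ M : ℝ, ∀ k x, ‖ld l (a k) x‖ ≤ M)
    (c : lp (fun _ : ℕ => ℂ) 1) : TF d where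
  toFun x := ∑' k, c k * a k x
  contDiff' := by
    refine (smooth_tsum (u := fun k x => c k * a k x)
      (fun k => contDiff_const.mul (a k).smooth) fun l ρ => ?_).1
    obtain ⟨M, hM⟩ := ha l
    refine ⟨fun k => ‖c k‖ * M, (summable_norm_lp_one c).mul_right M, fun k x _ => ?_⟩
    rw [ld_const_mul (a k).smooth, norm_mul]
    exact mul_le_mul_of_nonneg_left (hM k x) (norm_nonneg _)
  hasCompactSupport' := by
    refine (isCompact_closedBall (0 : Eu d) R).of_isClosed_subset (isClosed_tsupport _)
      (tsupport_subset_closedBall fun x hx => ?_)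
    by_contra hcon
    refine hx ?_
    have : ∀ k, a k x = 0 := fun k => by
      by_contra h; exact hcon (norm_le_of_ne_zero (hR k) h)
    simp [this]
  tsupport_subset' := fun _ _ => trivial

section

variable {a : ℕ → TF d} {R : ℝ} (hR : ∀ k, tsupport (a k) ⊆ Metric.closedBall 0 R)
  (ha : ∀ l : List (Fin d), ∃ M : ℝ, ∀ k x, ‖ld l (a k) x‖ ≤ M)

lemma tfSeries_apply (c : lp (fun _ : ℕ => ℂ) 1) (x : Eu d) :
    tfSeries a R hR ha c x = ∑' k, c k * a k x := rfl

lemma summable_mul_tf (ha : ∀ l : List (Fin d), ∃ M : ℝ, ∀ k x, ‖ld l (a k) x‖ ≤ M)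
    (c : lp (fun _ : ℕ => ℂ) 1) (x : Eu d) : Summable fun k => c k * a k x := by
  obtain ⟨M, hM⟩ := ha []
  refine Summable.of_norm_bounded ((summable_norm_lp_one c).mul_right M) fun k => ?_
  rw [norm_mul]
  exact mul_le_mul_of_nonneg_left (hM k x) (norm_nonneg _)

lemma tfSeries_add (c c' : lp (fun _ : ℕ => ℂ) 1) :
    tfSeries a R hR ha (c + c') = tfSeries a R hR ha c + tfSeries a R hR ha c' := by
  ext x
  change ∑' k, (c k + c' k) * a k x = ∑' k, c k * a k x + ∑' k, c' k * a k x
  simp only [add_mul]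
  exact (summable_mul_tf ha c x).tsum_add (summable_mul_tf ha c' x)

lemma tfSeries_smul (b : ℂ) (c : lp (fun _ : ℕ => ℂ) 1) :
    tfSeries a R hR ha (b • c) = b • tfSeries a R hR ha c := by
  ext x
  change ∑' k, (b * c k) * a k x = b * ∑' k, c k * a k x
  simp only [mul_assoc]
  exact tsum_mul_left

lemma tfSeries_single (k : ℕ) : tfSeries a R hR ha (lp.single 1 k 1) = a k := by
  ext x
  rw [tfSeries_apply, tsum_eq_single k]
  · simp
  · intro m hm; simp [hm]

lemma tsupport_tfSeries (c : lp (fun _ : ℕ => ℂ) 1) :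
    tsupport (tfSeries a R hR ha c) ⊆ Metric.closedBall 0 R := by
  refine tsupport_subset_closedBall fun x hx => ?_
  by_contra hcon
  refine hx ?_
  have : ∀ k, a k x = 0 := fun k => by
    by_contra h; exact hcon (norm_le_of_ne_zero (hR k) h)
  simp [tfSeries_apply, this]

lemma exists_norm_ld_tfSeries_le (l : List (Fin d)) : ∃ M : ℝ, 0 ≤ M ∧
    ∀ c x, ‖ld l (tfSeries a R hR ha c) x‖ ≤ M * ‖c‖ := by
  obtain ⟨M, hM⟩ := ha l
  have hM0 : 0 ≤ M := (norm_nonneg _).trans (hM 0 0)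
  refine ⟨M, hM0, fun c x => ?_⟩
  have h1 := (smooth_tsum (u := fun k x => c k * a k x)
    (fun k => contDiff_const.mul (a k).smooth) fun l ρ => ?_).2 l
  · change ‖ld l (fun x => ∑' k, c k * a k x) x‖ ≤ _
    rw [h1]
    have hle : ∀ k, ‖ld l (fun x => c k * a k x) x‖ ≤ M * ‖c k‖ := fun k => by
      rw [ld_const_mul (a k).smooth, norm_mul, mul_comm]
      exact mul_le_mul_of_nonneg_right (hM k x) (norm_nonneg _)
    have hn : ‖c‖ = ∑' k, ‖c k‖ := by
      rw [lp.norm_eq_tsum_rpow (by simp)]; simp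
    rw [hn, ← tsum_mul_left]
    exact tsum_of_norm_bounded ((summable_norm_lp_one c).mul_left M).hasSum hle
  · obtain ⟨M, hM⟩ := ha l
    refine ⟨fun k => ‖c k‖ * M, (summable_norm_lp_one c).mul_right M, fun k x _ => ?_⟩
    rw [ld_const_mul (a k).smooth, norm_mul]
    exact mul_le_mul_of_nonneg_left (hM k x) (norm_nonneg _)

lemma exists_norm_dconv_tfSeries_le (f : Distr d) (x : Eu d) : ∃ M : ℝ, ∀ c,
    ‖dconv f (tfSeries a R hR ha c) x‖ ≤ M * ‖c‖ := by
  obtain ⟨N, C, hC, hN⟩ := exists_order f (isCompact_closedBall (0 : Eu d) (‖x‖ + R))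
  choose M hM0 hM using fun l => exists_norm_ld_tfSeries_le hR ha l
  set B : ℝ := ∑ l : {l : List (Fin d) // l.length ≤ N}, M l.1 with hB
  have hB0 : 0 ≤ B := Finset.sum_nonneg fun l _ => hM0 l.1
  refine ⟨C * ((1 + d : ℝ) ^ N * B), fun c => ?_⟩
  rw [mul_assoc, mul_assoc]
  refine hN _ (tsupport_reflTranslate (tsupport_tfSeries hR ha c) le_rfl) _ (by positivity)
    fun y => Sg_le_of_ld_le fun l hl => ?_
  rw [ld_reflTranslate, norm_mul]
  simp only [norm_pow, norm_neg, norm_one, one_pow, one_mul]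
  refine (hM l c _).trans (mul_le_mul_of_nonneg_right ?_ (norm_nonneg _))
  exact Finset.single_le_sum (f := fun l : {l : List (Fin d) // l.length ≤ N} => M l.1)
    (fun l _ => hM0 l.1) (Finset.mem_univ ⟨l, hl⟩)

end

lemma continuous_dconv_tfSeries {a : ℕ → TF d} {R : ℝ}
    (hR : ∀ k, tsupport (a k) ⊆ Metric.closedBall 0 R)
    (ha : ∀ l : List (Fin d), ∃ M : ℝ, ∀ k x, ‖ld l (a k) x‖ ≤ M) (f : Distr d) (x : Eu d) :
    Continuous fun c => dconv f (tfSeries a R hR ha c) x := by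
  obtain ⟨M, hM⟩ := exists_norm_dconv_tfSeries_le hR ha f x
  let T : lp (fun _ : ℕ => ℂ) 1 →ₗ[ℂ] ℂ :=
    { toFun := fun c => dconv f (tfSeries a R hR ha c) x
      map_add' := fun c c' => by rw [tfSeries_add, dconv_add]
      map_smul' := fun b c => by rw [tfSeries_smul, dconv_smul]; rfl }
  exact (T.mkContinuous M hM).continuous

/-- A convolutor maps a bounded sequence of test functions to a bounded sequence of weighted `L^p`
functions. The weighted norm of `f * ∑ c_k a_k` is a lower semicontinuous seminorm of `c ∈ ℓ^1`,
by Fatou's lemma, and `ℓ^1` is barrelled. -/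
lemma exists_wt_dconv_le (hω : Continuous ω) (hp : 1 ≤ p) {f : Distr d}
    (hf : f ∈ ConvolutorSpace ω p) (n : ℕ) {a : ℕ → TF d} {R : ℝ}
    (hR : ∀ k, tsupport (a k) ⊆ Metric.closedBall 0 R)
    (ha : ∀ l : List (Fin d), ∃ M : ℝ, ∀ k x, ‖ld l (a k) x‖ ≤ M) :
    ∃ M : ℝ, ∀ k, wt ω p n (fun x => ‖dconv f (a k) x‖) ≤ ENNReal.ofReal M := by
  set Q : lp (fun _ : ℕ => ℂ) 1 → ℝ≥0∞ := fun c =>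
    wt ω p n fun x => ‖dconv f (tfSeries a R hR ha c) x‖ with hQ
  have hQt : ∀ c, Q c < ∞ := fun c => ((mem_KSpace_iff hω).mp (hf _)).2 n []
  have hcont : ∀ φ : TF d, Continuous fun x => ‖dconv f φ x‖ := fun φ =>
    (smooth_dconv f φ).continuous.norm
  let q : Seminorm ℂ (lp (fun _ : ℕ => ℂ) 1) := Seminorm.of (fun c => (Q c).toReal)
    (fun c c' => by
      rw [← ENNReal.toReal_add (hQt c).ne (hQt c').ne]
      refine ENNReal.toReal_mono (ENNReal.add_lt_top.mpr ⟨hQt c, hQt c'⟩).ne ?_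
      refine (wt_mono (T := fun x => ‖dconv f (tfSeries a R hR ha c) x‖
        + ‖dconv f (tfSeries a R hR ha c') x‖) (fun x => norm_nonneg _) fun x => ?_).trans
        (wt_add_le hω hp (hcont _) (hcont _))
      rw [tfSeries_add, dconv_add]
      exact norm_add_le _ _)
    (fun b c => by
      have : Q (b • c) = ENNReal.ofReal ‖b‖ * Q c := by
        simp only [hQ]
        rw [← wt_const_mul (norm_nonneg b)]
        simp only [tfSeries_smul, dconv_smul, norm_mul]
      rw [this, ENNReal.toReal_mul, ENNReal.toReal_ofReal (norm_nonneg b)])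
  have hq : Continuous q := by
    refine Seminorm.continuous_of_lowerSemicontinuous q ?_
    rw [lowerSemicontinuous_iff_isClosed_preimage]
    intro t
    refine IsSeqClosed.isClosed fun c c₀ hc hlim => ?_
    have hc' : ∀ m, Q (c m) ≤ ENNReal.ofReal t := fun m =>
      ENNReal.le_ofReal_iff_toReal_le (hQt _).ne (ENNReal.toReal_nonneg.trans (hc m)) |>.mpr (hc m)
    have ht : 0 ≤ t := ENNReal.toReal_nonneg.trans (hc 0)
    have h1 : Q c₀ ≤ ENNReal.ofReal t := by
      refine (Lp.eLpNorm_lim_le_liminf_eLpNorm (f := fun m x =>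
        ‖dconv f (tfSeries a R hR ha (c m)) x‖ * Real.exp (n * ω x))
        (fun m => (continuous_mul_exp hω n (hcont _)).aestronglyMeasurable) _
        (Filter.Eventually.of_forall fun x => ?_)).trans ?_
      · exact ((((continuous_dconv_tfSeries hR ha f x).tendsto c₀).comp hlim).norm).mul_const _
      · refine (Filter.liminf_le_liminf (Filter.Eventually.of_forall hc')).trans ?_
        rw [Filter.liminf_const]
    exact ENNReal.toReal_le_of_le_ofReal ht h1
  obtain ⟨C, hC0, hC⟩ := Seminorm.bound_of_continuous_normedSpace q hq
  refine ⟨C, fun k => ?_⟩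
  have h1 := hC (lp.single 1 k 1)
  rw [lp.norm_single (by simp), norm_one, mul_one] at h1
  have h2 : q (lp.single 1 k 1) = (wt ω p n (fun x => ‖dconv f (a k) x‖)).toReal := by
    change (Q _).toReal = _
    simp only [hQ, tfSeries_single]
  rw [h2] at h1
  refine ENNReal.le_ofReal_iff_toReal_le ?_ hC0.le |>.mpr h1
  have := hQt (lp.single 1 k 1)
  simp only [hQ, tfSeries_single] at this
  exact this.ne

lemma ld_dilate (φ : TF d) (j : ℕ) (l : List (Fin d)) (x : Eu d) :
    ld l (dilate φ j) x = (2 : ℂ) ^ (j * (d + l.length)) * ld l φ ((2 : ℝ) ^ j • x) := by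
  have hs : Smooth fun y => φ ((2 : ℝ) ^ j • y) := φ.smooth.comp (contDiff_const_smul _)
  change ld l (fun y => (2 : ℂ) ^ (j * d) * φ ((2 : ℝ) ^ j • y)) x = _
  rw [ld_const_mul hs, ld_comp_smul φ.smooth]
  push_cast
  rw [← mul_assoc, ← pow_mul, ← pow_add, mul_add]

/-- The norms of the regularizations `f * χ_j` of a convolutor `f` grow at most exponentially in
`j`: otherwise the multiples `2^{-k j_k} χ_{j_k}` along a suitable sequence `j_k`, which form a
bounded sequence in `𝓓`, would be mapped to an unbounded sequence. -/
lemma exists_wt_dconv_dilate_le (hω : Continuous ω) (hp : 1 ≤ p) {f : Distr d}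
    (hf : f ∈ ConvolutorSpace ω p) (n : ℕ) (χ : TF d) : ∃ r : ℕ, ∀ j : ℕ,
    wt ω p n (fun x => ‖dconv f (dilate χ j) x‖) ≤ ENNReal.ofReal (r * (2 : ℝ) ^ (r * j)) := by
  by_contra! hcon
  choose j hj using hcon
  obtain ⟨R, -, hR⟩ := exists_tsupport_subset χ
  set a : ℕ → TF d := fun k => ((2 : ℂ) ^ (k * j k))⁻¹ • dilate χ (j k) with ha
  have hcoe : ∀ k x, a k x = ((2 : ℂ) ^ (k * j k))⁻¹ * dilate χ (j k) x := fun k x => rfl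
  have hsupp : ∀ k, tsupport (a k) ⊆ Metric.closedBall 0 R := by
    intro k
    refine tsupport_subset_closedBall fun x hx => ?_
    rw [hcoe] at hx
    exact norm_le_of_ne_zero (tsupport_dilate hR _) (right_ne_zero_of_mul hx)
  have hbd : ∀ l : List (Fin d), ∃ M : ℝ, ∀ k x, ‖ld l (a k) x‖ ≤ M := by
    intro l
    obtain ⟨M, hM0, hM⟩ := exists_Sg_le χ l.length
    refine ⟨(∑ k ∈ Finset.range (d + l.length), (2 : ℝ) ^ (j k * (d + l.length)) + 1) * M,
      fun k x => ?_⟩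
    have e1 : ld l (a k) = fun x => ((2 : ℂ) ^ (k * j k))⁻¹ * ld l (dilate χ (j k)) x :=
      ld_const_mul (dilate χ (j k)).smooth _ l
    rw [e1]
    simp only [ld_dilate, norm_mul, norm_inv, norm_pow, Complex.norm_ofNat]
    rw [← mul_assoc]
    have h1 : ‖ld l χ ((2 : ℝ) ^ j k • x)‖ ≤ M := by
      refine (norm_le_Sg 0 _ _).trans ((Sg_ld_le 0 l χ _).trans ?_)
      rw [zero_add]; exact hM _
    refine mul_le_mul ?_ h1 (norm_nonneg _)
      (add_nonneg (Finset.sum_nonneg fun _ _ => by positivity) zero_le_one)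
    rcases lt_or_ge k (d + l.length) with hk | hk
    · have h2 : (2 : ℝ) ^ (j k * (d + l.length))
          ≤ ∑ k ∈ Finset.range (d + l.length), (2 : ℝ) ^ (j k * (d + l.length)) :=
        Finset.single_le_sum (f := fun k => (2 : ℝ) ^ (j k * (d + l.length)))
          (fun _ _ => by positivity) (Finset.mem_range.mpr hk)
      have h3 : ((2 : ℝ) ^ (k * j k))⁻¹ ≤ 1 := inv_le_one_of_one_le₀ (one_le_pow₀ one_le_two)
      have h4 : ((2 : ℝ) ^ (k * j k))⁻¹ * (2 : ℝ) ^ (j k * (d + l.length))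
          ≤ (2 : ℝ) ^ (j k * (d + l.length)) := mul_le_of_le_one_left (by positivity) h3
      linarith
    · have h2 : (2 : ℝ) ^ (j k * (d + l.length)) ≤ (2 : ℝ) ^ (k * j k) := by
        refine pow_le_pow_right₀ one_le_two ?_
        rw [mul_comm]; exact Nat.mul_le_mul_right _ hk
      have h3 : ((2 : ℝ) ^ (k * j k))⁻¹ * (2 : ℝ) ^ (j k * (d + l.length)) ≤ 1 := by
        rw [inv_mul_le_iff₀ (by positivity), mul_one]; exact h2
      have h4 : 0 ≤ ∑ k ∈ Finset.range (d + l.length), (2 : ℝ) ^ (j k * (d + l.length)) :=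
        Finset.sum_nonneg fun _ _ => by positivity
      linarith
  obtain ⟨M, hM⟩ := exists_wt_dconv_le hω hp hf n hsupp hbd
  obtain ⟨k, hk⟩ := exists_nat_ge M
  have h1 := hM k
  have h2 : wt ω p n (fun x => ‖dconv f (a k) x‖)
      = ENNReal.ofReal (((2 : ℝ) ^ (k * j k))⁻¹) *
        wt ω p n (fun x => ‖dconv f (dilate χ (j k)) x‖) := by
    rw [← wt_const_mul (by positivity)]
    simp only [ha, dconv_smul, norm_mul, norm_inv, norm_pow, Complex.norm_ofNat]
  rw [h2] at h1
  have h3 : ENNReal.ofReal k < ENNReal.ofReal (((2 : ℝ) ^ (k * j k))⁻¹) *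
      wt ω p n (fun x => ‖dconv f (dilate χ (j k)) x‖) := by
    have h4 := ENNReal.mul_lt_mul_right (a := ENNReal.ofReal (((2 : ℝ) ^ (k * j k))⁻¹))
      (by simp) ENNReal.ofReal_ne_top (hj k)
    rw [← ENNReal.ofReal_mul (by positivity)] at h4
    refine lt_of_le_of_lt (le_of_eq ?_) h4
    congr 1
    field_simp
  exact absurd (h3.trans_le h1) (not_lt.mpr (ENNReal.ofReal_le_ofReal hk))

/-! ### The decomposition of an approximate identity given by the MDFP -/

/-- Convolution with a fixed test function on the right, as a linear map. -/
def tcvRight (θ : TF d) : TF d →ₗ[ℂ] TF d where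
  toFun φ := tcv φ θ
  map_add' φ φ' := by
    ext x
    change cv (φ + φ' : TF d) θ x = cv φ θ x + cv φ' θ x
    have h : ∀ y, (φ + φ' : TF d) y = φ y + φ' y := fun _ => rfl
    simp only [cv, h, add_mul]
    exact integral_add (integrable_cont_mul_tf (by have := φ.continuous; fun_prop) θ)
      (integrable_cont_mul_tf (by have := φ'.continuous; fun_prop) θ)
  map_smul' c φ := by
    ext x
    change ∫ y, (c * φ (x - y)) * θ y = c * ∫ y, φ (x - y) * θ y
    simp only [mul_assoc]
    exact integral_const_mul _ _

@[simp] lemma tcvRight_apply (θ φ : TF d) : tcvRight θ φ = tcv φ θ := rfl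

lemma tcv_assoc (φ ψ θ : TF d) : tcv (tcv φ ψ) θ = tcv φ (tcv ψ θ) := by
  ext x
  simp only [coe_tcv, cv_eq_convolution]
  refine convolution_assoc (ContinuousLinearMap.mul ℝ ℂ) (ContinuousLinearMap.mul ℝ ℂ)
    (ContinuousLinearMap.mul ℝ ℂ) (ContinuousLinearMap.mul ℝ ℂ) (fun a b c => mul_assoc a b c)
    φ.continuous.aestronglyMeasurable ψ.continuous.aestronglyMeasurable
    θ.continuous.aestronglyMeasurable ?_ ?_ ?_
  · exact Filter.Eventually.of_forall fun y =>
      (φ.hasCompactSupport.convolutionExists_left _ φ.continuous ψ.continuous.locallyIntegrable y)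
  · exact Filter.Eventually.of_forall fun y =>
      ((ψ.hasCompactSupport.norm).convolutionExists_left _ ψ.continuous.norm
        θ.continuous.norm.locallyIntegrable y)
  · refine (φ.hasCompactSupport.norm).convolutionExists_left _ φ.continuous.norm ?_ x
    refine Continuous.locallyIntegrable ?_
    exact (ψ.hasCompactSupport.norm).continuous_convolution_left _ ψ.continuous.norm
      θ.continuous.norm.locallyIntegrable

lemma tcv_tld_tcv (φ ψ θ : TF d) (l : List (Fin d)) :
    tcv (tld l (tcv φ ψ)) θ = tcv φ (tcv ψ (tld l θ)) := by
  ext x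
  have h1 := congrArg (fun u : TF d => ld l u x) (tcv_assoc φ ψ θ)
  simp only [coe_tcv] at h1
  rw [← coe_tcv φ ψ, ld_cv_left (tcv φ ψ).smooth] at h1
  rw [coe_tcv, coe_tld, h1, ← coe_tcv ψ θ, ld_cv_right φ.continuous.locallyIntegrable, coe_tcv,
    ld_cv_right ψ.continuous.locallyIntegrable]
  simp

lemma dconv_tld_tcv (f : Distr d) (φ ψ : TF d) (l : List (Fin d)) :
    dconv f (tld l (tcv φ ψ)) = cv (ld l (dconv f φ)) ψ := by
  rw [← ld_dconv, dconv_tcv, ld_cv_left (smooth_dconv f φ)]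

lemma dilate_tcv (φ ψ : TF d) (j : ℕ) : dilate (tcv φ ψ) j = tcv (dilate φ j) (dilate ψ j) := by
  ext x
  rw [coe_tcv, cv_dilate, dilate_apply, coe_tcv, cv, ← integral_const_mul]
  refine integral_congr_ae (Filter.Eventually.of_forall fun y => ?_)
  simp only [dilate_apply]
  rw [smul_add, smul_smul, ← mul_pow, mul_inv_cancel₀ two_ne_zero, one_pow, one_smul,
    ← sub_eq_add_neg, mul_assoc]

lemma dilate_add (φ ψ : TF d) (j : ℕ) : dilate (φ + ψ) j = dilate φ j + dilate ψ j := by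
  ext x
  change (2 : ℂ) ^ (j * d) * (φ _ + ψ _) = _
  rw [mul_add]; rfl

/-- If `2^d φ(2 ·) - φ = Δψ`, then the increments of the approximate identity `φ_j` are
`φ_{j+1} - φ_j = 4^{-j} Δ(ψ_j)`. -/
lemma dilate_succ_sub {φ ψ : TF d}
    (h : ∀ x, (2 : ℂ) ^ d * φ ((2 : ℝ) • x) - φ x = Laplacian.laplacian (ψ : Eu d → ℂ) x) (j : ℕ) :
    dilate φ (j + 1) - dilate φ j = ((4 : ℂ) ^ j)⁻¹ • ∑ i, tld [i, i] (dilate ψ j) := by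
  ext x
  change dilate φ (j + 1) x - dilate φ j x
    = ((4 : ℂ) ^ j)⁻¹ * (∑ i, tld [i, i] (dilate ψ j) : TF d) x
  have h1 := h ((2 : ℝ) ^ j • x)
  rw [laplacian_eq_sum ψ.smooth, smul_smul, ← pow_succ'] at h1
  beta_reduce at h1
  have h2 : ∀ i, tld [i, i] (dilate ψ j) x
      = (2 : ℂ) ^ (j * d) * ((4 : ℂ) ^ j * pd i (pd i ψ) ((2 : ℝ) ^ j • x)) := fun i => by
    rw [coe_tld, ld_dilate]
    change (2 : ℂ) ^ (j * (d + 2)) * pd i (pd i ψ) _ = _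
    rw [mul_add, pow_add, mul_comm j 2, pow_mul 2 2 j]
    norm_num [mul_assoc]
  rw [tf_sum_apply, Finset.sum_congr rfl fun i _ => h2 i, ← Finset.mul_sum, ← Finset.mul_sum, ← h1,
    dilate_apply, dilate_apply, Nat.succ_mul, pow_add]
  field_simp

/-- The MDFP at all scales: `φ^0_j` and its increments in `j` are given by convolutions with the
`χ^ℓ_j`, where the latter involve functions `ψ^ℓ` with `L` vanishing moments. The radius `R` of the
supports does not depend on `L`. -/
lemma MDFP.exists_decomposition {χ : Fin 2 → TF d} (hχ : MDFP χ) : ∃ R : ℝ, 0 ≤ R ∧ ∀ L : ℕ,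
    ∃ φ ψ : Fin 2 → TF d, (∀ ℓ, tsupport (φ ℓ) ⊆ Metric.closedBall 0 R) ∧
      (∀ ℓ, tsupport (ψ ℓ) ⊆ Metric.closedBall 0 R) ∧ (∀ ℓ, MomentsVanish L (ψ ℓ)) ∧
      ∫ x, φ 0 x = 1 ∧
      (∀ j, dilate (φ 0) j = ∑ ℓ, tcv (dilate (χ ℓ) j) (dilate (φ ℓ) j)) ∧
      ∀ j, dilate (φ 0) (j + 1) - dilate (φ 0) j = ((4 : ℂ) ^ j)⁻¹ •
        ∑ i, ∑ ℓ, tld [i, i] (tcv (dilate (χ ℓ) j) (dilate (ψ ℓ) j)) := by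
  obtain ⟨K, hK, -, h⟩ := hχ
  obtain ⟨R, hR⟩ := hK.isBounded.subset_closedBall 0
  refine ⟨max R 0, le_max_right _ _, fun L => ?_⟩
  have hR' : K ⊆ Metric.closedBall 0 (max R 0) :=
    hR.trans (Metric.closedBall_subset_closedBall (le_max_left _ _))
  obtain ⟨φ, ψ, h1, h2, h3, h4, h5⟩ := h L
  have e : ∀ u : Fin 2 → TF d, (∀ x, u 0 x = tconv (χ 0) (u 0) x + tconv (χ 1) (u 1) x) →
      ∀ j, dilate (u 0) j = ∑ ℓ, tcv (dilate (χ ℓ) j) (dilate (u ℓ) j) := by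
    intro u hu j
    have : u 0 = tcv (χ 0) (u 0) + tcv (χ 1) (u 1) := by
      ext x
      rw [hu x, tconv_eq_cv, tconv_eq_cv]; rfl
    rw [Fin.sum_univ_two, ← dilate_tcv, ← dilate_tcv, ← dilate_add, ← this]
  refine ⟨φ, ψ, fun ℓ => (h1 ℓ).1.trans hR', fun ℓ => (h1 ℓ).2.1.trans hR', fun ℓ => (h1 ℓ).2.2.1,
    h3, e φ h4, fun j => ?_⟩
  rw [dilate_succ_sub h2, e ψ h5]
  congr 1
  refine Finset.sum_congr rfl fun i _ => ?_
  ext x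
  rw [coe_tld, tf_sum_apply]
  have : ((∑ ℓ, tcv (dilate (χ ℓ) j) (dilate (ψ ℓ) j) : TF d) : Eu d → ℂ)
      = fun x => ∑ ℓ, tcv (dilate (χ ℓ) j) (dilate (ψ ℓ) j) x := by
    funext x; rw [tf_sum_apply]
  rw [this, ld_sum _ fun ℓ => (tcv (dilate (χ ℓ) j) (dilate (ψ ℓ) j)).smooth]
  simp only [coe_tld]

/-! ### Weighted bounds for telescoping limits -/

/-- By Fatou's lemma, a pointwise limit inherits a weighted bound from the sum of the weighted norms
of the increments. -/
lemma wt_lt_top_of_tendsto (hω : Continuous ω) (hp : 1 ≤ p) {s : ℝ} {v : ℕ → Eu d → ℂ}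
    (hv : ∀ k, Continuous (v k)) {u : Eu d → ℂ}
    (hlim : ∀ x, Filter.Tendsto (fun k => v k x) Filter.atTop (nhds (u x)))
    (h0 : wt ω p s (fun x => ‖v 0 x‖) < ∞) {b : ℕ → ℝ≥0∞}
    (h : ∀ k, wt ω p s (fun x => ‖v (k + 1) x - v k x‖) ≤ b k) (hb : ∑' k, b k < ∞) :
    wt ω p s (fun x => ‖u x‖) < ∞ := by
  have hk : ∀ k, wt ω p s (fun x => ‖v k x‖)
      ≤ wt ω p s (fun x => ‖v 0 x‖) + ∑ i ∈ Finset.range k, b i := by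
    intro k
    induction k with
    | zero => simp
    | succ k ih =>
      have h1 : wt ω p s (fun x => ‖v (k + 1) x‖)
          ≤ wt ω p s (fun x => ‖v k x‖ + ‖v (k + 1) x - v k x‖) :=
        wt_mono (fun x => norm_nonneg _) fun x => by
          simpa using norm_add_le (v k x) (v (k + 1) x - v k x)
      refine h1.trans ((wt_add_le hω hp (hv k).norm ((hv (k + 1)).sub (hv k)).norm).trans ?_)
      rw [Finset.sum_range_succ, ← add_assoc]
      exact add_le_add ih (h k)
  refine lt_of_le_of_lt ?_ (ENNReal.add_lt_top.mpr ⟨h0, hb⟩)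
  refine (Lp.eLpNorm_lim_le_liminf_eLpNorm (f := fun k x => ‖v k x‖ * Real.exp (s * ω x))
    (fun k => (continuous_mul_exp hω s (hv k).norm).aestronglyMeasurable) _
    (Filter.Eventually.of_forall fun x => ((hlim x).norm).mul_const _)).trans ?_
  refine (Filter.liminf_le_liminf (Filter.Eventually.of_forall fun k =>
    (hk k).trans (add_le_add le_rfl (ENNReal.sum_le_tsum _)))).trans ?_
  rw [Filter.liminf_const]

/-- The growth `2^{rj}` is absorbed by vanishing moments of order `L > r`. -/
lemma two_rpow_mul_inv_pow (r : ℝ) (L j : ℕ) :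
    (2 : ℝ) ^ (r * j) * (2⁻¹ : ℝ) ^ (L * j) = ((2 : ℝ) ^ (r - L)) ^ j := by
  rw [← Real.rpow_natCast ((2 : ℝ) ^ (r - L)), ← Real.rpow_mul two_pos.le, inv_pow,
    ← Real.rpow_natCast, ← Real.rpow_neg two_pos.le, ← Real.rpow_add two_pos]
  congr 1; push_cast; ring

lemma summable_two_rpow_pow {r : ℝ} {L : ℕ} (h : r < L) :
    Summable fun j : ℕ => ((2 : ℝ) ^ (r - L)) ^ j :=
  summable_geometric_of_lt_one (by positivity)
    (Real.rpow_lt_one_of_one_lt_of_neg one_lt_two (by linarith))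

lemma tsum_ofReal_mul_lt_top {r : ℝ} {L : ℕ} (h : r < L) (c : ℝ) :
    ∑' j : ℕ, ENNReal.ofReal (c * ((2 : ℝ) ^ (r - L)) ^ j) < ∞ :=
  ((summable_two_rpow_pow h).mul_left c).tsum_ofReal_lt_top

/-! ### Sufficiency of the growth conditions -/

lemma wt_mul_sum_sum_le (hω : Continuous ω) (hp : 1 ≤ p) {s : ℝ} {a : ℂ} (ha : ‖a‖ ≤ 1)
    {ι κ : Type*} [Fintype ι] [Fintype κ] {w : ι → κ → Eu d → ℂ}
    (hw : ∀ i k, Continuous (w i k)) :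
    wt ω p s (fun x => ‖a * ∑ i, ∑ k, w i k x‖) ≤ ∑ i, ∑ k, wt ω p s fun x => ‖w i k x‖ := by
  refine (wt_mono (T := fun x => ∑ i, ∑ k, ‖w i k x‖) (fun x => norm_nonneg _) fun x => ?_).trans
    ((wt_sum_le hω hp _ fun i => continuous_finsetSum _ fun k _ => (hw i k).norm).trans
      (Finset.sum_le_sum fun i _ => wt_sum_le hω hp _ fun k => (hw i k).norm))
  rw [norm_mul]
  refine (mul_le_of_le_one_left (norm_nonneg _) ha).trans ((norm_sum_le _ _).trans ?_)
  exact Finset.sum_le_sum fun i _ => norm_sum_le _ _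

lemma norm_inv_four_pow_le (j : ℕ) : ‖((4 : ℂ) ^ j)⁻¹‖ ≤ 1 := by
  rw [norm_inv, norm_pow, Complex.norm_ofNat]
  exact inv_le_one_of_one_le₀ (one_le_pow₀ (by norm_num))

lemma sum_sum_ofReal {ι κ : Type*} [Fintype ι] [Fintype κ] {c : ι → κ → ℝ} (hc : ∀ i k, 0 ≤ c i k)
    {q : ℝ} (hq : 0 ≤ q) :
    ∑ i, ∑ k, ENNReal.ofReal (c i k * q) = ENNReal.ofReal ((∑ i, ∑ k, c i k) * q) := by
  rw [Finset.sum_mul, ENNReal.ofReal_sum_of_nonneg fun i _ =>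
    mul_nonneg (Finset.sum_nonneg fun k _ => hc i k) hq]
  refine Finset.sum_congr rfl fun i _ => ?_
  rw [Finset.sum_mul, ENNReal.ofReal_sum_of_nonneg fun k _ => mul_nonneg (hc i k) hq]

lemma norm_cv_le_average {R M : ℝ} {h : Eu d → ℂ} (hh : Continuous h) {Θ : TF d}
    (hR : tsupport Θ ⊆ Metric.closedBall 0 R) (hΘ : ∀ y, ‖Θ y‖ ≤ M) (x : Eu d) :
    ‖cv h Θ x‖ ≤ M * ∫ z in Metric.ball (0 : Eu d) (R + 1), ‖h (x + z)‖ := by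
  have h1 : cv h Θ x = ∫ y, h (x + y) * Θ (-y) := by
    have := integral_neg_eq_self (fun y => h (x + y) * Θ (-y)) (volume : Measure (Eu d))
    simp only [neg_neg, ← sub_eq_add_neg] at this
    exact this
  have hS : Continuous fun z => ‖h z‖ := hh.norm
  have h2 : ∫ y, h (x + y) * Θ (-y) = ∫ y in Metric.ball (0 : Eu d) (R + 1), h (x + y) * Θ (-y) := by
    refine (setIntegral_eq_integral_of_forall_compl_eq_zero fun y hy => ?_).symm
    by_contra hne
    have := norm_le_of_ne_zero hR (right_ne_zero_of_mul hne)
    rw [norm_neg] at this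
    exact hy (mem_ball_zero_iff.mpr (by linarith))
  rw [h1, h2, ← integral_const_mul]
  refine norm_integral_le_of_norm_le ((integrableOn_ball_shift hS x (R + 1)).const_mul M)
    (Filter.Eventually.of_forall fun y => ?_)
  rw [norm_mul, mul_comm]
  exact mul_le_mul_of_nonneg_right (hΘ _) (norm_nonneg _)

/-- A weighted form of Young's inequality for a bounded kernel with bounded support. -/
lemma wt_cv_le (hω : Continuous ω) (hp : 1 ≤ p) {s s' R M : ℝ} (hM : 0 ≤ M)
    (hw : ∀ x y, ‖y‖ ≤ R + 1 → s * ω x ≤ s' * ω (x + y)) {h : Eu d → ℂ} (hh : Continuous h)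
    {Θ : TF d} (hR : tsupport Θ ⊆ Metric.closedBall 0 R) (hΘ : ∀ y, ‖Θ y‖ ≤ M) :
    wt ω p s (fun x => ‖cv h Θ x‖)
      ≤ ENNReal.ofReal (M * (volume (Metric.ball (0 : Eu d) (R + 1))).toReal) *
        wt ω p s' fun x => ‖h x‖ := by
  have hav : wt ω p s (fun x => ∫ z in Metric.ball (0 : Eu d) (R + 1), ‖h (x + z)‖)
      ≤ volume (Metric.ball (0 : Eu d) (R + 1)) * wt ω p s' fun x => ‖h x‖ :=
    wt_average_le hω hp hw (S := fun x => ‖h x‖) hh.norm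
  have hm : wt ω p s (fun x => ‖cv h Θ x‖) ≤ ENNReal.ofReal M *
      wt ω p s (fun x => ∫ z in Metric.ball (0 : Eu d) (R + 1), ‖h (x + z)‖) := by
    rw [← wt_const_mul hM]
    exact wt_mono (fun x => norm_nonneg _) (norm_cv_le_average hh hR hΘ)
  refine hm.trans ((mul_le_mul_right hav _).trans (le_of_eq ?_))
  rw [ENNReal.ofReal_mul hM, mul_assoc, ENNReal.ofReal_toReal measure_ball_lt_top.ne]

/-- The growth conditions imply that `f` is a convolutor. In the telescoping series for `f * θ` the
derivatives in `Δψ^0_j` and the gain `2^{-jL}` from the vanishing moments are put on `θ`, so that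
only the regularizations `f * χ^ℓ_j` themselves, not their derivatives, are to be estimated. -/
lemma mem_ConvolutorSpace_of_wt_le (hω0 : ∀ x, 0 ≤ ω x) (hωc : Continuous ω)
    (hω : ∃ C : ℝ, 0 < C ∧ ∀ x y : Eu d, ‖y‖ ≤ 1 → ω (x + y) ≤ C * ω x) (hp : 1 ≤ p)
    {χ : Fin 2 → TF d} (hχ : MDFP χ) {f : Distr d}
    (h : ∀ n : ℕ, ∃ r A : ℝ, 0 ≤ A ∧ ∀ (j : ℕ) (ℓ : Fin 2),
      wt ω p n (fun x => ‖dconv f (dilate (χ ℓ) j) x‖) ≤ ENNReal.ofReal (A * (2 : ℝ) ^ (r * j))) :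
    f ∈ ConvolutorSpace ω p := by
  intro η
  rw [mem_KSpace_iff hωc]
  refine ⟨smooth_dconv f η, fun n l => ?_⟩
  rw [ld_dconv]
  generalize tld l η = θ
  obtain ⟨R, hR0, hdec⟩ := hχ.exists_decomposition
  obtain ⟨ρ, hρ0, hρ⟩ := exists_tsupport_subset θ
  -- The weight is chosen before the number of moments: the supports do not depend on the latter.
  obtain ⟨κ, hκ⟩ := exists_weight_comparison hω0 hω (R + ρ + 1)
  obtain ⟨r, A, hA, hH⟩ := h (n * κ)
  obtain ⟨L, hL⟩ := exists_nat_gt r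
  obtain ⟨φ, ψ, hφR, hψR, hψ, hφ1, hφ, hstep⟩ := hdec L
  have hw : ∀ x y : Eu d, ‖y‖ ≤ R + ρ + 1 → (n : ℝ) * ω x ≤ (n * κ : ℕ) * ω (x + y) := by
    intro x y hy
    push_cast
    rw [mul_assoc]
    exact mul_le_mul_of_nonneg_left (hκ x y hy).2 (Nat.cast_nonneg _)
  set V : ℝ := (volume (Metric.ball (0 : Eu d) (R + ρ + 1))).toReal with hV
  have hθs : ∀ i, tsupport (tld [i, i] θ) ⊆ Metric.closedBall 0 ρ := fun i => by
    rw [coe_tld]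
    exact (tsupport_pd_subset _ i).trans ((tsupport_pd_subset _ i).trans hρ)
  choose M hM0 hM using fun i => exists_Sg_le (tld [i, i] θ) L
  refine wt_lt_top_of_tendsto hωc hp (v := fun k => dconv f (tcv (dilate (φ 0) k) θ))
    (fun k => (smooth_dconv f _).continuous) (tendsto_dconv_tcv_dilate f (φ 0) hφ1 θ) ?_
    (b := fun j => ENNReal.ofReal ((∑ i, ∑ ℓ, (∫ y, ‖y‖ ^ L * ‖ψ ℓ y‖) * M i * V * A) *
      ((2 : ℝ) ^ (r - L)) ^ j)) (fun j => ?_) (tsum_ofReal_mul_lt_top hL _)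
  · have h0 : dconv f (tcv (dilate (φ 0) 0) θ) = fun x => (1 : ℂ) * ∑ _i : Unit, ∑ ℓ,
        cv (dconv f (dilate (χ ℓ) 0)) (tcv (dilate (φ ℓ) 0) θ) x := by
      funext x
      rw [hφ, ← tcvRight_apply, map_sum, dconv_sum]
      simp only [tcvRight_apply, tcv_assoc, dconv_tcv, one_mul, Finset.univ_unique,
        Finset.sum_singleton, coe_tcv]
    rw [h0]
    refine lt_of_le_of_lt (wt_mul_sum_sum_le hωc hp (by simp) (fun i ℓ =>
      (smooth_cv (smooth_dconv f _).continuous.locallyIntegrable _).continuous)) ?_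
    refine ENNReal.sum_lt_top.mpr fun i _ => ENNReal.sum_lt_top.mpr fun ℓ _ => ?_
    obtain ⟨B, hB0, hB⟩ := exists_Sg_le (tcv (dilate (φ ℓ) 0) θ) 0
    refine lt_of_le_of_lt (wt_cv_le hωc hp hB0 hw (smooth_dconv f _).continuous
      (tsupport_tcv hρ (tsupport_dilate (hφR ℓ) 0)) hB) ?_
    exact ENNReal.mul_lt_top ENNReal.ofReal_lt_top ((hH 0 ℓ).trans_lt ENNReal.ofReal_lt_top)
  · have hj : (fun x => dconv f (tcv (dilate (φ 0) (j + 1)) θ) x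
        - dconv f (tcv (dilate (φ 0) j) θ) x) = fun x => ((4 : ℂ) ^ j)⁻¹ * ∑ i, ∑ ℓ,
        cv (dconv f (dilate (χ ℓ) j)) (tcv (dilate (ψ ℓ) j) (tld [i, i] θ)) x := by
      funext x
      rw [← dconv_sub, ← tcvRight_apply, ← tcvRight_apply, ← map_sub, hstep, map_smul, dconv_smul]
      simp only [map_sum, dconv_sum, tcvRight_apply, tcv_tld_tcv, dconv_tcv, coe_tcv]
    have hj' : (fun x => ‖dconv f (tcv (dilate (φ 0) (j + 1)) θ) x
        - dconv f (tcv (dilate (φ 0) j) θ) x‖) = fun x => ‖((4 : ℂ) ^ j)⁻¹ * ∑ i, ∑ ℓ,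
        cv (dconv f (dilate (χ ℓ) j)) (tcv (dilate (ψ ℓ) j) (tld [i, i] θ)) x‖ :=
      funext fun x => congrArg norm (congrFun hj x)
    rw [hj']
    have hI : ∀ ℓ, 0 ≤ ∫ y, ‖y‖ ^ L * ‖ψ ℓ y‖ := fun ℓ => integral_nonneg fun y => by positivity
    rw [← sum_sum_ofReal (fun i ℓ => by have := hI ℓ; have := hM0 i; positivity) (by positivity)]
    refine (wt_mul_sum_sum_le hωc hp (norm_inv_four_pow_le j) (fun i ℓ =>
      (smooth_cv (smooth_dconv f _).continuous.locallyIntegrable _).continuous)).trans ?_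
    refine Finset.sum_le_sum fun i _ => Finset.sum_le_sum fun ℓ _ => ?_
    have hI' := hI ℓ
    have hMi := hM0 i
    refine (wt_cv_le hωc hp (s' := (n * κ : ℕ)) (R := R + ρ)
      (M := (∫ y, ‖y‖ ^ L * ‖ψ ℓ y‖) * ((2⁻¹ : ℝ) ^ (L * j) * M i)) (by positivity)
      hw (smooth_dconv f _).continuous
      (tsupport_tcv (hθs i) (tsupport_dilate (hψR ℓ) j)) (fun y => ?_)).trans ?_
    · rw [coe_tcv, cv_comm]
      exact norm_cv_dilate_le (hψ ℓ) (hψR ℓ) (tld [i, i] θ).smooth j y fun z _ => hM i _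
    · refine (mul_le_mul_right (hH j ℓ) _).trans (le_of_eq ?_)
      rw [← ENNReal.ofReal_mul (by positivity), ← two_rpow_mul_inv_pow]
      congr 1
      ring

/-- The growth condition on the derivatives `∂^{l'} ∂^l`, `|l'| ≤ m`, of the regularizations
`f * χ^ℓ_j`, with respect to the weight `e^{s ω}`. -/
def RegBound (ω : Eu d → ℝ) (p : ℝ≥0∞) (χ : Fin 2 → TF d) (f : Distr d) (m : ℕ) (r : ℝ)
    (l : List (Fin d)) (s A : ℝ) : Prop :=
  ∀ l' : List (Fin d), l'.length ≤ m → ∀ (j : ℕ) (ℓ : Fin 2),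
    wt ω p s (fun x => ‖ld (l' ++ l) (dconv f (dilate (χ ℓ) j)) x‖)
      ≤ ENNReal.ofReal (A * (2 : ℝ) ^ (r * j))

lemma RegBound.wt_Sg_le (hω : Continuous ω) (hp : 1 ≤ p) {χ : Fin 2 → TF d} {f : Distr d}
    {m k : ℕ} {r s A : ℝ} {l : List (Fin d)} (h : RegBound ω p χ f (m + k) r l s A)
    {e : List (Fin d)} (he : e.length ≤ k) (j : ℕ) (ℓ : Fin 2) :
    wt ω p s (Sg m (ld (l ++ e) (dconv f (dilate (χ ℓ) j))))
      ≤ ENNReal.ofReal ((1 + d : ℝ) ^ m * (A * (2 : ℝ) ^ (r * j))) := by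
  have hs := smooth_dconv f (dilate (χ ℓ) j)
  refine (Mollif.wt_Sg_le hω hp (hs.ld _) (A := ENNReal.ofReal (A * (2 : ℝ) ^ (r * j)))
    fun l' hl' => ?_).trans (le_of_eq ?_)
  · rw [← ld_append, ld_perm hs (l' := (l' ++ e) ++ l)]
    · exact h (l' ++ e) (by rw [List.length_append]; omega) j ℓ
    · rw [List.append_assoc]
      exact List.Perm.append_left _ List.perm_append_comm
  · rw [ENNReal.ofReal_mul (p := (1 + d : ℝ) ^ m) (by positivity),
      ENNReal.ofReal_pow (by positivity),
      ENNReal.ofReal_add zero_le_one (by positivity), ENNReal.ofReal_one, ENNReal.ofReal_natCast]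

/-- If the regularizations `f * χ^ℓ_j` grow at most like `2^{rj}`, locally together with all their
derivatives, then the telescoping series of the regularizations `f * φ^0_j`, with more than `r`
vanishing moments in the MDFP, converges with all derivatives to a smooth function `g` which
represents `f` and inherits the weighted bounds. -/
lemma exists_smooth_representative (hω : Continuous ω) (hp : 1 ≤ p) {χ : Fin 2 → TF d}
    (hχ : MDFP χ) (r : ℝ) : ∃ (m : ℕ) (R : ℝ), ∀ f : Distr d,
      (∀ l, ∃ s A : ℝ, 0 ≤ A ∧ RegBound ω p χ f m r l s A) →
      ∃ g : Eu d → ℂ, Smooth g ∧ Represents g f ∧ ∀ (l : List (Fin d)) (s s' A : ℝ), 0 ≤ A →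
        (∀ x y, ‖y‖ ≤ R → s * ω x ≤ s' * ω (x + y)) → RegBound ω p χ f m r l s' A →
        wt ω p s (fun x => ‖ld l g x‖) < ∞ := by
  obtain ⟨R, hR0, hdec⟩ := hχ.exists_decomposition
  obtain ⟨L, hL⟩ := exists_nat_gt r
  obtain ⟨φ, ψ, hφR, hψR, hψ, hφ1, hφ, hstep⟩ := hdec L
  refine ⟨L + d + 1 + 2, R + 1, fun f hf => ?_⟩
  set H : Fin 2 → ℕ → Eu d → ℂ := fun ℓ j => dconv f (dilate (χ ℓ) j) with hH
  have hHs : ∀ ℓ j, Smooth (H ℓ j) := fun ℓ j => smooth_dconv f _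
  set F : ℕ → Eu d → ℂ := fun j => dconv f (dilate (φ 0) j) with hF
  have hFs : ∀ j, Smooth (F j) := fun j => smooth_dconv f _
  set q : ℝ := (2 : ℝ) ^ (r - L) with hq
  have hq0 : 0 ≤ q := by positivity
  have hF0 : ∀ l, ld l (F 0) = fun x => (1 : ℂ) * ∑ _i : Unit, ∑ ℓ,
      cv (ld (l ++ []) (H ℓ 0)) (dilate (φ ℓ) 0) x := by
    intro l
    have : F 0 = fun x => ∑ ℓ, cv (H ℓ 0) (dilate (φ ℓ) 0) x := by
      funext x
      simp only [hF, hH]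
      rw [hφ, dconv_sum]
      simp only [dconv_tcv]
    rw [this, ld_sum _ fun ℓ => smooth_cv (hHs ℓ 0).continuous.locallyIntegrable _]
    simp only [ld_cv_left (hHs _ _), Finset.univ_unique, Finset.sum_singleton, one_mul,
      List.append_nil]
  have hinc : ∀ l j, ld l (fun x => F (j + 1) x - F j x) = fun x => ((4 : ℂ) ^ j)⁻¹ * ∑ i, ∑ ℓ,
      cv (ld (l ++ [i, i]) (H ℓ j)) (dilate (ψ ℓ) j) x := by
    intro l j
    have : (fun x => F (j + 1) x - F j x) = fun x => ((4 : ℂ) ^ j)⁻¹ * ∑ i, ∑ ℓ,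
        cv (ld [i, i] (H ℓ j)) (dilate (ψ ℓ) j) x := by
      funext x
      simp only [hF, hH]
      rw [← dconv_sub, hstep, dconv_smul, dconv_sum]
      simp only [dconv_sum, dconv_tld_tcv]
    have hs : ∀ i ℓ, Smooth (cv (ld [i, i] (H ℓ j)) (dilate (ψ ℓ) j)) := fun i ℓ =>
      smooth_cv ((hHs ℓ j).ld _).continuous.locallyIntegrable _
    rw [this, ld_const_mul (ContDiff.sum fun i _ => ContDiff.sum fun ℓ _ => hs i ℓ),
      ld_sum _ fun i => ContDiff.sum fun ℓ _ => hs i ℓ]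
    simp only [ld_sum _ (hs _), ld_cv_left ((hHs _ _).ld _), ld_append]
  have hinc' : ∀ l j x, ld l (F (j + 1)) x - ld l (F j) x
      = ld l (fun x => F (j + 1) x - F j x) x := fun l j x => by
    rw [ld_sub (hFs _) (hFs _)]
  -- Normal convergence on bounded sets.
  have hloc : ∀ l (ρ : ℝ), ∃ c : ℝ, 0 ≤ c ∧ ∀ j x, ‖x‖ ≤ ρ →
      ‖ld l (fun x => F (j + 1) x - F j x) x‖ ≤ c * q ^ j := by
    intro l ρ
    obtain ⟨s, A, hA, hB⟩ := hf l
    choose C hC0 hC using fun ℓ => exists_norm_cv_dilate_le (hψ ℓ) (hψR ℓ)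
    obtain ⟨D, hD0, hD⟩ := exists_average_le_wt hω hp s (R + 1) ρ
    refine ⟨∑ _i : Fin d, ∑ ℓ, C ℓ * (D * ((1 + d : ℝ) ^ (L + d + 1) * A)),
      Finset.sum_nonneg fun i _ => Finset.sum_nonneg fun ℓ _ => by have := hC0 ℓ; positivity,
      fun j x hx => ?_⟩
    rw [hinc, norm_mul]
    refine (mul_le_of_le_one_left (norm_nonneg _) (norm_inv_four_pow_le j)).trans ?_
    rw [Finset.sum_mul]
    refine (norm_sum_le _ _).trans (Finset.sum_le_sum fun i _ => ?_)
    rw [Finset.sum_mul]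
    refine (norm_sum_le _ _).trans (Finset.sum_le_sum fun ℓ _ => ?_)
    have hCℓ := hC0 ℓ
    have hs := (hHs ℓ j).ld (l ++ [i, i])
    refine (hC ℓ _ hs j x).trans ?_
    refine (mul_le_mul_of_nonneg_left (hD _ (hs.continuous_Sg _) (Sg_nonneg _ _) _
      (by positivity) (hB.wt_Sg_le hω hp (e := [i, i]) le_rfl j ℓ) x hx)
      (by positivity)).trans (le_of_eq ?_)
    rw [hq, ← two_rpow_mul_inv_pow]
    ring
  set u : ℕ → Eu d → ℂ := fun k => k.casesOn (F 0) fun j x => F (j + 1) x - F j x with hu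
  have hus : ∀ k, Smooth (u k) := by
    rintro (_ | j)
    · exact hFs 0
    · exact (hFs _).sub (hFs _)
  have hub : ∀ (l : List (Fin d)) (ρ : ℝ), ∃ b : ℕ → ℝ, (∀ k, 0 ≤ b k) ∧ Summable b ∧
      ∀ k x, ‖x‖ ≤ ρ → ‖ld l (u k) x‖ ≤ b k := by
    intro l ρ
    obtain ⟨c, hc0, hc⟩ := hloc l ρ
    obtain ⟨M, hM⟩ := (isCompact_closedBall (0 : Eu d) ρ).exists_bound_of_continuousOn
      ((hFs 0).ld l).continuous.continuousOn
    refine ⟨fun k => k.casesOn (max M 0) fun j => c * q ^ j, ?_, ?_, ?_⟩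
    · rintro (_ | j)
      · exact le_max_right _ _
      · change 0 ≤ c * q ^ j; positivity
    · exact (summable_nat_add_iff 1).mp ((summable_two_rpow_pow hL).mul_left c)
    · rintro (_ | j) x hx
      · exact (hM x (by simpa using hx)).trans (le_max_left _ _)
      · exact hc j x hx
  obtain ⟨hgs, hgl⟩ := smooth_tsum hus fun l ρ => (hub l ρ).imp fun b hb => hb.2
  set g : Eu d → ℂ := fun x => ∑' k, u k x with hg
  have hpart : ∀ l n x, ∑ k ∈ Finset.range (n + 1), ld l (u k) x = ld l (F n) x := by
    intro l n x
    induction n with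
    | zero => simp [hu]
    | succ n ih =>
      rw [Finset.sum_range_succ, ih]
      change ld l (F n) x + ld l (fun x => F (n + 1) x - F n x) x = _
      rw [← hinc']; ring
  have hlim : ∀ l x, Filter.Tendsto (fun n => ld l (F n) x) Filter.atTop (nhds (ld l g x)) := by
    intro l x
    obtain ⟨b, -, hb, hle⟩ := hub l ‖x‖
    have h1 : Summable fun k => ld l (u k) x :=
      Summable.of_norm_bounded hb fun k => hle k x le_rfl
    have h2 := (Filter.tendsto_add_atTop_iff_nat 1).mpr h1.hasSum.tendsto_sum_nat
    simp only [hpart] at h2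
    rw [hgl]
    exact h2
  refine ⟨g, hgs, fun θ => ?_, fun l s s' A hA hw hB => ?_⟩
  · obtain ⟨ρ, -, hρ⟩ := exists_tsupport_subset θ
    obtain ⟨b, hb0, hb, hle⟩ := hub [] ρ
    have h1 := tendsto_dconv_tcv_dilate f (φ 0) hφ1 (reflTranslate θ 0) 0
    have h2 : dconv f (reflTranslate θ 0) 0 = f θ := by
      rw [dconv]; congr 1; ext y; simp [reflTranslate_apply]
    have h3 : ∀ k, dconv f (tcv (dilate (φ 0) k) (reflTranslate θ 0)) 0 = ∫ y, F k y * θ y := by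
      intro k
      rw [dconv_tcv, cv, ← integral_neg_eq_self]
      simp [hF, reflTranslate_apply]
    simp only [h2, h3] at h1
    refine tendsto_nhds_unique h1 ?_
    refine tendsto_integral_of_dominated_convergence (fun y => (∑' k, b k) * ‖θ y‖)
      (fun k => ((hFs k).continuous.mul θ.continuous).aestronglyMeasurable) ?_ (fun k => ?_) ?_
    · exact ((θ.continuous.integrable_of_hasCompactSupport θ.hasCompactSupport).norm).const_mul _
    · refine Filter.Eventually.of_forall fun y => ?_
      rw [norm_mul]
      by_cases hy : θ y = 0
      · simp [hy]
      refine mul_le_mul_of_nonneg_right ?_ (norm_nonneg _)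
      have h4 := hpart [] k y
      rw [ld_nil] at h4
      rw [← h4]
      exact (norm_sum_le_of_le _ fun i _ => hle i y (norm_le_of_ne_zero hρ hy)).trans
        (hb.sum_le_tsum _ fun i _ => hb0 i)
    · exact Filter.Eventually.of_forall fun y => (hlim [] y).mul_const _
  · choose C hC0 hC using fun ℓ => exists_wt_cv_dilate_le hω hp (hψ ℓ) (hψR ℓ)
    refine wt_lt_top_of_tendsto hω hp (v := fun k => ld l (F k))
      (fun k => ((hFs k).ld l).continuous) (hlim l) ?_
      (b := fun j => ENNReal.ofReal ((∑ _i : Fin d, ∑ ℓ, C ℓ * ((1 + d : ℝ) ^ (L + d + 1) * A)) *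
        ((2 : ℝ) ^ (r - L)) ^ j)) (fun j => ?_) (tsum_ofReal_mul_lt_top hL _)
    · simp only [hF0]
      refine lt_of_le_of_lt (wt_mul_sum_sum_le hω hp (by simp) fun i ℓ =>
        (smooth_cv ((hHs ℓ 0).ld _).continuous.locallyIntegrable _).continuous) ?_
      refine ENNReal.sum_lt_top.mpr fun i _ => ENNReal.sum_lt_top.mpr fun ℓ _ => ?_
      obtain ⟨C', hC'0, hC'⟩ := exists_wt_cv_dilate_le hω hp (momentsVanish_zero (φ ℓ)) (hφR ℓ)
      refine lt_of_le_of_lt (hC' s s' hw _ ((hHs ℓ 0).ld _) 0)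
        (ENNReal.mul_lt_top ENNReal.ofReal_lt_top ?_)
      refine lt_of_le_of_lt (wt_mono (Sg_nonneg _ _) (Sg_mono (m' := L + d + 1) (by omega) _)) ?_
      exact (hB.wt_Sg_le hω hp (e := []) (by simp) 0 ℓ).trans_lt ENNReal.ofReal_lt_top
    · simp only [hinc', hinc]
      rw [← sum_sum_ofReal (fun i ℓ => by have := hC0 ℓ; positivity) (by positivity)]
      refine (wt_mul_sum_sum_le hω hp (norm_inv_four_pow_le j) (fun i ℓ =>
        (smooth_cv ((hHs ℓ j).ld _).continuous.locallyIntegrable _).continuous)).trans ?_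
      refine Finset.sum_le_sum fun i _ => Finset.sum_le_sum fun ℓ _ => ?_
      have hCℓ := hC0 ℓ
      refine (hC ℓ s s' hw _ ((hHs ℓ j).ld _) j).trans ?_
      refine (mul_le_mul_right (hB.wt_Sg_le hω hp (e := [i, i]) le_rfl j ℓ) _).trans (le_of_eq ?_)
      rw [← ENNReal.ofReal_mul (by positivity), ← two_rpow_mul_inv_pow]
      congr 1
      ring

/-! ### Necessity of the growth conditions for functions, and multi-indices -/

/-- The regularizations of a smooth function `g` are bounded, uniformly in `j`, in terms of finitely
many derivatives of `g`. -/
lemma exists_wt_ld_dconv_dilate_le (hω : Continuous ω) (hp : 1 ≤ p) (χ : Fin 2 → TF d) :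
    ∃ R : ℝ, ∀ (g : Eu d → ℂ) (f : Distr d), Smooth g → Represents g f →
      ∀ (l : List (Fin d)) (s s' : ℝ), (∀ x y, ‖y‖ ≤ R → s * ω x ≤ s' * ω (x + y)) →
      (∀ l' : List (Fin d), l'.length ≤ d + 1 → wt ω p s' (fun x => ‖ld (l' ++ l) g x‖) < ∞) →
      ∃ A : ℝ, 0 ≤ A ∧ ∀ (j : ℕ) (ℓ : Fin 2),
        wt ω p s (fun x => ‖ld l (dconv f (dilate (χ ℓ) j)) x‖) ≤ ENNReal.ofReal A := by
  choose R hR0 hR using fun ℓ => exists_tsupport_subset (χ ℓ)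
  choose C hC0 hC using fun ℓ =>
    exists_wt_cv_dilate_le hω hp (momentsVanish_zero (χ ℓ)) (hR ℓ)
  refine ⟨∑ ℓ, R ℓ + 1, fun g f hg hf l s s' hw hfin => ?_⟩
  set B : ℝ≥0∞ := ∑ l' : {l' : List (Fin d) // l'.length ≤ d + 1},
    wt ω p s' (fun x => ‖ld (l'.1 ++ l) g x‖) with hB
  have hBt : (1 + d : ℝ≥0∞) ^ (d + 1) * B < ∞ := by
    refine ENNReal.mul_lt_top (by finiteness) ?_
    exact ENNReal.sum_lt_top.mpr fun l' _ => hfin l'.1 l'.2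
  refine ⟨(∑ ℓ, C ℓ) * ((1 + d : ℝ≥0∞) ^ (d + 1) * B).toReal,
    mul_nonneg (Finset.sum_nonneg fun ℓ _ => hC0 ℓ) ENNReal.toReal_nonneg, fun j ℓ => ?_⟩
  rw [dconv_of_represents hf, ld_cv_left hg, ENNReal.ofReal_mul (Finset.sum_nonneg fun ℓ _ => hC0 ℓ),
    ENNReal.ofReal_toReal hBt.ne]
  have hRℓ : R ℓ ≤ ∑ ℓ, R ℓ := Finset.single_le_sum (fun ℓ _ => hR0 ℓ) (Finset.mem_univ ℓ)
  have hCℓ : C ℓ ≤ ∑ ℓ, C ℓ := Finset.single_le_sum (fun ℓ _ => hC0 ℓ) (Finset.mem_univ ℓ)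
  refine (hC ℓ s s' (fun x y hy => hw x y (by linarith)) _ (hg.ld l) j).trans
    (mul_le_mul' (ENNReal.ofReal_le_ofReal (by simpa using hCℓ)) ?_)
  rw [zero_add]
  refine wt_Sg_le hω hp (hg.ld l) fun l' hl' => ?_
  rw [← ld_append]
  have := Finset.single_le_sum (f := fun l' : {l' : List (Fin d) // l'.length ≤ d + 1} =>
    wt ω p s' (fun x => ‖ld (l'.1 ++ l) g x‖)) (fun _ _ => bot_le)
    (Finset.mem_univ ⟨l', hl'⟩)
  exact this

lemma exists_regBound {χ : Fin 2 → TF d} {f : Distr d} {m : ℕ} {r s : ℝ} {l : List (Fin d)}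
    (h : ∀ l' : List (Fin d), l'.length ≤ m → ∃ A : ℝ, 0 ≤ A ∧ ∀ (j : ℕ) (ℓ : Fin 2),
      wt ω p s (fun x => ‖ld (l' ++ l) (dconv f (dilate (χ ℓ) j)) x‖)
        ≤ ENNReal.ofReal (A * (2 : ℝ) ^ (r * j))) :
    ∃ A : ℝ, 0 ≤ A ∧ RegBound ω p χ f m r l s A := by
  choose A hA0 hA using fun l' : {l' : List (Fin d) // l'.length ≤ m} => h l'.1 l'.2
  refine ⟨∑ l' : {l' : List (Fin d) // l'.length ≤ m}, A l',
    Finset.sum_nonneg fun l' _ => hA0 l', fun l' hl' j ℓ =>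
    (hA ⟨l', hl'⟩ j ℓ).trans (ENNReal.ofReal_le_ofReal ?_)⟩
  gcongr
  exact Finset.single_le_sum (f := A) (fun l' _ => hA0 l')
    (Finset.mem_univ (⟨l', hl'⟩ : {l' : List (Fin d) // l'.length ≤ m}))

/-- The growth condition along all multi-indices, restated for derivatives along lists of
coordinates. The predicate `Q` stands for the quantifier over the weights, `∀ n` or `∃ n`. -/
lemma forall_iSup_pderiv_lt_top_iff {N : Type*} (χ : Fin 2 → TF d) (f : Distr d) (r : ℝ)
    (s : N → ℝ) (Q : (N → Prop) → Prop) :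
    (∀ α : Fin d → ℕ, Q fun n => (⨆ (j : ℕ) (ℓ : Fin 2), ENNReal.ofReal ((2 : ℝ) ^ (-(r * j))) *
      eLpNorm (fun x => pderiv α (dconv f (dilate (χ ℓ) j)) x * (Real.exp (s n * ω x) : ℂ))
        p volume) < ∞) ↔
    ∀ l : List (Fin d), Q fun n => ∃ A : ℝ, 0 ≤ A ∧ ∀ (j : ℕ) (ℓ : Fin 2),
      wt ω p (s n) (fun x => ‖ld l (dconv f (dilate (χ ℓ) j)) x‖)
        ≤ ENNReal.ofReal (A * (2 : ℝ) ^ (r * j)) := by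
  simp only [eLpNorm_mul_exp_eq_wt, iSup_lt_top_iff]
  constructor
  · intro h l
    simp only [ld_eq_pderiv (smooth_dconv _ _)]
    exact h _
  · intro h α
    simp only [pderiv_eq_ld]
    exact h _

/-! ### The characterizations -/

lemma exists_KSpace_iff (hω0 : ∀ x, 0 ≤ ω x) (hωc : Continuous ω)
    (hω : ∃ C : ℝ, 0 < C ∧ ∀ x y : Eu d, ‖y‖ ≤ 1 → ω (x + y) ≤ C * ω x) (hp : 1 ≤ p)
    {χ : Fin 2 → TF d} (hχ : MDFP χ) (f : Distr d) :
    (∃ g ∈ KSpace ω p, Represents g f) ↔ ∃ r : ℝ, 0 < r ∧ ∀ (l : List (Fin d)) (n : ℕ),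
      ∃ A : ℝ, 0 ≤ A ∧ ∀ (j : ℕ) (ℓ : Fin 2),
        wt ω p n (fun x => ‖ld l (dconv f (dilate (χ ℓ) j)) x‖)
          ≤ ENNReal.ofReal (A * (2 : ℝ) ^ (r * j)) := by
  have hwt : ∀ {R : ℝ} {κ : ℕ}, (∀ x y, ‖y‖ ≤ R → ω (x + y) ≤ κ * ω x ∧ ω x ≤ κ * ω (x + y)) →
      ∀ (n : ℕ) x y, ‖y‖ ≤ R → (n : ℝ) * ω x ≤ (n * κ : ℕ) * ω (x + y) := by
    intro R κ hκ n x y hy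
    push_cast
    rw [mul_assoc]
    exact mul_le_mul_of_nonneg_left (hκ x y hy).2 (Nat.cast_nonneg _)
  constructor
  · rintro ⟨g, hg, hf⟩
    rw [mem_KSpace_iff hωc] at hg
    obtain ⟨R, hR⟩ := exists_wt_ld_dconv_dilate_le hωc hp χ
    obtain ⟨κ, hκ⟩ := exists_weight_comparison hω0 hω R
    refine ⟨1, one_pos, fun l n => ?_⟩
    obtain ⟨A, hA, h⟩ := hR g f hg.1 hf l n (n * κ : ℕ) (hwt hκ n) fun l' _ => hg.2 _ _
    refine ⟨A, hA, fun j ℓ => (h j ℓ).trans (ENNReal.ofReal_le_ofReal ?_)⟩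
    exact le_mul_of_one_le_right hA (Real.one_le_rpow one_le_two (by positivity))
  · rintro ⟨r, -, h⟩
    obtain ⟨m, R, hm⟩ := exists_smooth_representative hωc hp hχ r
    obtain ⟨κ, hκ⟩ := exists_weight_comparison hω0 hω R
    have hreg : ∀ (n : ℕ) l, ∃ A : ℝ, 0 ≤ A ∧ RegBound ω p χ f m r l n A := fun n l =>
      exists_regBound fun l' _ => h _ n
    obtain ⟨g, hg, hgf, hw⟩ := hm f fun l => ⟨_, hreg 0 l⟩
    refine ⟨g, (mem_KSpace_iff hωc).mpr ⟨hg, fun n l => ?_⟩, hgf⟩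
    obtain ⟨A, hA, hreg⟩ := hreg (n * κ) l
    exact hw l n (n * κ : ℕ) A hA (hwt hκ n) hreg

lemma mem_ConvolutorSpace_iff (hω0 : ∀ x, 0 ≤ ω x) (hωc : Continuous ω)
    (hω : ∃ C : ℝ, 0 < C ∧ ∀ x y : Eu d, ‖y‖ ≤ 1 → ω (x + y) ≤ C * ω x) (hp : 1 ≤ p)
    {χ : Fin 2 → TF d} (hχ : MDFP χ) (f : Distr d) :
    f ∈ ConvolutorSpace ω p ↔ ∀ n : ℕ, ∃ r : ℝ, 0 < r ∧
      ∃ A : ℝ, 0 ≤ A ∧ ∀ (j : ℕ) (ℓ : Fin 2),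
        wt ω p n (fun x => ‖dconv f (dilate (χ ℓ) j) x‖)
          ≤ ENNReal.ofReal (A * (2 : ℝ) ^ (r * j)) := by
  constructor
  · intro hf n
    choose r hr using fun ℓ => exists_wt_dconv_dilate_le hωc hp hf n (χ ℓ)
    set N : ℕ := ∑ ℓ, r ℓ + 1 with hN
    refine ⟨N, by positivity, N, by positivity, fun j ℓ => (hr ℓ j).trans
      (ENNReal.ofReal_le_ofReal ?_)⟩
    have h1 : r ℓ ≤ N :=
      (Finset.single_le_sum (fun _ _ => Nat.zero_le _) (Finset.mem_univ ℓ)).trans (Nat.le_succ _)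
    have h2 : (2 : ℝ) ^ (r ℓ * j) ≤ (2 : ℝ) ^ ((N : ℝ) * j) := by
      rw [← Nat.cast_mul, Real.rpow_natCast]
      exact pow_le_pow_right₀ one_le_two (Nat.mul_le_mul_right _ h1)
    exact mul_le_mul (Nat.cast_le.mpr h1) h2 (by positivity) (by positivity)
  · intro h
    exact mem_ConvolutorSpace_of_wt_le hω0 hωc hω hp hχ fun n =>
      let ⟨r, _, A, hA, hle⟩ := h n
      ⟨r, A, hA, hle⟩

lemma exists_MultiplierSpace_iff (hω0 : ∀ x, 0 ≤ ω x) (hωc : Continuous ω)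
    (hω : ∃ C : ℝ, 0 < C ∧ ∀ x y : Eu d, ‖y‖ ≤ 1 → ω (x + y) ≤ C * ω x) (hp : 1 ≤ p)
    {χ : Fin 2 → TF d} (hχ : MDFP χ) (f : Distr d) :
    (∃ g ∈ MultiplierSpace ω p, Represents g f) ↔ ∃ r : ℝ, 0 < r ∧ ∀ l : List (Fin d), ∃ n : ℕ,
      ∃ A : ℝ, 0 ≤ A ∧ ∀ (j : ℕ) (ℓ : Fin 2),
        wt ω p (-n) (fun x => ‖ld l (dconv f (dilate (χ ℓ) j)) x‖)
          ≤ ENNReal.ofReal (A * (2 : ℝ) ^ (r * j)) := by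
  have hwt : ∀ {R : ℝ} {κ : ℕ}, (∀ x y, ‖y‖ ≤ R → ω (x + y) ≤ κ * ω x ∧ ω x ≤ κ * ω (x + y)) →
      ∀ (n : ℕ) x y, ‖y‖ ≤ R → -((n * κ : ℕ) : ℝ) * ω x ≤ -(n : ℝ) * ω (x + y) := by
    intro R κ hκ n x y hy
    push_cast
    have := mul_le_mul_of_nonneg_left (hκ x y hy).1 (Nat.cast_nonneg n (α := ℝ))
    linarith
  have hmono : ∀ {n n' : ℕ}, n ≤ n' → ∀ x, -(n' : ℝ) * ω x ≤ -(n : ℝ) * ω x := by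
    intro n n' h x
    exact mul_le_mul_of_nonneg_right (neg_le_neg (Nat.cast_le.mpr h)) (hω0 x)
  constructor
  · rintro ⟨g, hg, hf⟩
    obtain ⟨R, hR⟩ := exists_wt_ld_dconv_dilate_le hωc hp χ
    obtain ⟨κ, hκ⟩ := exists_weight_comparison hω0 hω R
    choose n hn using MultiplierSpace.exists_wt_lt_top hω0 hωc hω hp hg
    refine ⟨1, one_pos, fun l => ?_⟩
    set N : ℕ := ∑ l' : {l' : List (Fin d) // l'.length ≤ d + 1}, n (l'.1 ++ l) with hN
    refine ⟨N * κ, ?_⟩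
    obtain ⟨A, hA, h⟩ := hR g f hg.1 hf l _ (-(N : ℝ)) (hwt hκ N) fun l' hl' =>
      lt_of_le_of_lt (wt_mono_weight (hmono (Finset.single_le_sum
        (f := fun l' : {l' : List (Fin d) // l'.length ≤ d + 1} => n (l'.1 ++ l))
        (fun _ _ => Nat.zero_le _) (Finset.mem_univ ⟨l', hl'⟩)))) (hn (l' ++ l))
    refine ⟨A, hA, fun j ℓ => (h j ℓ).trans (ENNReal.ofReal_le_ofReal ?_)⟩
    exact le_mul_of_one_le_right hA (Real.one_le_rpow one_le_two (by positivity))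
  · rintro ⟨r, -, h⟩
    choose n A hA0 hA using h
    obtain ⟨m, R, hm⟩ := exists_smooth_representative hωc hp hχ r
    obtain ⟨κ, hκ⟩ := exists_weight_comparison hω0 hω R
    have hreg : ∀ l, ∃ (N : ℕ) (A : ℝ), 0 ≤ A ∧ RegBound ω p χ f m r l (-N) A := fun l => by
      refine ⟨∑ l' : {l' : List (Fin d) // l'.length ≤ m}, n (l'.1 ++ l),
        exists_regBound fun l' hl' => ⟨A (l' ++ l), hA0 _, fun j ℓ =>
          (wt_mono_weight (hmono ?_)).trans (hA (l' ++ l) j ℓ)⟩⟩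
      exact Finset.single_le_sum
        (f := fun l' : {l' : List (Fin d) // l'.length ≤ m} => n (l'.1 ++ l))
        (fun _ _ => Nat.zero_le _) (Finset.mem_univ ⟨l', hl'⟩)
    obtain ⟨g, hg, hgf, hw⟩ := hm f fun l => (hreg l).elim fun N hN => ⟨-N, hN⟩
    refine ⟨g, mem_MultiplierSpace_of_wt_lt_top hωc hp hg fun l => ?_, hgf⟩
    obtain ⟨N, B, hB, hreg⟩ := hreg l
    exact ⟨N * κ, hw l _ _ B hB (hwt hκ N) hreg⟩

end Mollif

end

theorem theorem1p1 {d : ℕ} (p : ℝ≥0∞) (hp : 1 ≤ p)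
    (ω : Mollif.Eu d → ℝ) (hω_nonneg : ∀ x, 0 ≤ ω x) (hω_cont : Continuous ω)
    (hω : ∃ C : ℝ, 0 < C ∧ ∀ x y : Mollif.Eu d, ‖y‖ ≤ 1 → ω (x + y) ≤ C * ω x)
    (χ : Fin 2 → Mollif.TF d) (hχ : Mollif.MDFP χ) (f : Mollif.Distr d) :
    ((∃ g ∈ Mollif.KSpace ω p, Mollif.Represents g f) ↔
      ∃ r : ℝ, 0 < r ∧ ∀ (n : ℕ) (α : Fin d → ℕ),
        (⨆ (j : ℕ) (ℓ : Fin 2), ENNReal.ofReal ((2 : ℝ) ^ (-(r * j))) *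
          eLpNorm (fun x => Mollif.pderiv α (Mollif.dconv f (Mollif.dilate (χ ℓ) j)) x *
            (Real.exp (n * ω x) : ℂ)) p volume) < ∞) ∧
    (f ∈ Mollif.ConvolutorSpace ω p ↔
      ∀ n : ℕ, ∃ r : ℝ, 0 < r ∧
        (⨆ (j : ℕ) (ℓ : Fin 2), ENNReal.ofReal ((2 : ℝ) ^ (-(r * j))) *
          eLpNorm (fun x => Mollif.dconv f (Mollif.dilate (χ ℓ) j) x *
            (Real.exp (n * ω x) : ℂ)) p volume) < ∞) ∧
    ((∃ g ∈ Mollif.MultiplierSpace ω p, Mollif.Represents g f) ↔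
      ∃ r : ℝ, 0 < r ∧ ∀ α : Fin d → ℕ, ∃ n : ℕ,
        (⨆ (j : ℕ) (ℓ : Fin 2), ENNReal.ofReal ((2 : ℝ) ^ (-(r * j))) *
          eLpNorm (fun x => Mollif.pderiv α (Mollif.dconv f (Mollif.dilate (χ ℓ) j)) x *
            (Real.exp (-(n * ω x)) : ℂ)) p volume) < ∞) := by
  refine ⟨?_, ?_, ?_⟩
  · rw [Mollif.exists_KSpace_iff hω_nonneg hω_cont hω hp hχ f]
    refine exists_congr fun r => and_congr_right fun _ => ?_
    rw [forall_comm (α := ℕ)]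
    exact (Mollif.forall_iSup_pderiv_lt_top_iff χ f r (fun n : ℕ => (n : ℝ))
      (fun P => ∀ n, P n)).symm
  · rw [Mollif.mem_ConvolutorSpace_iff hω_nonneg hω_cont hω hp hχ f]
    simp only [Mollif.eLpNorm_mul_exp_eq_wt, Mollif.iSup_lt_top_iff]
  · rw [Mollif.exists_MultiplierSpace_iff hω_nonneg hω_cont hω hp hχ f]
    refine exists_congr fun r => and_congr_right fun _ => ?_
    simp only [← neg_mul (Nat.cast _ : ℝ) (ω _)]
    exact (Mollif.forall_iSup_pderiv_lt_top_iff χ f r (fun n : ℕ => -(n : ℝ))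
      (fun P => ∃ n, P n)).symm
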